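/- Let $m\ge 0$. A germ of analytic family of vector fields is $X(x;\lambda)=f(x,\lambda)\frac{\partial}{\partial x}$ with $f$ analytic near $(0,0)\in\mathbb C\times\mathbb C^m$. Two such germs $X=f\frac{\partial}{\partial x}$, $X'=f'\frac{\partial}{\partial x}$ with the same parameter $\lambda$ are conjugate by $\phi$ if $\phi(x,\lambda)$ is analytic near $(0,0)$ with $\phi(0,0)=0$, $\frac{\partial\phi}{\partial x}(0,0)\neq0$, and $f'(\phi(x,\lambda),\lambda)=\frac{\partial\phi}{\partial x}(x,\lambda)\,f(x,\lambda)$ near $(0,0)$, i.e. $X=\phi^*X'$. (i) Let $k\ge0$, let $\omega$ be analytic near $0$ with $\omega(0)\ne0$, and let $\tilde X(x;\lambda)$ be a germ of analytic family with $\tilde X(x;0)=\frac{x^{k+1}}{\omega(x)}\frac{\partial}{\partial x}$. Then $\tilde X$ is analytically conjugate to a family of the form $$X(x;\lambda)=c(\lambda)\,x\frac{\partial}{\partial x}\quad(k=0),\qquad X(x;\lambda)=\frac{x^{k+1}+y_{k-1}(\lambda)x^{k-1}+\dots+y_0(\lambda)}{1+\mu(\lambda)x^k}\frac{\partial}{\partial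 x}\quad(k\ge1),$$ where $c$, respectively $y_0,\dots,y_{k-1},\mu$, are analytic germs at $\lambda=0$ with $c(0)\neq0$, respectively $y_0(0)=\dots=y_{k-1}(0)=0$; for $k\ge1$, moreover, $\mu(\lambda)=-\mathrm{Res}_{x=\infty}X(x;\lambda)^{-1}$, and it is the sum of the residues of the dual form $\tilde X(x;\lambda)^{-1}$ over its local polar locus around the origin (in every sufficiently small disc $|x|<r$ and for all $\lambda$ sufficiently close to $0$, depending on $r$, this locus is finite and the sum of residues over it is $\mu(\lambda)$). (ii) For $k=0$ the normal form of a family, with $c(0)\ne0$, is unique as a germ: two normal forms of the same family have the same $c$. For $k\ge1$ the normal form is unique up to the action of $x\mapsto e^{2\pi i l/k}x$, $l\in\mathbb Z/k\mathbb Z$: if a family is conjugate to the normal form with coefficients $(y,\mu)$, then it is conjugate to the normal form with coefficients $(y',\mu')$ if and only if, for some $l$, as germs at $\lambda=0$, $\mu'=\mu$ and $y'_j=e^{-2\pi i(j-1)l/k}y_j$ for $j=0,\dots,k-1$ (in particular it is unique for $k=1$). More precisely, if $x\mapsto\phi(x,\lambda)$ is a conjugacy, fixing $\lambda$, from a normal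 form $X$ to a normal form $X'$, then there is an analytic germ $t(\lambda)$ such that, near $(0,0)$, $$\phi(x,\lambda)=e^{t(\lambda)}x\ \text{ if }k=0,\qquad \phi(x,\lambda)=e^{2\pi i l/k}\,\exp\bigl(t(\lambda)X\bigr)(x;\lambda)\ \text{ if }k\ge1,$$ for some $l\in\mathbb Z/k\mathbb Z$ for which $X'$ is the image of $X$ under the above action of $l$, where $\exp(t(\lambda)X)(x;\lambda)$ is the flow map of $X$ at the complex time $t(\lambda)$. -/

import Mathlib

open Filter Topology Complex

noncomputable section

namespace Kostov

/-! A germ at the origin of a family of vector fields `X(x;lam) = f (x, lam) ∂/∂x`, with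
`lam` in `ℂ^m`, is represented by its coefficient `f : ℂ × (Fin m → ℂ) → ℂ`, analytic at `0`. -/

/-- The family `f` unfolds the vector field `x ^ (k + 1) / ω(x) ∂/∂x`. -/
def Unfolds {m : ℕ} (f : ℂ × (Fin m → ℂ) → ℂ) (k : ℕ) (ω : ℂ → ℂ) : Prop :=
  AnalyticAt ℂ f 0 ∧ ∀ᶠ x in 𝓝 (0 : ℂ), f (x, 0) = x ^ (k + 1) / ω x

/-- The germ of change of coordinate `x' = φ(x;lam)`, fixing the parameter, changes the family `f`
into the family `g`, that is, `f ∂/∂x` is the pullback of `g ∂/∂x'` by `φ`. The germ `φ` preserves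
the origin for `lam = 0` only. -/
structure IsConjugacy {m : ℕ} (f g φ : ℂ × (Fin m → ℂ) → ℂ) : Prop where
  analytic : AnalyticAt ℂ φ 0
  map_zero : φ 0 = 0
  invertible : deriv (fun x => φ (x, 0)) 0 ≠ 0
  conj : ∀ᶠ p in 𝓝 (0 : ℂ × (Fin m → ℂ)),
    g (φ p, p.2) = deriv (fun x => φ (x, p.2)) p.1 * f p

/-- The germs of families `f` and `g` are analytically conjugate. -/
def AreConjugate {m : ℕ} (f g : ℂ × (Fin m → ℂ) → ℂ) : Prop :=
  ∃ φ : ℂ × (Fin m → ℂ) → ℂ, IsConjugacy f g φ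

/-- The family `c(lam) x ∂/∂x`. -/
def linearForm {m : ℕ} (c : (Fin m → ℂ) → ℂ) (p : ℂ × (Fin m → ℂ)) : ℂ :=
  c p.2 * p.1

/-- The family `(x ^ (k + 1) + y_{k-1}(lam) x ^ (k-1) + … + y_0(lam)) / (1 + μ(lam) x ^ k) ∂/∂x`. -/
def normalForm {m k : ℕ} (y : Fin k → (Fin m → ℂ) → ℂ) (μ : (Fin m → ℂ) → ℂ)
    (p : ℂ × (Fin m → ℂ)) : ℂ :=
  (p.1 ^ (k + 1) + ∑ j : Fin k, y j p.2 * p.1 ^ (j : ℕ)) / (1 + μ p.2 * p.1 ^ k)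

/-- Admissible coefficient of the linear normal form. -/
def IsLinearCoeff {m : ℕ} (c : (Fin m → ℂ) → ℂ) : Prop :=
  AnalyticAt ℂ c 0 ∧ c 0 ≠ 0

/-- Admissible coefficients of the normal form for `1 ≤ k`. -/
def IsNormalCoeffs {m k : ℕ} (y : Fin k → (Fin m → ℂ) → ℂ) (μ : (Fin m → ℂ) → ℂ) : Prop :=
  (∀ j, AnalyticAt ℂ (y j) 0 ∧ y j 0 = 0) ∧ AnalyticAt ℂ μ 0

/-- The residue at `a` of `g(z) dz`, for `g` holomorphic on a punctured neighbourhood of `a`; the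
normalised integral over the circle of radius `r` is then constant for small `r > 0`. -/
def residue (g : ℂ → ℂ) (a : ℂ) : ℂ :=
  limUnder (𝓝[>] (0 : ℝ))
    (fun r => (2 * (Real.pi : ℂ) * I)⁻¹ * circleIntegral g a r)

/-- The residue at infinity of `g(z) dz`, computed in the coordinate `w = 1 / z`. -/
def residueAtInfinity (g : ℂ → ℂ) : ℂ :=
  residue (fun w => -(w ^ 2)⁻¹ * g w⁻¹) 0

/-- The poles in the disc of radius `r` of the dual form `dx / f (x, lam)`. -/
def polarLocus {m : ℕ} (f : ℂ × (Fin m → ℂ) → ℂ) (r : ℝ) (lam : Fin m → ℂ) : Set ℂ :=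
  {x | ‖x‖ < r ∧ f (x, lam) = 0}

/-- `μ(lam)` is the sum of the residues of the dual form of the family `f` over its local polar
locus around the origin: in every small enough disc, for `lam` close enough to `0`. -/
def IsResidueSum {m : ℕ} (f : ℂ × (Fin m → ℂ) → ℂ) (μ : (Fin m → ℂ) → ℂ) : Prop :=
  ∀ᶠ r in 𝓝[>] (0 : ℝ), ∀ᶠ lam in 𝓝 (0 : Fin m → ℂ),
    (polarLocus f r lam).Finite ∧
      μ lam = ∑ᶠ a ∈ polarLocus f r lam, residue (fun x => (f (x, lam))⁻¹) a

/-- The germ `Ψ` is `exp(t(lam) X)(x;lam)`, the flow map of the family `X = f ∂/∂x` at the complex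
time `t(lam)`, that is, the time-one map of `t(lam) X`: for `(x, lam)` close to the origin there is
an integral curve of `t(lam) X` on `[0, 1]` from `x` to `Ψ (x, lam)`, inside any prescribed
neighbourhood of the origin (so that only the germ of `f` matters and the curve is unique). -/
def IsFlowMap {m : ℕ} (f : ℂ × (Fin m → ℂ) → ℂ) (t : (Fin m → ℂ) → ℂ)
    (Ψ : ℂ × (Fin m → ℂ) → ℂ) : Prop :=
  ∀ V ∈ 𝓝 (0 : ℂ), ∀ᶠ p in 𝓝 (0 : ℂ × (Fin m → ℂ)), ∃ γ : ℝ → ℂ,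
    γ 0 = p.1 ∧ γ 1 = Ψ p ∧ ∀ s ∈ Set.Icc (0 : ℝ) 1,
      γ s ∈ V ∧ HasDerivWithinAt γ (t p.2 * f (γ s, p.2)) (Set.Icc (0 : ℝ) 1) s

/-- The coefficients `(y', μ')` are the image of `(y, μ)` under the action of the class of `l` in
`ℤ/kℤ`: `y_j ↦ exp(-2πi (j-1) l / k) y_j`, with `μ` fixed. -/
def IsRotated {m k : ℕ} (l : Fin k) (y : Fin k → (Fin m → ℂ) → ℂ) (μ : (Fin m → ℂ) → ℂ)
    (y' : Fin k → (Fin m → ℂ) → ℂ) (μ' : (Fin m → ℂ) → ℂ) : Prop :=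
  ∀ᶠ lam in 𝓝 (0 : Fin m → ℂ), μ' lam = μ lam ∧ ∀ j : Fin k,
    y' j lam =
      exp (-(2 * (Real.pi : ℂ) * I * (((j : ℕ) : ℂ) - 1) * ((l : ℕ) : ℂ) / (k : ℂ))) * y j lam

end Kostov

end

/-! Existence comes from the implicit function theorem in a Banach algebra of power series. Let
`A` be the algebra of the series `∑ aₙ Xⁿ` with `∑ ‖aₙ‖ < ∞`. A conjugacy `φ` of `f` with the
normal form satisfies `f φ' (1 + μ φ ^ k) = φ ^ (k + 1) + ∑ yⱼ φ ^ j`, and with the unknowns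
`v = φ'`, `b = φ(0)`, `yⱼ`, `μ` this is an equation between analytic functions on `A`, with no
loss of derivative. At `f = X ^ (k + 1)`, `φ = X` its linearisation is solved coefficient by
coefficient: it is onto, with a kernel of dimension one spanned by the infinitesimal flow
`X ^ (k + 1)`. Hence near this point the solutions form a graph over `f` and the coefficient of
`X ^ k` in `v` (`exists_conjDefect_solution`, `conjDefect_solution_unique`). A germ of family is
brought close to `X ^ (k + 1)` by a dilation of `x`, and it then depends analytically on the
parameter as an element of `A` (`exists_series`). For the parameter `0`, counting orders of
vanishing shows that `y = 0` and `φ(0) = 0`.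

For the residues, the dual form `(1 + μ z ^ k) / P(z) dz` of the normal form has partial
fractions with simple poles whose coefficients add up to `μ`, plus a derivative
(`hasSimpleParts_pow_div_rootProd`). A derivative has no residue, also after pull-back by a
conjugacy, so that no care is needed for multiple roots (`hasResidue_comp`,
`IsConjugacy.isResidueSum`). The residue at infinity is that of a simple pole
(`residueAtInfinity_normalForm`).

For uniqueness, a conjugacy between normal forms is made tangent to the identity by a rotation
(`IsConjugacy.pderiv_pow_eq_one`). The flow of the normal form is constructed in `A`, again by
the implicit function theorem, and it is a self-conjugacy (`IsFlowVelocity.flow_conj`). For the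
parameter `0` it is `x + t x ^ (k + 1) + ⋯`, so a time `t(λ)` can be chosen for which it has the
same coefficient of `x ^ k` in its derivative as the given conjugacy. The uniqueness of the
solution of the conjugacy equation with this coefficient gives the equality of the two maps and
of the two normal forms at once (`IsConjugacy.exists_flow`). -/

noncomputable section

namespace Kostov

/-! ### The algebra of absolutely summable power series -/

/-- The subalgebra of the formal power series `∑ aₙ Xⁿ` with `∑ ‖aₙ‖ < ∞`. -/
def absSeriesSubalgebra : Subalgebra ℂ (PowerSeries ℂ) where
  carrier := {a | Summable fun n => ‖PowerSeries.coeff n a‖}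
  mul_mem' {a b} ha hb := by
    simpa only [Set.mem_ofPred_eq, PowerSeries.coeff_mul] using
      summable_norm_sum_mul_antidiagonal_of_summable_norm ha hb
  add_mem' {a b} ha hb := by
    simp only [Set.mem_ofPred_eq, map_add] at *
    exact (ha.add hb).of_nonneg_of_le (fun _ => norm_nonneg _) fun n => norm_add_le _ _
  algebraMap_mem' r := by
    refine summable_of_ne_finset_zero (s := {0}) fun n hn => ?_
    simp only [Finset.mem_singleton] at hn
    simp [PowerSeries.coeff_C, hn]

/-- The algebra of the power series `∑ aₙ Xⁿ` with `∑ ‖aₙ‖ < ∞`; it is a Banach algebra for the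
norm `∑ ‖aₙ‖`, and its elements define holomorphic functions on the unit disc. -/
def AbsSeries : Type := absSeriesSubalgebra

namespace AbsSeries

instance : CommRing AbsSeries := inferInstanceAs (CommRing absSeriesSubalgebra)
instance : Algebra ℂ AbsSeries := inferInstanceAs (Algebra ℂ absSeriesSubalgebra)

/-- The coefficient of `Xⁿ`, as a linear form. -/
def coeffₗ (n : ℕ) : AbsSeries →ₗ[ℂ] ℂ :=
  (PowerSeries.coeff n) ∘ₗ absSeriesSubalgebra.val.toLinearMap

/-- The series with given summable coefficients. -/
def mk (a : ℕ → ℂ) (ha : Summable fun n => ‖a n‖) : AbsSeries :=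
  ⟨PowerSeries.mk a, by simpa [absSeriesSubalgebra] using ha⟩

@[simp] lemma coeffₗ_mk (a : ℕ → ℂ) (ha) (n : ℕ) : coeffₗ n (mk a ha) = a n :=
  PowerSeries.coeff_mk n a

@[ext] lemma ext {a b : AbsSeries} (h : ∀ n, coeffₗ n a = coeffₗ n b) : a = b :=
  Subtype.ext (PowerSeries.ext h)

lemma summable_norm_coeffₗ (a : AbsSeries) : Summable fun n => ‖coeffₗ n a‖ := a.2

lemma coeffₗ_mul (n : ℕ) (a b : AbsSeries) :
    coeffₗ n (a * b) = ∑ p ∈ Finset.HasAntidiagonal.antidiagonal n, coeffₗ p.1 a * coeffₗ p.2 b :=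
  PowerSeries.coeff_mul n a.1 b.1

lemma coeffₗ_one (n : ℕ) : coeffₗ n 1 = if n = 0 then 1 else 0 :=
  PowerSeries.coeff_one n

lemma coeffₗ_algebraMap (n : ℕ) (c : ℂ) :
    coeffₗ n (algebraMap ℂ AbsSeries c) = if n = 0 then c else 0 := by
  rw [Algebra.algebraMap_eq_smul_one, map_smul, coeffₗ_one]
  split_ifs <;> simp

/-- The norm `‖a‖ = ∑ ‖aₙ‖`. -/
def ringNorm : RingNorm AbsSeries where
  toFun a := ∑' n, ‖coeffₗ n a‖
  map_zero' := by simp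
  add_le' a b := by
    rw [← a.summable_norm_coeffₗ.tsum_add b.summable_norm_coeffₗ]
    refine (a + b).summable_norm_coeffₗ.tsum_le_tsum (fun n => ?_)
      (a.summable_norm_coeffₗ.add b.summable_norm_coeffₗ)
    rw [map_add]
    exact norm_add_le _ _
  neg' a := by simp
  mul_le' a b := by
    have ha := a.summable_norm_coeffₗ
    have hb := b.summable_norm_coeffₗ
    have hs := summable_norm_sum_mul_antidiagonal_of_summable_norm ha.norm hb.norm
    rw [tsum_mul_tsum_eq_tsum_sum_antidiagonal_of_summable_norm ha.norm hb.norm]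
    refine (a * b).summable_norm_coeffₗ.tsum_le_tsum (fun n => ?_) hs.of_norm
    rw [coeffₗ_mul]
    exact (norm_sum_le _ _).trans (by simp)
  eq_zero_of_map_eq_zero' a h := by
    ext n
    rw [map_zero, ← norm_le_zero_iff, ← h]
    exact a.summable_norm_coeffₗ.le_tsum n fun _ _ => norm_nonneg _

instance : NormedCommRing AbsSeries :=
  { ringNorm.toNormedRing, (inferInstance : CommRing AbsSeries) with }

lemma norm_def (a : AbsSeries) : ‖a‖ = ∑' n, ‖coeffₗ n a‖ := rfl

lemma norm_coeffₗ_le (n : ℕ) (a : AbsSeries) : ‖coeffₗ n a‖ ≤ ‖a‖ :=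
  a.summable_norm_coeffₗ.le_tsum n fun _ _ => norm_nonneg _

instance : NormedAlgebra ℂ AbsSeries where
  norm_smul_le c a := by
    refine le_of_eq ?_
    rw [norm_def, norm_def, ← tsum_mul_left]
    simp

/-- The coefficient of `Xⁿ`, as a continuous linear form. -/
def coeff (n : ℕ) : AbsSeries →L[ℂ] ℂ :=
  (coeffₗ n).mkContinuous 1 fun a => by simpa using norm_coeffₗ_le n a

lemma coeff_eq_coeffₗ (n : ℕ) (a : AbsSeries) : coeff n a = coeffₗ n a := rfl

@[simp] lemma coeff_mk (a : ℕ → ℂ) (ha) (n : ℕ) : coeff n (mk a ha) = a n := coeffₗ_mk a ha n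

lemma ext_coeff {a b : AbsSeries} (h : ∀ n, coeff n a = coeff n b) : a = b := ext h

lemma summable_norm_coeff (a : AbsSeries) : Summable fun n => ‖coeff n a‖ := a.2

lemma norm_eq (a : AbsSeries) : ‖a‖ = ∑' n, ‖coeff n a‖ := rfl

lemma norm_coeff_le (n : ℕ) : ‖coeff n‖ ≤ 1 :=
  LinearMap.mkContinuous_norm_le _ zero_le_one _

lemma coeff_mul (n : ℕ) (a b : AbsSeries) :
    coeff n (a * b) = ∑ p ∈ Finset.HasAntidiagonal.antidiagonal n, coeff p.1 a * coeff p.2 b :=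
  coeffₗ_mul n a b

lemma coeff_one (n : ℕ) : coeff n (1 : AbsSeries) = if n = 0 then 1 else 0 := coeffₗ_one n

/-- A linear isometry onto `ℓ¹`, which gives completeness. -/
def toLp : AbsSeries ≃ₗᵢ[ℂ] lp (fun _ : ℕ => ℂ) 1 where
  toFun a := ⟨fun n => coeff n a,
    (memℓp_gen_iff (E := fun _ : ℕ => ℂ) (by simp)).2 (by simpa using a.summable_norm_coeff)⟩
  invFun b := mk b (by
    have := lp.memℓp b
    rw [memℓp_gen_iff (by simp)] at this
    simpa using this)
  map_add' a b := by ext n; exact map_add (coeff n) a b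
  map_smul' c a := by ext n; exact map_smul (coeff n) c a
  left_inv a := by apply ext_coeff; intro n; simp
  right_inv b := by ext n; simp
  norm_map' a := by
    rw [lp.norm_eq_tsum_rpow (by simp), norm_eq]
    simp

instance : CompleteSpace AbsSeries :=
  toLp.toIsometryEquiv.completeSpace_iff.2 inferInstance

instance : NormOneClass AbsSeries := ⟨by
  rw [norm_eq, tsum_eq_single 0]
  · simp [coeff_one]
  · intro n hn
    simp [coeff_one, hn]⟩

/-- The operator `(aₙ) ↦ (tₙ a_{n+d})`, for a bounded sequence of weights `t`. -/
def wshift (t : ℕ → ℂ) (d : ℕ) (C : ℝ) (ht : ∀ n, ‖t n‖ ≤ C) : AbsSeries →L[ℂ] AbsSeries :=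
  have key (a : AbsSeries) (n : ℕ) : ‖t n * coeff (n + d) a‖ ≤ C * ‖coeff (n + d) a‖ := by
    rw [norm_mul]
    exact mul_le_mul_of_nonneg_right (ht n) (norm_nonneg _)
  have hs (a : AbsSeries) : Summable fun n => C * ‖coeff (n + d) a‖ :=
    ((summable_nat_add_iff d).2 a.summable_norm_coeff).mul_left C
  LinearMap.mkContinuous
    { toFun := fun a => mk (fun n => t n * coeff (n + d) a)
        ((hs a).of_nonneg_of_le (fun _ => norm_nonneg _) (key a))
      map_add' := fun a b => by apply ext_coeff; intro n; simp [mul_add]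
      map_smul' := fun c a => by apply ext_coeff; intro n; simp [mul_left_comm] } C fun a => by
    have hC : 0 ≤ C := (norm_nonneg _).trans (ht 0)
    rw [norm_eq, norm_eq]
    calc _ ≤ ∑' n, C * ‖coeff (n + d) a‖ := by
          refine Summable.tsum_le_tsum (fun n => ?_)
            ((hs a).of_nonneg_of_le (fun _ => norm_nonneg _) ?_) (hs a)
          · simpa using key a n
          · intro n; simpa using key a n
      _ = C * ∑' n, ‖coeff (n + d) a‖ := tsum_mul_left
      _ ≤ _ := by
          refine mul_le_mul_of_nonneg_left ?_ hC
          rw [← a.summable_norm_coeff.sum_add_tsum_nat_add d]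
          exact le_add_of_nonneg_left (Finset.sum_nonneg fun _ _ => norm_nonneg _)

@[simp] lemma coeff_wshift (t d C ht) (a : AbsSeries) (n : ℕ) :
    coeff n (wshift t d C ht a) = t n * coeff (n + d) a := by
  simp [wshift]

/-- The series `X`. -/
def X : AbsSeries := mk (fun n => if n = 1 then 1 else 0)
  (summable_of_ne_finset_zero (s := {1}) fun n hn => by simp at hn; simp [hn])

lemma coeff_zero_X_mul (a : AbsSeries) : coeff 0 (X * a) = 0 := by
  rw [coeff_mul]; simp [X]

lemma coeff_succ_X_mul (a : AbsSeries) (n : ℕ) : coeff (n + 1) (X * a) = coeff n a := by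
  rw [coeff_mul, Finset.sum_eq_single (1, n)]
  · simp [X]
  · rintro ⟨i, j⟩ hij hne
    rcases eq_or_ne i 1 with rfl | hi
    · exact absurd (by simp at hij; simp; omega) hne
    · simp [X, hi]
  · intro h
    simp [add_comm] at h

lemma coeff_X_pow_mul (d n : ℕ) (a : AbsSeries) :
    coeff n (X ^ d * a) = if d ≤ n then coeff (n - d) a else 0 := by
  induction d generalizing n with
  | zero => simp
  | succ d ih =>
    rw [pow_succ', mul_assoc]
    cases n with
    | zero => simp [coeff_zero_X_mul]
    | succ n => simp [coeff_succ_X_mul, ih]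

lemma coeff_X_pow (d n : ℕ) : coeff n (X ^ d) = if n = d then 1 else 0 := by
  have := coeff_X_pow_mul d n 1
  rw [mul_one, coeff_one] at this
  rw [this]
  split_ifs <;> first | rfl | omega

/-- The primitive vanishing at the origin. -/
def integral : AbsSeries →L[ℂ] AbsSeries :=
  (ContinuousLinearMap.mul ℂ AbsSeries X) ∘L wshift (fun n => ((n : ℂ) + 1)⁻¹) 0 1 fun n => by
    rw [norm_inv]
    refine inv_le_one_of_one_le₀ ?_
    have : ((n : ℂ) + 1) = ((n + 1 : ℕ) : ℂ) := by push_cast; rfl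
    rw [this, Complex.norm_natCast]
    simp

lemma coeff_integral_zero (a : AbsSeries) : coeff 0 (integral a) = 0 := by
  simp [integral, coeff_zero_X_mul]

lemma coeff_integral_succ (a : AbsSeries) (n : ℕ) :
    coeff (n + 1) (integral a) = ((n : ℂ) + 1)⁻¹ * coeff n a := by
  simp [integral, coeff_succ_X_mul]

/-- The dilation `a(X) ↦ a(s X)`, for `‖s‖ ≤ 1`. -/
def dilate (s : ℂ) (hs : ‖s‖ ≤ 1) : AbsSeries →L[ℂ] AbsSeries :=
  wshift (fun n => s ^ n) 0 1 fun n => by rw [norm_pow]; exact pow_le_one₀ (norm_nonneg _) hs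

@[simp] lemma coeff_dilate (s hs) (a : AbsSeries) (n : ℕ) :
    coeff n (dilate s hs a) = s ^ n * coeff n a := by simp [dilate]

lemma norm_dilate_sub_le (s hs) (a : AbsSeries) :
    ‖dilate s hs a - algebraMap ℂ AbsSeries (coeff 0 a)‖ ≤ ‖s‖ * ‖a‖ := by
  rw [norm_eq, norm_eq, ← tsum_mul_left]
  refine (summable_norm_coeff _).tsum_le_tsum (fun n => ?_) (a.summable_norm_coeff.mul_left _)
  have := coeffₗ_algebraMap n (coeff 0 a)
  rw [map_sub, coeff_dilate, coeff_eq_coeffₗ n (algebraMap _ _ _), this]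
  cases n with
  | zero => simp; positivity
  | succ n =>
    simp only [Nat.add_eq_zero_iff, one_ne_zero, and_false, if_false, sub_zero, norm_mul, norm_pow]
    refine mul_le_mul_of_nonneg_right ?_ (norm_nonneg _)
    rw [pow_succ]
    exact mul_le_of_le_one_left (norm_nonneg _) (pow_le_one₀ (norm_nonneg _) hs)

/-! ### Evaluation on the unit disc -/

/-- Evaluation at a point of the open unit disc, as a continuous linear form; a junk value is
taken outside of the disc. -/
def ev (x : ℂ) : AbsSeries →L[ℂ] ℂ := ∑' n, x ^ n • coeff n

lemma summable_ev {x : ℂ} (hx : ‖x‖ < 1) : Summable fun n => x ^ n • coeff n := by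
  refine Summable.of_norm_bounded (g := fun n => ‖x‖ ^ n)
    (summable_geometric_of_lt_one (norm_nonneg _) hx) fun n => ?_
  rw [norm_smul, norm_pow]
  exact mul_le_of_le_one_right (by positivity) (norm_coeff_le n)

lemma hasSum_ev {x : ℂ} (hx : ‖x‖ < 1) (a : AbsSeries) :
    HasSum (fun n => x ^ n * coeff n a) (ev x a) := by
  have := (ContinuousLinearMap.apply ℂ ℂ a).hasSum (summable_ev hx).hasSum
  simpa [ev] using this

lemma summable_norm_ev {x : ℂ} (hx : ‖x‖ < 1) (a : AbsSeries) :
    Summable (fun n => ‖x ^ n * coeff n a‖) := by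
  refine a.summable_norm_coeff.of_nonneg_of_le (fun _ => norm_nonneg _) fun n => ?_
  rw [norm_mul, norm_pow]
  exact mul_le_of_le_one_left (norm_nonneg _) (pow_le_one₀ (norm_nonneg _) hx.le)

lemma norm_ev_le {x : ℂ} (hx : ‖x‖ < 1) (a : AbsSeries) : ‖ev x a‖ ≤ ‖a‖ := by
  rw [← (hasSum_ev hx a).tsum_eq]
  refine (norm_tsum_le_tsum_norm (summable_norm_ev hx a)).trans ?_
  refine (summable_norm_ev hx a).tsum_le_tsum (fun n => ?_) a.summable_norm_coeff
  rw [norm_mul, norm_pow]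
  exact mul_le_of_le_one_left (norm_nonneg _) (pow_le_one₀ (norm_nonneg _) hx.le)

lemma ev_mul {x : ℂ} (hx : ‖x‖ < 1) (a b : AbsSeries) : ev x (a * b) = ev x a * ev x b := by
  rw [← (hasSum_ev hx a).tsum_eq, ← (hasSum_ev hx b).tsum_eq, ← (hasSum_ev hx (a * b)).tsum_eq,
    tsum_mul_tsum_eq_tsum_sum_antidiagonal_of_summable_norm (summable_norm_ev hx a)
      (summable_norm_ev hx b)]
  congr 1
  ext n
  rw [coeff_mul, Finset.mul_sum]
  refine Finset.sum_congr rfl fun p hp => ?_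
  rw [← Finset.HasAntidiagonal.mem_antidiagonal.1 hp]
  ring

lemma ev_one {x : ℂ} (hx : ‖x‖ < 1) : ev x 1 = 1 := by
  rw [← (hasSum_ev hx 1).tsum_eq, tsum_eq_single 0]
  · simp [coeff_one]
  · intro n hn
    simp [coeff_one, hn]

lemma ev_pow {x : ℂ} (hx : ‖x‖ < 1) (a : AbsSeries) (n : ℕ) : ev x (a ^ n) = ev x a ^ n := by
  induction n with
  | zero => simp [ev_one hx]
  | succ n ih => rw [pow_succ, ev_mul hx, ih, pow_succ]

lemma ev_algebraMap {x : ℂ} (hx : ‖x‖ < 1) (c : ℂ) : ev x (algebraMap ℂ AbsSeries c) = c := by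
  rw [Algebra.algebraMap_eq_smul_one, map_smul, ev_one hx]
  simp

lemma ev_X {x : ℂ} (hx : ‖x‖ < 1) : ev x X = x := by
  rw [← (hasSum_ev hx X).tsum_eq, tsum_eq_single 1]
  · simp [X]
  · intro n hn
    simp [X, hn]

lemma ev_zero_apply (a : AbsSeries) : ev 0 a = coeff 0 a := by
  rw [← (hasSum_ev (by simp) a).tsum_eq, tsum_eq_single 0]
  · simp
  · intro n hn
    simp [hn]

lemma norm_mul_lt_one {s x : ℂ} (hs : ‖s‖ ≤ 1) (hx : ‖x‖ < 1) : ‖s * x‖ < 1 := by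
  rw [norm_mul]
  exact (mul_le_of_le_one_left (norm_nonneg _) hs).trans_lt hx

lemma ev_dilate {x : ℂ} (hx : ‖x‖ < 1) (s hs) (a : AbsSeries) :
    ev x (dilate s hs a) = ev (s * x) a := by
  rw [← (hasSum_ev hx _).tsum_eq, ← (hasSum_ev (norm_mul_lt_one hs hx) _).tsum_eq]
  congr 1
  ext n
  rw [coeff_dilate]
  ring

lemma analyticAt_ev {x : ℂ} (hx : ‖x‖ < 1) : AnalyticAt ℂ ev x := by
  obtain ⟨r, hxr, hr⟩ := exists_between hx
  have hr0 : 0 ≤ r := (norm_nonneg x).trans hxr.le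
  have : DifferentiableOn ℂ (fun x : ℂ => ∑' n, x ^ n • coeff n) (Metric.ball 0 r) := by
    refine differentiableOn_tsum_of_summable_norm (u := fun n => r ^ n)
      (summable_geometric_of_lt_one hr0 hr) (fun n => by fun_prop) Metric.isOpen_ball
      fun n y hy => ?_
    rw [mem_ball_zero_iff] at hy
    rw [norm_smul, norm_pow]
    exact (mul_le_of_le_one_right (by positivity) (norm_coeff_le n)).trans
      (pow_le_pow_left₀ (norm_nonneg _) hy.le _)
  exact this.analyticAt (Metric.isOpen_ball.mem_nhds (by simpa using hxr))

/-- Evaluation is jointly analytic in the point and in the series. -/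
lemma analyticAt_ev_apply {E : Type*} [NormedAddCommGroup E] [NormedSpace ℂ E] {u : E → ℂ}
    {g : E → AbsSeries} {p : E} (hu : AnalyticAt ℂ u p) (hg : AnalyticAt ℂ g p)
    (hp : ‖u p‖ < 1) : AnalyticAt ℂ (fun q => ev (u q) (g q)) p :=
  ((ContinuousLinearMap.id ℂ (AbsSeries →L[ℂ] ℂ)).analyticAt_bilinear _).comp₂
    ((analyticAt_ev hp).comp hu) hg

lemma hasDerivAt_ev_integral {x : ℂ} (hx : ‖x‖ < 1) (a : AbsSeries) :
    HasDerivAt (fun x => ev x (integral a)) (ev x a) x := by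
  have h : HasDerivAt (fun z => ∑' n : ℕ, z ^ n * coeff n (integral a))
      (∑' n : ℕ, ((n : ℂ) * x ^ (n - 1)) * coeff n (integral a)) x := by
    refine hasDerivAt_tsum_of_isPreconnected (u := fun n : ℕ => ‖coeff (n - 1) a‖)
      (g := fun (n : ℕ) (z : ℂ) => z ^ n * coeff n (integral a))
      (g' := fun (n : ℕ) (z : ℂ) => (n : ℂ) * z ^ (n - 1) * coeff n (integral a))
      (t := Metric.ball 0 1) (y₀ := 0)
      ?_ Metric.isOpen_ball (convex_ball _ _).isPreconnected
      (fun n y _ => (hasDerivAt_pow n y).mul_const _) (fun n y hy => ?_) (by simp) ?_ (by simpa)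
    · rw [← summable_nat_add_iff 1]
      simpa using a.summable_norm_coeff
    · rw [mem_ball_zero_iff] at hy
      cases n with
      | zero => simp
      | succ n =>
        rw [coeff_integral_succ]
        have : ((n : ℂ) + 1) ≠ 0 := Nat.cast_add_one_ne_zero n
        have e : ((n + 1 : ℕ) : ℂ) * y ^ (n + 1 - 1) * (((n : ℂ) + 1)⁻¹ * coeff n a) =
            y ^ n * coeff n a := by
          push_cast
          field_simp
        rw [e, norm_mul, norm_pow]
        exact mul_le_of_le_one_left (norm_nonneg _) (pow_le_one₀ (norm_nonneg _) hy.le)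
    · exact (hasSum_ev (by simp) _).summable
  have e : (∑' n : ℕ, ((n : ℂ) * x ^ (n - 1)) * coeff n (integral a)) = ev x a := by
    rw [← (hasSum_ev hx a).tsum_eq, tsum_eq_zero_add']
    · simp only [Nat.cast_zero, zero_mul, zero_add]
      congr 1
      ext n
      rw [coeff_integral_succ]
      have : ((n : ℂ) + 1) ≠ 0 := Nat.cast_add_one_ne_zero n
      push_cast
      field_simp
    · refine (hasSum_ev hx a).summable.congr fun n => ?_
      rw [coeff_integral_succ]
      have : ((n : ℂ) + 1) ≠ 0 := Nat.cast_add_one_ne_zero n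
      push_cast
      field_simp
  rw [e] at h
  refine h.congr_of_eventuallyEq ?_
  filter_upwards [Metric.isOpen_ball.mem_nhds (show x ∈ Metric.ball (0 : ℂ) 1 by simpa)] with z hz
  exact (hasSum_ev (by simpa using hz) _).tsum_eq.symm

lemma hasFPowerSeriesAt_ev (a : AbsSeries) :
    HasFPowerSeriesAt (fun x => ev x a)
      (FormalMultilinearSeries.ofScalars ℂ fun n => coeff n a) 0 := by
  rw [hasFPowerSeriesAt_iff]
  filter_upwards [Metric.ball_mem_nhds (0 : ℂ) one_pos] with z hz
  rw [mem_ball_zero_iff] at hz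
  simpa [FormalMultilinearSeries.coeff_ofScalars] using hasSum_ev hz a

/-- A series is determined by its germ at the origin. -/
lemma eq_of_eventually_ev_eq {a b : AbsSeries} (h : ∀ᶠ x in 𝓝 0, ev x a = ev x b) : a = b := by
  have := (hasFPowerSeriesAt_ev a).eq_formalMultilinearSeries_of_eventually
    (hasFPowerSeriesAt_ev b) h
  apply ext_coeff
  intro n
  have h2 := congrArg (fun p => FormalMultilinearSeries.coeff p n) this
  simpa [FormalMultilinearSeries.coeff_ofScalars] using h2

attribute [irreducible] ev

end AbsSeries

/-! ### The implicit function theorem with normalised partial derivative -/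

/-- If the partial derivative of `F` along `E` at a zero is the identity, the zeros of `F` near that
point form the graph of an analytic map. Only directional derivatives are asked for. -/
lemma exists_analytic_implicit {P E : Type*} [NormedAddCommGroup P] [NormedSpace ℂ P]
    [CompleteSpace P] [NormedAddCommGroup E] [NormedSpace ℂ E] [CompleteSpace E]
    {F : P × E → E} {p : P} {e : E} (hF : AnalyticAt ℂ F (p, e)) (h0 : F (p, e) = 0)
    (hD : ∀ h, HasDerivAt (fun s : ℂ => F (p, e + s • h)) h 0) :
    ∃ H : P → E, AnalyticAt ℂ H p ∧ H p = e ∧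
      (∀ᶠ q in 𝓝 (p, e), F q = 0 ↔ q.2 = H q.1) ∧ ∀ᶠ q in 𝓝 p, F (q, H q) = 0 := by
  have hc : ContDiffAt ℂ ⊤ F (p, e) := hF.contDiffAt
  have hid : fderiv ℂ F (p, e) ∘L .inr ℂ P E = .id ℂ E := by
    ext h
    have h1 : HasDerivAt (fun s : ℂ => (p, e + s • h)) ((0 : P), h) 0 := by
      refine (hasDerivAt_const _ _).prodMk ?_
      simpa using ((hasDerivAt_id (0 : ℂ)).smul_const h).const_add e
    have h2 : HasFDerivAt F (fderiv ℂ F (p, e)) (p, e + (0 : ℂ) • h) := by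
      simpa using hF.differentiableAt.hasFDerivAt
    simpa using (h2.comp_hasDerivAt (0 : ℂ) h1).unique (hD h)
  have hi : (fderiv ℂ F (p, e) ∘L .inr ℂ P E).IsInvertible := by
    rw [hid]
    exact ⟨.refl ℂ E, rfl⟩
  refine ⟨hc.implicitFunction (by simp) hi, ?_, ?_, ?_, ?_⟩
  · exact (hc.contDiffAt_implicitFunction (by simp) hi).analyticAt
  · exact hc.implicitFunction_apply_self (by simp) hi
  · filter_upwards [hc.eventually_apply_eq_iff_implicitFunction (by simp) hi] with q hq
    rw [← h0, hq, eq_comm]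
  · filter_upwards [hc.eventually_apply_implicitFunction (by simp) hi] with q hq
    rw [hq, h0]

/-! ### Germs of families as series with analytic dependence on the parameter -/

/-- Superposition with an analytic function is analytic for the topology of uniform convergence. -/
lemma exists_analytic_superposition (K : Type*) [TopologicalSpace K] [CompactSpace K]
    {V : Type*} [NormedAddCommGroup V] [NormedSpace ℂ V] {f : V → ℂ} {v : V}
    (hf : AnalyticAt ℂ f v) :
    ∃ r > 0, ∃ S : C(K, V) → C(K, ℂ),
      ∀ a, ‖a‖ < r → AnalyticAt ℂ S a ∧ ∀ z, S a z = f (v + a z) := by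
  obtain ⟨p, R, hp⟩ := hf
  let q : FormalMultilinearSeries ℂ C(K, V) C(K, ℂ) := fun n =>
    MultilinearMap.mkContinuous
      { toFun := fun a => ⟨fun z => p n fun i => a i z, by fun_prop⟩
        map_update_add' := fun a i b c => by
          ext z
          have (d : C(K, V)) : (fun j => Function.update a i d j z) =
              Function.update (fun j => a j z) i (d z) := by
            ext j; rcases eq_or_ne j i with rfl | h <;> simp [*]
          simp [this]
        map_update_smul' := fun a i b c => by
          ext z
          have (d : C(K, V)) : (fun j => Function.update a i d j z) =
              Function.update (fun j => a j z) i (d z) := by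
            ext j; rcases eq_or_ne j i with rfl | h <;> simp [*]
          simp [this] } ‖p n‖ fun a => by
      rw [ContinuousMap.norm_le _ (by positivity)]
      intro z
      refine ((p n).le_opNorm _).trans ?_
      gcongr with i
      exact (a i).norm_coe_le_norm z
  have hq (n : ℕ) : ‖q n‖ ≤ ‖p n‖ := MultilinearMap.mkContinuous_norm_le _ (norm_nonneg _) _
  have hrad : p.radius ≤ q.radius := by
    refine ENNReal.le_of_forall_nnreal_lt fun r hr => ?_
    obtain ⟨C, -, hC⟩ := p.norm_mul_pow_le_of_lt_radius hr
    refine q.le_radius_of_bound C fun n => (mul_le_mul_of_nonneg_right (hq n) ?_).trans (hC n)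
    positivity
  obtain ⟨r, hr0, hrR⟩ := ENNReal.lt_iff_exists_nnreal_btwn.1 hp.r_pos
  have hrpos : (0 : ℝ) < r := by exact_mod_cast hr0
  have hqpos : 0 < q.radius := hp.r_pos.trans_le (hp.r_le.trans hrad)
  have hS := q.hasFPowerSeriesOnBall hqpos
  have mem (a : C(K, V)) (ha : ‖a‖ < r) : a ∈ Metric.eball (0 : C(K, V)) q.radius := by
    have : ENNReal.ofReal ‖a‖ < r := by
      rw [ENNReal.ofReal_lt_iff_lt_toReal (norm_nonneg _) (by simp)]; simpa using ha
    rw [mem_eball_zero_iff]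
    rw [ofReal_norm] at this
    exact this.trans (hrR.trans_le (hp.r_le.trans hrad))
  refine ⟨r, hrpos, q.sum, fun a ha => ⟨hS.analyticAt_of_mem (mem a ha), fun z => ?_⟩⟩
  have h1 := hS.hasSum (mem a ha)
  rw [zero_add] at h1
  have h2 := (ContinuousMap.evalCLM ℂ z).hasSum h1
  have h3 : a z ∈ Metric.eball (0 : V) R := by
    have : ENNReal.ofReal ‖a z‖ < r := by
      rw [ENNReal.ofReal_lt_iff_lt_toReal (norm_nonneg _) (by simp)]
      simpa using (a.norm_coe_le_norm z).trans_lt ha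
    rw [mem_eball_zero_iff]
    rw [ofReal_norm] at this
    exact this.trans hrR
  exact h2.unique (hp.hasSum h3)

section AbsSeriesGerms

open AbsSeries

/-- The point `2 exp(iθ)` of the circle of radius `2`. -/
def circlePoint (θ : ℝ) : Metric.sphere (0 : ℂ) 2 :=
  ⟨circleMap 0 2 θ, circleMap_mem_sphere 0 zero_le_two θ⟩

lemma continuous_circlePoint : Continuous circlePoint :=
  (continuous_circleMap 0 2).subtype_mk _

lemma norm_cauchyCoeff_le (g : C(Metric.sphere (0 : ℂ) 2, ℂ)) (n : ℕ) :
    ‖(2 * Real.pi : ℂ)⁻¹ * ∫ θ in (0 : ℝ)..2 * Real.pi,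
      (circleMap 0 2 θ)⁻¹ ^ n * g (circlePoint θ)‖ ≤ (1 / 2) ^ n * ‖g‖ := by
  have h : ‖∫ θ in (0 : ℝ)..2 * Real.pi, (circleMap 0 2 θ)⁻¹ ^ n * g (circlePoint θ)‖ ≤
      ((1 / 2) ^ n * ‖g‖) * |2 * Real.pi - 0| := by
    refine intervalIntegral.norm_integral_le_of_norm_le_const fun θ _ => ?_
    rw [norm_mul, norm_pow, norm_inv, norm_circleMap_zero]
    simp only [abs_two, one_div]
    exact mul_le_mul_of_nonneg_left (g.norm_coe_le_norm _) (by positivity)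
  have hpi : (0 : ℝ) < 2 * Real.pi := by positivity
  have e : ‖(2 * Real.pi : ℂ)⁻¹‖ = (2 * Real.pi)⁻¹ := by
    rw [norm_inv]
    congr 1
    rw [norm_mul, Complex.norm_real, Real.norm_of_nonneg Real.pi_pos.le]
    simp
  rw [norm_mul, e]
  rw [sub_zero, abs_of_pos hpi] at h
  calc _ ≤ (2 * Real.pi)⁻¹ * ((1 / 2) ^ n * ‖g‖ * (2 * Real.pi)) := by gcongr
    _ = _ := by field_simp

lemma intervalIntegrable_cauchyCoeff (g : C(Metric.sphere (0 : ℂ) 2, ℂ)) (n : ℕ) :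
    IntervalIntegrable (fun θ => (circleMap 0 2 θ)⁻¹ ^ n * g (circlePoint θ))
      MeasureTheory.volume 0 (2 * Real.pi) := by
  refine Continuous.intervalIntegrable ?_ _ _
  have h0 (θ : ℝ) : circleMap 0 2 θ ≠ 0 := circleMap_ne_center two_ne_zero
  exact (((continuous_circleMap 0 2).inv₀ h0).pow n).mul
    (g.continuous.comp continuous_circlePoint)

/-- The Taylor series at the origin, by the Cauchy formula, of a function on the disc of radius `2`
with given boundary values. -/
def cauchySeries : C(Metric.sphere (0 : ℂ) 2, ℂ) →L[ℂ] AbsSeries :=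
  have hs : Summable fun n : ℕ => (1 / 2 : ℝ) ^ n :=
    summable_geometric_of_lt_one (by norm_num) (by norm_num)
  LinearMap.mkContinuous
    { toFun := fun g => AbsSeries.mk (fun n => (2 * Real.pi : ℂ)⁻¹ *
          ∫ θ in (0 : ℝ)..2 * Real.pi, (circleMap 0 2 θ)⁻¹ ^ n * g (circlePoint θ))
        ((hs.mul_right ‖g‖).of_nonneg_of_le (fun _ => norm_nonneg _) (norm_cauchyCoeff_le g))
      map_add' := fun g h => by
        apply ext_coeff
        intro n
        rw [map_add]
        simp only [coeff_mk, ContinuousMap.add_apply, mul_add]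
        rw [intervalIntegral.integral_add (intervalIntegrable_cauchyCoeff g n)
          (intervalIntegrable_cauchyCoeff h n), mul_add]
      map_smul' := fun c g => by
        apply ext_coeff
        intro n
        simp only [coeff_mk, ContinuousMap.smul_apply, smul_eq_mul, RingHom.id_apply, map_smul]
        simp only [mul_left_comm _ c]
        rw [intervalIntegral.integral_const_mul, mul_left_comm] } 2 fun g => by
    have e : 2 * ‖g‖ = ∑' n : ℕ, (1 / 2 : ℝ) ^ n * ‖g‖ := by
      rw [tsum_mul_right, tsum_geometric_two]
    rw [norm_eq, e]
    refine (summable_norm_coeff _).tsum_le_tsum (fun n => ?_) (hs.mul_right _)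
    simpa using norm_cauchyCoeff_le g n

lemma ev_cauchySeries {g : C(Metric.sphere (0 : ℂ) 2, ℂ)} {G : ℂ → ℂ}
    (hG : DifferentiableOn ℂ G (Metric.closedBall 0 2)) (hg : ∀ z, g z = G z) {x : ℂ}
    (hx : ‖x‖ < 1) : ev x (cauchySeries g) = G x := by
  have h := (DifferentiableOn.hasFPowerSeriesOnBall (R := 2) (by simpa using hG) (by simp)).hasSum
    (y := x) (by
      rw [mem_eball_zero_iff, ← ofReal_norm, ENNReal.ofReal_lt_iff_lt_toReal
        (norm_nonneg _) (by simp)]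
      simpa using hx.trans one_lt_two)
  rw [zero_add] at h
  refine (hasSum_ev hx _).unique (h.congr_fun ?_)
  intro n
  rw [cauchyPowerSeries_apply]
  simp only [circleIntegral, deriv_circleMap, smul_eq_mul, sub_zero, cauchySeries]
  rw [LinearMap.mkContinuous_apply]
  simp only [LinearMap.coe_mk, AddHom.coe_mk, coeff_mk, hg]
  rw [← intervalIntegral.integral_const_mul, ← intervalIntegral.integral_const_mul,
    ← intervalIntegral.integral_const_mul]
  refine intervalIntegral.integral_congr fun θ _ => ?_
  have h0 : circleMap 0 2 θ ≠ 0 := circleMap_ne_center two_ne_zero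
  have hpi : (Real.pi : ℂ) ≠ 0 := by exact_mod_cast Real.pi_ne_zero
  simp only [circlePoint, div_pow, inv_pow, NNReal.coe_ofNat]
  field_simp

/-- A germ of analytic function of `(x, l)` gives, after a dilation of `x`, a series in `x` whose
dependence on the parameter `l` is analytic for the norm of `AbsSeries`. -/
lemma exists_series {Λ : Type*} [NormedAddCommGroup Λ] [NormedSpace ℂ Λ] {f : ℂ × Λ → ℂ} {l₀ : Λ}
    (hf : AnalyticAt ℂ f (0, l₀)) :
    ∀ᶠ ρ : ℝ in 𝓝[>] 0, ∃ g : Λ → AbsSeries, AnalyticAt ℂ g l₀ ∧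
      ∀ᶠ l in 𝓝 l₀, ∀ x : ℂ, ‖x‖ < 1 → ev x (g l) = f (ρ * x, l) := by
  obtain ⟨r, hr, S, hS⟩ := exists_analytic_superposition (Metric.sphere (0 : ℂ) 2) hf
  obtain ⟨ε, hε, hball⟩ := Metric.eventually_nhds_iff_ball.1 hf.eventually_analyticAt
  have hm : (0 : ℝ) < min r ε / 2 := by positivity
  filter_upwards [Ioo_mem_nhdsGT hm] with ρ hρ
  have hρ2 : 2 * ρ < min r ε := by linarith [hρ.2]
  have hscale {x : ℂ} (hx : ‖x‖ ≤ 2) : ‖(ρ : ℂ) * x‖ < min r ε := by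
    rw [norm_mul, Complex.norm_real, Real.norm_of_nonneg hρ.1.le]
    nlinarith [hρ.1]
  let B : Λ →L[ℂ] C(Metric.sphere (0 : ℂ) 2, ℂ × Λ) := LinearMap.mkContinuous
    { toFun := fun l => .const _ (0, l)
      map_add' := fun a b => by ext z <;> simp
      map_smul' := fun c a => by ext z <;> simp } 1 fun l => by
    rw [ContinuousMap.norm_le _ (by positivity)]
    simp
  let c : C(Metric.sphere (0 : ℂ) 2, ℂ × Λ) := ⟨fun z => ((ρ : ℂ) * z, -l₀), by fun_prop⟩
  have hBc (l : Λ) (z : Metric.sphere (0 : ℂ) 2) : (B l + c) z = ((ρ : ℂ) * z, l - l₀) := by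
    simp [B, c, sub_eq_add_neg]
  have hnorm (l : Λ) (hl : ‖l - l₀‖ < min r ε) : ‖B l + c‖ < r := by
    refine (ContinuousMap.norm_lt_iff _ hr).2 fun z => ?_
    rw [hBc, Prod.norm_def, max_lt_iff]
    exact ⟨(hscale (by simp)).trans_le (min_le_left _ _), hl.trans_le (min_le_left _ _)⟩
  refine ⟨fun l => cauchySeries (S (B l + c)), ?_, ?_⟩
  · refine (cauchySeries.analyticAt _).comp ?_
    exact AnalyticAt.comp (g := S) (f := fun l => B l + c)
      (hS _ (hnorm l₀ (by simpa using ⟨hr, hε⟩))).1 ((B.analyticAt l₀).add analyticAt_const)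
  · filter_upwards [Metric.ball_mem_nhds l₀ (show 0 < min r ε by positivity)] with l hl x hx
    rw [mem_ball_iff_norm] at hl
    refine ev_cauchySeries (G := fun x => f (ρ * x, l)) ?_ (fun z => ?_) hx
    · intro x hx
      rw [mem_closedBall_zero_iff] at hx
      have h1 : AnalyticAt ℂ f ((ρ : ℂ) * x, l) := by
        refine hball _ ?_
        rw [mem_ball_iff_norm, Prod.norm_def, max_lt_iff]
        simp only [Prod.fst_sub, sub_zero, Prod.snd_sub]
        exact ⟨(hscale hx).trans_le (min_le_right _ _), hl.trans_le (min_le_right _ _)⟩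
      exact (h1.differentiableAt.comp x (f := fun x : ℂ => ((ρ : ℂ) * x, l))
        (by fun_prop)).differentiableWithinAt
    · rw [(hS _ (hnorm l hl)).2 z, hBc]
      simp

/-- The partial derivative along the first variable. -/
def pderiv {Λ : Type*} (f : ℂ × Λ → ℂ) (p : ℂ × Λ) : ℂ := deriv (fun x => f (x, p.2)) p.1

lemma hasDerivAt_slice {Λ : Type*} [NormedAddCommGroup Λ] [NormedSpace ℂ Λ] {f : ℂ × Λ → ℂ}
    {p : ℂ × Λ} (hf : DifferentiableAt ℂ f p) :
    HasDerivAt (fun x => f (x, p.2)) (fderiv ℂ f p (1, 0)) p.1 :=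
  HasFDerivAt.comp_hasDerivAt (f := fun x : ℂ => (x, p.2)) p.1 (hf.hasFDerivAt)
    ((hasDerivAt_id p.1).prodMk (hasDerivAt_const _ _))

lemma hasDerivAt_pderiv {Λ : Type*} [NormedAddCommGroup Λ] [NormedSpace ℂ Λ] {f : ℂ × Λ → ℂ}
    {p : ℂ × Λ} (hf : AnalyticAt ℂ f p) : HasDerivAt (fun x => f (x, p.2)) (pderiv f p) p.1 :=
  (hasDerivAt_slice hf.differentiableAt).differentiableAt.hasDerivAt

lemma analyticAt_pderiv {Λ : Type*} [NormedAddCommGroup Λ] [NormedSpace ℂ Λ] {f : ℂ × Λ → ℂ}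
    {p : ℂ × Λ} (hf : AnalyticAt ℂ f p) : AnalyticAt ℂ (pderiv f) p := by
  have h : AnalyticAt ℂ (fun q => fderiv ℂ f q (1, 0)) p :=
    ((ContinuousLinearMap.apply ℂ ℂ ((1, 0) : ℂ × Λ)).analyticAt _).comp hf.fderiv
  refine h.congr ?_
  filter_upwards [hf.eventually_analyticAt] with q hq
  exact (hasDerivAt_slice hq.differentiableAt).deriv.symm

/-! ### The conjugacy equation in the algebra of series -/

/-- The unknowns `(b, v, y, μ)` of the conjugacy equation: the change of coordinate `b + ∫ v` and
the coefficients of the normal form. -/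
abbrev Unknown (k : ℕ) : Type := ℂ × AbsSeries × (Fin k → ℂ) × ℂ

namespace Unknown

variable {k : ℕ}

/-- The change of coordinate, as a series, with value `b` at the origin and derivative `v`. -/
def coord (u : Unknown k) : AbsSeries := algebraMap ℂ AbsSeries u.1 + integral u.2.1

/-- The unknown that stands for the identity as a conjugacy of `x ^ (k + 1)` with itself. -/
def base (k : ℕ) : Unknown k := (0, 1, 0, 0)

end Unknown

/-- The defect `f v (1 + μ φ ^ k) - (φ ^ (k + 1) + ∑ yⱼ φ ^ j)`, where `v` is the derivative of `φ`:
it vanishes when `φ` conjugates `f` to the normal form with coefficients `(y, μ)`. -/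
def conjDefect {k : ℕ} (f : AbsSeries) (u : Unknown k) : AbsSeries :=
  f * u.2.1 * (1 + u.2.2.2 • u.coord ^ k) -
    (u.coord ^ (k + 1) + ∑ j : Fin k, u.2.2.1 j • u.coord ^ (j : ℕ))

lemma ev_conjDefect {k : ℕ} (f : AbsSeries) (u : Unknown k) {x : ℂ} (hx : ‖x‖ < 1) :
    ev x (conjDefect f u) = ev x f * ev x u.2.1 * (1 + u.2.2.2 * ev x u.coord ^ k) -
      (ev x u.coord ^ (k + 1) + ∑ j : Fin k, u.2.2.1 j * ev x u.coord ^ (j : ℕ)) := by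
  simp [conjDefect, ev_mul hx, ev_pow hx, ev_one hx]

lemma norm_div_sub_le (k n : ℕ) :
    ‖if n = k then (0 : ℂ) else ((n : ℂ) + 1) / ((n : ℂ) - k)‖ ≤ k + 2 := by
  split_ifs with h
  · simp; positivity
  · have h1 : (1 : ℝ) ≤ |(n : ℝ) - k| := by
      have : (1 : ℤ) ≤ |(n : ℤ) - k| := Int.one_le_abs (by omega)
      exact_mod_cast this
    have e1 : ‖(n : ℂ) + 1‖ = n + 1 := by
      rw [← Nat.cast_add_one, Complex.norm_natCast]; push_cast; rfl
    have e2 : ‖(n : ℂ) - k‖ = |(n : ℝ) - k| := by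
      rw [← Complex.ofReal_natCast, ← Complex.ofReal_natCast, ← Complex.ofReal_sub,
        Complex.norm_real, Real.norm_eq_abs]
    rw [norm_div, e1, e2, div_le_iff₀ (by linarith)]
    have h2 : (n : ℝ) - k ≤ |(n : ℝ) - k| := le_abs_self _
    nlinarith [(Nat.cast_nonneg k : (0 : ℝ) ≤ k)]

lemma norm_sub_div_le (k n : ℕ) : ‖((n : ℂ) - k) / ((n : ℂ) + 1)‖ ≤ k + 1 := by
  have e1 : ‖(n : ℂ) + 1‖ = n + 1 := by
    rw [← Nat.cast_add_one, Complex.norm_natCast]; push_cast; rfl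
  rw [norm_div, e1, div_le_iff₀ (by positivity)]
  refine (norm_sub_le _ _).trans ?_
  rw [Complex.norm_natCast, Complex.norm_natCast]
  nlinarith [(Nat.cast_nonneg k : (0 : ℝ) ≤ k), (Nat.cast_nonneg n : (0 : ℝ) ≤ n)]

/-- A right inverse `h ↦ unknowns (0, h)` of the linearised conjugacy equation at the identity,
found by comparing coefficients; the first variable `τ` is the coordinate along the kernel, which is
spanned by the infinitesimal flow `X ^ (k + 1)`. -/
def linSolve (k : ℕ) : ℂ × AbsSeries →L[ℂ] Unknown k :=
  let h := ContinuousLinearMap.snd ℂ ℂ AbsSeries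
  ((-((k : ℂ) + 1)⁻¹) • (coeff k ∘L h)).prod <|
    (wshift (fun n => if n = k then (0 : ℂ) else ((n : ℂ) + 1) / ((n : ℂ) - k)) (k + 1) (k + 2)
        (norm_div_sub_le k) ∘L h +
      ((k : ℂ) + 1) • (ContinuousLinearMap.fst ℂ ℂ AbsSeries).smulRight (X ^ k)).prod <|
    (ContinuousLinearMap.pi fun j : Fin k => -(coeff j ∘L h)).prod (coeff (2 * k + 1) ∘L h)

/-- The coordinates `(τ, h)` of given unknowns, see `linSolve_linCoords`. -/
def linCoords {k : ℕ} (u : Unknown k) : ℂ × AbsSeries :=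
  (((k : ℂ) + 1)⁻¹ * coeff k u.2.1,
    X ^ (k + 1) *
        wshift (fun n => ((n : ℂ) - k) / ((n : ℂ) + 1)) 0 (k + 1) (norm_sub_div_le k) u.2.1
      + u.2.2.2 • X ^ (2 * k + 1) - (((k : ℂ) + 1) * u.1) • X ^ k
      - ∑ j : Fin k, u.2.2.1 j • X ^ (j : ℕ))

lemma coeff_sum_smul_X_pow {k : ℕ} (y : Fin k → ℂ) (n : ℕ) :
    coeff n (∑ j : Fin k, y j • X ^ (j : ℕ)) = if h : n < k then y ⟨n, h⟩ else 0 := by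
  rw [map_sum]
  simp only [map_smul, coeff_X_pow, smul_eq_mul, mul_ite, mul_one, mul_zero]
  split_ifs with h
  · rw [Finset.sum_eq_single ⟨n, h⟩] <;> simp [Fin.ext_iff]
    intro b hb h'; exact absurd h'.symm hb
  · refine Finset.sum_eq_zero fun j _ => if_neg ?_
    have := j.2
    omega

lemma natCast_add_one_ne_zero (n : ℕ) : (n : ℂ) + 1 ≠ 0 := Nat.cast_add_one_ne_zero n

lemma coeff_linCoords {k : ℕ} (u : Unknown k) (n : ℕ) :
    coeff n (linCoords u).2 =
      (if k + 1 ≤ n then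
        (((n - (k + 1) : ℕ) : ℂ) - k) / (((n - (k + 1) : ℕ) : ℂ) + 1) * coeff (n - (k + 1)) u.2.1
        else 0) + (if n = 2 * k + 1 then u.2.2.2 else 0) -
      (if n = k then ((k : ℂ) + 1) * u.1 else 0) - if h : n < k then u.2.2.1 ⟨n, h⟩ else 0 := by
  simp only [linCoords, map_sub, map_add, map_smul, coeff_sum_smul_X_pow, coeff_X_pow_mul,
    coeff_X_pow, coeff_wshift, smul_eq_mul, mul_ite, mul_one, mul_zero, add_zero]

lemma linSolve_fst {k : ℕ} (p : ℂ × AbsSeries) :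
    (linSolve k p).1 = -((k : ℂ) + 1)⁻¹ * coeff k p.2 := rfl

lemma coeff_linSolve {k : ℕ} (p : ℂ × AbsSeries) (n : ℕ) : coeff n (linSolve k p).2.1 =
    (if n = k then (0 : ℂ) else ((n : ℂ) + 1) / ((n : ℂ) - k)) * coeff (n + (k + 1)) p.2 +
      if n = k then ((k : ℂ) + 1) * p.1 else 0 := by
  have : (linSolve k p).2.1 =
    wshift (fun n => if n = k then (0 : ℂ) else ((n : ℂ) + 1) / ((n : ℂ) - k)) (k + 1) (k + 2)
        (norm_div_sub_le k) p.2 + ((k : ℂ) + 1) • p.1 • X ^ k := rfl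
  rw [this, map_add, coeff_wshift, map_smul, map_smul, coeff_X_pow]
  simp

lemma linSolve_y {k : ℕ} (p : ℂ × AbsSeries) (j : Fin k) :
    (linSolve k p).2.2.1 j = -coeff j p.2 := rfl

lemma linSolve_μ {k : ℕ} (p : ℂ × AbsSeries) :
    (linSolve k p).2.2.2 = coeff (2 * k + 1) p.2 := rfl

lemma linSolve_linCoords {k : ℕ} (u : Unknown k) : linSolve k (linCoords u) = u := by
  have hk := natCast_add_one_ne_zero k
  refine Prod.ext ?_ (Prod.ext ?_ (Prod.ext ?_ ?_))
  · rw [linSolve_fst, coeff_linCoords, if_neg (by omega), if_neg (by omega), if_pos rfl,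
      dif_neg (by omega)]
    field_simp
    ring
  · apply ext_coeff
    intro n
    rw [coeff_linSolve, coeff_linCoords, if_pos (show k + 1 ≤ n + (k + 1) by omega),
      if_neg (show n + (k + 1) ≠ k by omega), dif_neg (show ¬n + (k + 1) < k by omega),
      Nat.add_sub_cancel]
    rcases eq_or_ne n k with rfl | h
    · simp [linCoords, hk]
    · have h1 : (n : ℂ) - k ≠ 0 := sub_ne_zero.2 (by exact_mod_cast h)
      have hn := natCast_add_one_ne_zero n
      rw [if_neg h, if_neg h, if_neg (show n + (k + 1) ≠ 2 * k + 1 by omega)]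
      field_simp
      ring
  · ext j
    have := j.2
    rw [linSolve_y, coeff_linCoords, if_neg (by omega), if_neg (by omega), if_neg (by omega),
      dif_pos this]
    simp
  · rw [linSolve_μ, coeff_linCoords, if_pos (by omega), if_pos rfl, if_neg (by omega),
      dif_neg (by omega), show 2 * k + 1 - (k + 1) = k by omega]
    simp

lemma coeff_algebraMap (n : ℕ) (c : ℂ) :
    coeff n (algebraMap ℂ AbsSeries c) = if n = 0 then c else 0 := coeffₗ_algebraMap n c

lemma coeff_coord {k : ℕ} (u : Unknown k) (n : ℕ) :
    coeff n u.coord = if n = 0 then u.1 else (n : ℂ)⁻¹ * coeff (n - 1) u.2.1 := by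
  rw [Unknown.coord, map_add, coeff_algebraMap]
  cases n with
  | zero => simp [coeff_integral_zero]
  | succ n => simp [coeff_integral_succ]

lemma linearised_linSolve {k : ℕ} (h : AbsSeries) {u : Unknown k} (hu : u = linSolve k (0, h)) :
    X ^ (k + 1) * u.2.1 + u.2.2.2 • X ^ (2 * k + 1) -
      (((k : ℂ) + 1) • (X ^ k * u.coord) + ∑ j : Fin k, u.2.2.1 j • X ^ (j : ℕ)) = h := by
  subst hu
  apply ext_coeff
  intro n
  simp only [map_sub, map_add, map_smul, coeff_X_pow_mul, coeff_X_pow, coeff_sum_smul_X_pow,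
    coeff_coord, linSolve_fst, coeff_linSolve, linSolve_y, linSolve_μ, smul_eq_mul, mul_zero,
    ite_self, add_zero]
  have hk := natCast_add_one_ne_zero k
  rcases lt_trichotomy n k with hn | rfl | hn
  · rw [if_neg (by omega), if_neg (by omega), if_neg (by omega), dif_pos hn]
    simp
  · rw [if_neg (by omega), if_neg (by omega), if_pos le_rfl, if_pos (Nat.sub_self n),
      dif_neg (lt_irrefl n)]
    field_simp
    simp
  · obtain ⟨d, rfl⟩ := Nat.exists_eq_add_of_le (show k + 1 ≤ n from hn)
    have hd := natCast_add_one_ne_zero d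
    rw [if_pos (show k + 1 ≤ k + 1 + d by omega), if_pos (show k ≤ k + 1 + d by omega),
      if_neg (show k + 1 + d - k ≠ 0 by omega), dif_neg (show ¬k + 1 + d < k by omega),
      show k + 1 + d - (k + 1) = d by omega, show k + 1 + d - k = d + 1 by omega,
      add_comm d (k + 1),
      Nat.add_sub_cancel]
    rcases eq_or_ne d k with rfl | h
    · rw [if_pos rfl, if_pos (show d + 1 + d = 2 * d + 1 by omega),
        show 2 * d + 1 = d + 1 + d by omega]
      simp
    · have h1 : (d : ℂ) - k ≠ 0 := sub_ne_zero.2 (by exact_mod_cast h)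
      rw [if_neg h, if_neg (show k + 1 + d ≠ 2 * k + 1 by omega), add_comm d (k + 1)]
      push_cast
      field_simp
      ring

lemma coord_base (k : ℕ) : (Unknown.base k).coord = X := by
  apply ext_coeff
  intro n
  rw [coeff_coord]
  have := coeff_X_pow 1 n
  rw [pow_one] at this
  rw [this]
  simp only [Unknown.base, coeff_one]
  rcases n with _ | _ | n <;> simp

lemma coord_add_smul {k : ℕ} (u w : Unknown k) (s : ℂ) :
    (u + s • w).coord = u.coord + s • w.coord := by
  simp only [Unknown.coord, Prod.fst_add, Prod.smul_fst, Prod.snd_add, Prod.smul_snd, map_add,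
    map_smul, smul_add, smul_eq_mul, map_mul]
  simp only [Algebra.smul_def]
  ring

/-- The linearised conjugacy equation at the identity, for `f = X ^ (k + 1)`. -/
lemma hasDerivAt_conjDefect {k : ℕ} (u : Unknown k) :
    HasDerivAt (fun s : ℂ => conjDefect (X ^ (k + 1)) (Unknown.base k + s • u))
      (X ^ (k + 1) * u.2.1 + u.2.2.2 • X ^ (2 * k + 1) -
      (((k : ℂ) + 1) • (X ^ k * u.coord) + ∑ j : Fin k, u.2.2.1 j • X ^ (j : ℕ))) 0 := by
  have hφ : HasDerivAt (fun s : ℂ => (Unknown.base k + s • u).coord) u.coord 0 := by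
    simp only [coord_add_smul, coord_base]
    simpa using ((hasDerivAt_id (0 : ℂ)).smul_const u.coord).const_add X
  have h0 : (Unknown.base k + (0 : ℂ) • u).coord = X := by simp [coord_base]
  have hv : HasDerivAt (fun s : ℂ => (Unknown.base k + s • u).2.1) u.2.1 0 := by
    simpa using ((hasDerivAt_id (0 : ℂ)).smul_const u.2.1).const_add (1 : AbsSeries)
  have hμ : HasDerivAt (fun s : ℂ => (Unknown.base k + s • u).2.2.2) u.2.2.2 0 := by
    simpa [Unknown.base] using ((hasDerivAt_id (0 : ℂ)).mul_const u.2.2.2)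
  have hy (j : Fin k) : HasDerivAt (fun s : ℂ => (Unknown.base k + s • u).2.2.1 j)
      (u.2.2.1 j) 0 := by
    simpa [Unknown.base] using ((hasDerivAt_id (0 : ℂ)).mul_const (u.2.2.1 j))
  have h1 := ((hv.const_mul (X ^ (k + 1))).fun_mul
    ((hμ.fun_smul (hφ.fun_pow k)).const_add 1)).fun_sub
    ((hφ.fun_pow (k + 1)).fun_add (HasDerivAt.fun_sum fun j (_ : j ∈ Finset.univ) =>
      (hy j).fun_smul (hφ.fun_pow j)))
  refine h1.congr_deriv ?_
  simp only [h0]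
  simp only [Unknown.base, add_zero, zero_smul, zero_add, Pi.zero_apply, mul_one,
    Nat.add_sub_cancel, Nat.cast_add, Nat.cast_one]
  rw [show 2 * k + 1 = (k + 1) + k by ring, pow_add X (k + 1) k]
  simp only [Algebra.smul_def, map_add, map_one, map_natCast]
  ring

lemma analyticAt_coord {E : Type*} [NormedAddCommGroup E] [NormedSpace ℂ E] {k : ℕ}
    {u : E → Unknown k} {p : E} (hu : AnalyticAt ℂ u p) :
    AnalyticAt ℂ (fun q => (u q).coord) p := by
  have h1 : AnalyticAt ℂ (fun q => (u q).1) p := analyticAt_fst.comp hu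
  have h2 : AnalyticAt ℂ (fun q => (u q).2.1) p := (analyticAt_fst.comp analyticAt_snd).comp hu
  exact (((algebraMapCLM ℂ AbsSeries).analyticAt _).comp h1).add ((integral.analyticAt _).comp h2)

lemma analyticAt_conjDefect {E : Type*} [NormedAddCommGroup E] [NormedSpace ℂ E] {k : ℕ}
    {f : E → AbsSeries} {u : E → Unknown k} {p : E} (hf : AnalyticAt ℂ f p)
    (hu : AnalyticAt ℂ u p) : AnalyticAt ℂ (fun q => conjDefect (f q) (u q)) p := by
  have hc := analyticAt_coord hu
  have h2 : AnalyticAt ℂ (fun q => (u q).2.1) p := (analyticAt_fst.comp analyticAt_snd).comp hu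
  have h3 : AnalyticAt ℂ (fun q => (u q).2.2.1) p :=
    (analyticAt_fst.comp (analyticAt_snd.comp analyticAt_snd)).comp hu
  have h3' (j : Fin k) : AnalyticAt ℂ (fun q => (u q).2.2.1 j) p :=
    ((ContinuousLinearMap.proj (R := ℂ) (φ := fun _ : Fin k => ℂ) j).analyticAt _).comp h3
  have h4 : AnalyticAt ℂ (fun q => (u q).2.2.2) p :=
    (analyticAt_snd.comp (analyticAt_snd.comp analyticAt_snd)).comp hu
  unfold conjDefect
  exact ((hf.mul h2).mul (analyticAt_const.add (h4.smul (hc.pow k)))).sub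
    ((hc.pow (k + 1)).add (Finset.analyticAt_fun_sum _ fun j _ => (h3' j).smul (hc.pow j)))

lemma conjDefect_base (k : ℕ) : conjDefect (X ^ (k + 1)) (Unknown.base k) = 0 := by
  simp [conjDefect, coord_base]
  simp [Unknown.base]

/-- The conjugacy equation near the identity: with `τ` fixed, it is solved by a graph over `f`. -/
lemma exists_conjDefect_implicit (k : ℕ) :
    ∃ H : AbsSeries × ℂ → AbsSeries, AnalyticAt ℂ H (X ^ (k + 1), 0) ∧ H (X ^ (k + 1), 0) = 0 ∧
      (∀ᶠ q in 𝓝 (((X ^ (k + 1), 0), 0) : (AbsSeries × ℂ) × AbsSeries),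
        conjDefect q.1.1 (Unknown.base k + linSolve k (q.1.2, q.2)) = 0 ↔ q.2 = H q.1) ∧
      ∀ᶠ q in 𝓝 ((X ^ (k + 1), 0) : AbsSeries × ℂ),
        conjDefect q.1 (Unknown.base k + linSolve k (q.2, H q)) = 0 := by
  refine exists_analytic_implicit (F := fun q : (AbsSeries × ℂ) × AbsSeries =>
    conjDefect q.1.1 (Unknown.base k + linSolve k (q.1.2, q.2))) ?_ ?_ fun h => ?_
  · refine analyticAt_conjDefect (analyticAt_fst.comp analyticAt_fst)
      (analyticAt_const.add (((linSolve k).analyticAt _).comp ?_))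
    exact (analyticAt_snd.comp analyticAt_fst).prod analyticAt_snd
  · rw [show ((0, 0) : ℂ × AbsSeries) = 0 from rfl, map_zero, add_zero, conjDefect_base]
  · have := hasDerivAt_conjDefect (linSolve k (0, h))
    rw [linearised_linSolve h rfl] at this
    refine this.congr_of_eventuallyEq (Eventually.of_forall fun s => ?_)
    simp only
    rw [← map_smul, Prod.smul_mk, smul_zero, zero_add]

lemma exists_conjDefect_solution (k : ℕ) :
    ∃ H : AbsSeries → Unknown k, AnalyticAt ℂ H (X ^ (k + 1)) ∧
      H (X ^ (k + 1)) = Unknown.base k ∧ ∀ᶠ f in 𝓝 (X ^ (k + 1)), conjDefect f (H f) = 0 := by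
  obtain ⟨H, hH, hH0, -, hF⟩ := exists_conjDefect_implicit k
  have hι : AnalyticAt ℂ (fun f : AbsSeries => (f, (0 : ℂ))) (X ^ (k + 1)) :=
    analyticAt_id.prod analyticAt_const
  refine ⟨fun f => Unknown.base k + linSolve k (0, H (f, 0)), ?_, ?_, ?_⟩
  · exact analyticAt_const.add (((linSolve k).analyticAt _).comp
      (analyticAt_const.prod (AnalyticAt.comp (g := H) (f := fun f => (f, (0 : ℂ))) hH hι)))
  · simp only [hH0]
    rw [show ((0, 0) : ℂ × AbsSeries) = 0 from rfl, map_zero, add_zero]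
  · exact hι.continuousAt.eventually hF

lemma continuous_linCoords (k : ℕ) : Continuous (linCoords (k := k)) := by
  unfold linCoords
  fun_prop

/-- Two solutions of the conjugacy equation near the identity agree as soon as they have the same
component along the infinitesimal flow `X ^ (k + 1)`. -/
lemma conjDefect_solution_unique (k : ℕ) :
    ∀ᶠ q in 𝓝 ((X ^ (k + 1), Unknown.base k, Unknown.base k) :
      AbsSeries × Unknown k × Unknown k),
      conjDefect q.1 q.2.1 = 0 → conjDefect q.1 q.2.2 = 0 →
        coeff k q.2.1.2.1 = coeff k q.2.2.2.1 → q.2.1 = q.2.2 := by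
  obtain ⟨H, -, -, hH, -⟩ := exists_conjDefect_implicit k
  have h0 : linCoords (k := k) 0 = 0 := by simp [linCoords]
  have hL : Tendsto (fun p : AbsSeries × Unknown k =>
      ((p.1, (linCoords (p.2 - Unknown.base k)).1), (linCoords (p.2 - Unknown.base k)).2))
      (𝓝 (X ^ (k + 1), Unknown.base k)) (𝓝 ((X ^ (k + 1), 0), 0)) := by
    have hc : Continuous (fun p : AbsSeries × Unknown k =>
      ((p.1, (linCoords (p.2 - Unknown.base k)).1), (linCoords (p.2 - Unknown.base k)).2)) := by
      have := continuous_linCoords k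
      fun_prop
    simpa [h0] using hc.tendsto (X ^ (k + 1), Unknown.base k)
  have key := hL.eventually hH
  simp only [Prod.mk.eta, linSolve_linCoords, add_sub_cancel] at key
  have t1 : Tendsto (fun q : AbsSeries × Unknown k × Unknown k => (q.1, q.2.1))
      (𝓝 (X ^ (k + 1), Unknown.base k, Unknown.base k)) (𝓝 (X ^ (k + 1), Unknown.base k)) :=
    Continuous.tendsto (by fun_prop) _
  have t2 : Tendsto (fun q : AbsSeries × Unknown k × Unknown k => (q.1, q.2.2))
      (𝓝 (X ^ (k + 1), Unknown.base k, Unknown.base k)) (𝓝 (X ^ (k + 1), Unknown.base k)) :=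
    Continuous.tendsto (by fun_prop) _
  filter_upwards [t1.eventually key, t2.eventually key] with q h1 h2 e1 e2 ek
  have eτ : (linCoords (q.2.1 - Unknown.base k)).1 = (linCoords (q.2.2 - Unknown.base k)).1 := by
    simp [linCoords, ek]
  have eh : linCoords (q.2.1 - Unknown.base k) = linCoords (q.2.2 - Unknown.base k) := by
    refine Prod.ext eτ ?_
    rw [h1.1 e1, h2.1 e2, eτ]
  have := congrArg (linSolve k) eh
  rw [linSolve_linCoords, linSolve_linCoords] at this
  exact sub_left_injective this

/-! ### Existence of the normal form -/

/-- Small dilations bring the series of a germ close to a constant. -/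
lemma exists_series_near_const {Λ : Type*} [NormedAddCommGroup Λ] [NormedSpace ℂ Λ]
    {f : ℂ × Λ → ℂ} {l₀ : Λ} (hf : AnalyticAt ℂ f (0, l₀)) {W : Set AbsSeries}
    (hW : W ∈ 𝓝 (algebraMap ℂ AbsSeries (f (0, l₀)))) :
    ∀ᶠ σ : ℝ in 𝓝[>] 0, ∃ g : Λ → AbsSeries, AnalyticAt ℂ g l₀ ∧ g l₀ ∈ W ∧
      ∀ᶠ l in 𝓝 l₀, ∀ x : ℂ, ‖x‖ < 1 → ev x (g l) = f (σ * x, l) := by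
  obtain ⟨ρ, ⟨g, hg, hev⟩, hρ : 0 < ρ⟩ := ((exists_series hf).and self_mem_nhdsWithin).exists
  obtain ⟨ε, hε, hball⟩ := Metric.mem_nhds_iff.1 hW
  have hm : 0 < min ρ (ρ * (ε / (‖g l₀‖ + 1))) := by positivity
  filter_upwards [Ioo_mem_nhdsGT hm] with σ hσ
  have hs : ‖((σ / ρ : ℝ) : ℂ)‖ = σ / ρ := by
    rw [Complex.norm_real, Real.norm_of_nonneg (div_nonneg hσ.1.le hρ.le)]
  have hs1 : ‖((σ / ρ : ℝ) : ℂ)‖ ≤ 1 := by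
    rw [hs, div_le_one hρ]
    exact hσ.2.le.trans (min_le_left _ _)
  refine ⟨fun l => dilate _ hs1 (g l), ((dilate _ hs1).analyticAt _).comp hg, hball ?_, ?_⟩
  · have h0 : coeff 0 (g l₀) = f (0, l₀) := by
      rw [← ev_zero_apply, hev.self_of_nhds 0 (by simp), mul_zero]
    rw [mem_ball_iff_norm, ← h0]
    refine (norm_dilate_sub_le _ hs1 _).trans_lt ?_
    rw [hs]
    have h1 : σ / ρ < ε / (‖g l₀‖ + 1) := by
      rw [div_lt_iff₀' hρ]
      exact hσ.2.trans_le (min_le_right _ _)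
    have h2 : 0 < ‖g l₀‖ + 1 := by positivity
    rw [lt_div_iff₀ h2] at h1
    have h3 : 0 < σ / ρ := div_pos hσ.1 hρ
    nlinarith
  · filter_upwards [hev] with l hl x hx
    rw [ev_dilate hx, hl _ (norm_mul_lt_one hs1 hx)]
    congr 2
    push_cast
    have : (ρ : ℂ) ≠ 0 := by exact_mod_cast hρ.ne'
    field_simp

lemma tendsto_const_mul_zero (σ : ℂ) : Tendsto (fun x : ℂ => σ * x) (𝓝 0) (𝓝 0) := by
  simpa using (continuous_const_mul σ).tendsto 0

lemma eventually_norm_lt_one : ∀ᶠ x : ℂ in 𝓝 0, ‖x‖ < 1 := by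
  filter_upwards [Metric.ball_mem_nhds (0 : ℂ) one_pos] with x hx
  simpa using hx

/-- Small dilations bring a family that unfolds `x ^ (k + 1) w(x)` close to `X ^ (k + 1)`, up to a
constant factor. -/
lemma exists_series_near_monomial {Λ : Type*} [NormedAddCommGroup Λ] [NormedSpace ℂ Λ]
    {f : ℂ × Λ → ℂ} {k : ℕ} {w : ℂ → ℂ} (hf : AnalyticAt ℂ f 0) (hw : AnalyticAt ℂ w 0)
    (hw0 : w 0 ≠ 0) (hfw : ∀ᶠ x in 𝓝 (0 : ℂ), f (x, 0) = x ^ (k + 1) * w x) {W : Set AbsSeries}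
    (hW : W ∈ 𝓝 (X ^ (k + 1))) :
    ∀ᶠ σ : ℝ in 𝓝[>] 0, ∃ g : Λ → AbsSeries, AnalyticAt ℂ g 0 ∧ g 0 ∈ W ∧
      ∀ᶠ l in 𝓝 0, ∀ x : ℂ, ‖x‖ < 1 →
        ev x (g l) = ((σ : ℂ) ^ (k + 1) * w 0)⁻¹ * f (σ * x, l) := by
  have hw' : AnalyticAt ℂ (fun p : ℂ × ℂ => w p.1) (0, 0) :=
    AnalyticAt.comp (g := w) (f := fun p : ℂ × ℂ => p.1) hw analyticAt_fst
  have hcont : Tendsto (fun u : AbsSeries => X ^ (k + 1) * ((w 0)⁻¹ • u))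
      (𝓝 (algebraMap ℂ AbsSeries (w 0))) (𝓝 (X ^ (k + 1))) := by
    have h : Continuous (fun u : AbsSeries => X ^ (k + 1) * ((w 0)⁻¹ • u)) := by fun_prop
    have := h.tendsto (algebraMap ℂ AbsSeries (w 0))
    rw [Algebra.algebraMap_eq_smul_one] at this ⊢
    rwa [smul_smul, inv_mul_cancel₀ hw0, one_smul, mul_one] at this
  filter_upwards [exists_series hf, exists_series_near_const hw' (hcont hW),
    self_mem_nhdsWithin] with σ ⟨g, hg, hev⟩ ⟨u, _, huW, hu⟩ (hσ : 0 < σ)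
  have hσ' : (σ : ℂ) ≠ 0 := by exact_mod_cast hσ.ne'
  refine ⟨fun l => ((σ : ℂ) ^ (k + 1) * w 0)⁻¹ • g l, analyticAt_const.fun_smul hg, ?_, ?_⟩
  · suffices h : ((σ : ℂ) ^ (k + 1) * w 0)⁻¹ • g 0 = X ^ (k + 1) * ((w 0)⁻¹ • u 0) by
      simp only [h]
      exact huW
    apply eq_of_eventually_ev_eq
    filter_upwards [eventually_norm_lt_one, (tendsto_const_mul_zero σ).eventually hfw] with x hx h1
    rw [map_smul, hev.self_of_nhds x hx, ev_mul hx, ev_pow hx, ev_X hx, map_smul,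
      hu.self_of_nhds x hx, h1, smul_eq_mul, smul_eq_mul]
    field_simp
    ring
  · filter_upwards [hev] with l hl x hx
    rw [map_smul, hl x hx, smul_eq_mul]

/-- A monic polynomial of degree `k + 1` without term of degree `k`, which vanishes to order `k + 1`
along a regular parametrisation `φ`, is `z ^ (k + 1)`, and `φ` starts at the origin. -/
lemma eq_zero_of_vanishing_order {k : ℕ} {y : Fin k → ℂ} {φ w : ℂ → ℂ}
    (hφ : DifferentiableAt ℂ φ 0) (hφ' : deriv φ 0 ≠ 0) (hw : ContinuousAt w 0)
    (h : ∀ᶠ x in 𝓝 0, φ x ^ (k + 1) + ∑ j : Fin k, y j * φ x ^ (j : ℕ) = x ^ (k + 1) * w x) :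
    φ 0 = 0 ∧ ∀ j, y j = 0 := by
  open Polynomial in
  let Q : ℂ[X] := ∑ j : Fin k, C (y j) * Polynomial.X ^ (j : ℕ)
  let P : Polynomial ℂ := Polynomial.X ^ (k + 1) + Q
  have hQdeg : Q.degree < (k + 1 : ℕ) := by
    refine (Polynomial.degree_sum_fin_lt y).trans ?_
    exact_mod_cast Nat.lt_succ_self k
  have hQk (n : ℕ) : Q.coeff n = if h : n < k then y ⟨n, h⟩ else 0 := by
    simp only [Q, Polynomial.finsetSum_coeff, Polynomial.coeff_C_mul_X_pow]
    split_ifs with h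
    · rw [Finset.sum_eq_single ⟨n, h⟩]
      · simp
      · intro b _ hb
        rw [if_neg]
        exact fun h' => hb (Fin.ext h'.symm)
      · simp
    · refine Finset.sum_eq_zero fun j _ => if_neg ?_
      have := j.2
      omega
  have hPev (z : ℂ) : P.eval z = z ^ (k + 1) + ∑ j : Fin k, y j * z ^ (j : ℕ) := by
    simp [P, Q, Polynomial.eval_finsetSum]
  have hmonic : P.Monic := Polynomial.monic_X_pow_add hQdeg
  have hdeg : P.natDegree = k + 1 := by
    rw [Polynomial.natDegree_eq_of_degree_eq_some]
    rw [Polynomial.degree_add_eq_left_of_degree_lt (by rwa [Polynomial.degree_X_pow]),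
      Polynomial.degree_X_pow]
  have hdvd : ∀ i ≤ k + 1, (Polynomial.X - Polynomial.C (φ 0)) ^ i ∣ P := by
    intro i
    induction i with
    | zero => simp
    | succ i ih =>
      intro hi
      obtain ⟨R, hR⟩ := ih (by omega)
      have h1 : Tendsto (fun x => dslope φ 0 x ^ i * R.eval (φ x)) (𝓝[≠] 0)
          (𝓝 (deriv φ 0 ^ i * R.eval (φ 0))) := by
        refine Tendsto.mono_left ?_ nhdsWithin_le_nhds
        have := (continuousAt_dslope_same.2 hφ).pow i
        have h2 := this.mul (R.continuous.continuousAt.comp hφ.continuousAt)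
        simpa only [ContinuousAt, Pi.mul_apply, Pi.pow_apply, dslope_same, Function.comp_apply,
          Pi.mul_def, Pi.pow_def, Function.comp_def] using h2
      have h2 : Tendsto (fun x : ℂ => x ^ (k + 1 - i) * w x) (𝓝[≠] 0) (𝓝 0) := by
        refine Tendsto.mono_left ?_ nhdsWithin_le_nhds
        have : ContinuousAt (fun x : ℂ => x ^ (k + 1 - i) * w x) 0 := by fun_prop
        simpa [ContinuousAt, show k + 1 - i ≠ 0 by omega] using this
      have h3 : deriv φ 0 ^ i * R.eval (φ 0) = 0 := by
        refine tendsto_nhds_unique_of_eventuallyEq h1 h2 ?_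
        filter_upwards [nhdsWithin_le_nhds h, self_mem_nhdsWithin] with x hx (hx0 : x ≠ 0)
        have e : φ x - φ 0 = x * dslope φ 0 x := by
          have := sub_smul_dslope φ 0 x
          simpa using this.symm
        rw [← hPev, hR] at hx
        simp only [Polynomial.eval_mul, Polynomial.eval_pow, Polynomial.eval_sub,
          Polynomial.eval_X, Polynomial.eval_C] at hx
        rw [e, mul_pow, ← Nat.sub_add_cancel (show i ≤ k + 1 by omega), pow_add] at hx
        have hxi : x ^ i ≠ 0 := pow_ne_zero _ hx0
        refine mul_left_cancel₀ hxi ?_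
        rw [← mul_assoc, hx]
        ring
      have h4 : R.IsRoot (φ 0) := (mul_eq_zero.1 h3).resolve_left (pow_ne_zero _ hφ')
      rw [hR, pow_succ]
      exact mul_dvd_mul_left _ (Polynomial.dvd_iff_isRoot.2 h4)
  have hP : P = (Polynomial.X - Polynomial.C (φ 0)) ^ (k + 1) := by
    refine (Polynomial.eq_of_monic_of_dvd_of_natDegree_le ?_ hmonic (hdvd _ le_rfl) ?_)
    · exact (Polynomial.monic_X_sub_C _).pow _
    · simp [hdeg]
  have hcoeff (n : ℕ) (hn : n ≤ k) : Q.coeff n = (-φ 0) ^ (k + 1 - n) * ((k + 1).choose n : ℂ) := by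
    have := congrArg (fun p => p.coeff n) hP
    simp only [P, Polynomial.coeff_add, Polynomial.coeff_X_pow,
      sub_eq_add_neg, ← Polynomial.C_neg, Polynomial.coeff_X_add_C_pow] at this
    rwa [if_neg (by omega), zero_add] at this
  have h0 : φ 0 = 0 := by
    have := hcoeff k le_rfl
    rw [hQk, dif_neg (lt_irrefl k), Nat.add_sub_cancel_left, pow_one] at this
    have hc : (((k + 1).choose k : ℕ) : ℂ) ≠ 0 := by
      exact_mod_cast (Nat.choose_pos (Nat.le_succ k)).ne'
    simpa only [zero_eq_mul, hc, or_false, neg_eq_zero] using this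
  refine ⟨h0, fun j => ?_⟩
  have := hcoeff j j.2.le
  rw [hQk, dif_pos j.2, h0, neg_zero, zero_pow (by omega), zero_mul] at this
  exact this

lemma tendsto_slice {Λ : Type*} [NormedAddCommGroup Λ] :
    Tendsto (fun x : ℂ => (x, (0 : Λ))) (𝓝 0) (𝓝 0) := by
  have : Continuous (fun x : ℂ => (x, (0 : Λ))) := by fun_prop
  exact this.tendsto 0

lemma hasDerivAt_ev_coord {k : ℕ} (u : Unknown k) {x : ℂ} (hx : ‖x‖ < 1) :
    HasDerivAt (fun x => ev x u.coord) (ev x u.2.1) x := by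
  have h := (hasDerivAt_ev_integral hx u.2.1).const_add u.1
  refine h.congr_of_eventuallyEq ?_
  filter_upwards [(continuous_norm.tendsto x).eventually_lt_const hx] with z hz
  rw [Unknown.coord, map_add, ev_algebraMap hz]

lemma analyticAt_ev_coord {Λ : Type*} [NormedAddCommGroup Λ] [NormedSpace ℂ Λ] {k : ℕ}
    {u : Λ → Unknown k} {l : Λ} (hu : AnalyticAt ℂ u l) :
    AnalyticAt ℂ (fun p : ℂ × Λ => ev p.1 (u p.2).coord) (0, l) :=
  analyticAt_ev_apply analyticAt_fst
    (AnalyticAt.comp (g := fun l => (u l).coord) (f := fun p : ℂ × Λ => p.2)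
      (analyticAt_coord hu) analyticAt_snd) (by simp)

lemma pderiv_ev_coord {Λ : Type*} {k : ℕ} (u : Λ → Unknown k) {p : ℂ × Λ} (hp : ‖p.1‖ < 1) :
    pderiv (fun p : ℂ × Λ => ev p.1 (u p.2).coord) p = ev p.1 (u p.2).2.1 := by
  rw [pderiv]
  exact (hasDerivAt_ev_coord (u p.2) hp).deriv

lemma eventually_regular (k : ℕ) : ∀ᶠ u in 𝓝 (Unknown.base k),
    ev 0 u.2.1 ≠ 0 ∧ 1 + u.2.2.2 * ev 0 u.coord ^ k ≠ 0 := by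
  have h1 : Continuous fun u : Unknown k => ev 0 u.2.1 := by fun_prop
  have h2 : ContinuousAt (fun u : Unknown k => ev 0 u.coord) (Unknown.base k) :=
    (ev 0).continuous.continuousAt.comp (analyticAt_coord analyticAt_id).continuousAt
  have h3 : ContinuousAt (fun u : Unknown k => 1 + u.2.2.2 * ev 0 u.coord ^ k)
      (Unknown.base k) := by
    fun_prop
  refine (h1.continuousAt.eventually_ne ?_).and (h3.eventually_ne ?_)
  · simp [Unknown.base, ev_one]
  · simp [Unknown.base]

/-- Solution of the conjugacy problem up to dilations: `f`, dilated by `σ` and normalised to have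
leading coefficient `1` for the parameter `0`, is conjugate to a normal form. -/
lemma exists_scaled_conjugacy {Λ : Type*} [NormedAddCommGroup Λ] [NormedSpace ℂ Λ]
    {f : ℂ × Λ → ℂ} {k : ℕ} {w : ℂ → ℂ} (hf : AnalyticAt ℂ f 0) (hw : AnalyticAt ℂ w 0)
    (hw0 : w 0 ≠ 0) (hfw : ∀ᶠ x in 𝓝 (0 : ℂ), f (x, 0) = x ^ (k + 1) * w x) :
    ∃ (σ : ℂ) (y : Fin k → Λ → ℂ) (μ : Λ → ℂ) (φ : ℂ × Λ → ℂ), σ ≠ 0 ∧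
      (∀ j, AnalyticAt ℂ (y j) 0 ∧ y j 0 = 0) ∧ AnalyticAt ℂ μ 0 ∧ AnalyticAt ℂ φ 0 ∧ φ 0 = 0 ∧
      pderiv φ 0 ≠ 0 ∧ 1 + μ 0 * φ 0 ^ k ≠ 0 ∧
      ∀ᶠ p in 𝓝 (0 : ℂ × Λ), (σ ^ (k + 1) * w 0)⁻¹ * f (σ * p.1, p.2) * pderiv φ p *
        (1 + μ p.2 * φ p ^ k) = φ p ^ (k + 1) + ∑ j : Fin k, y j p.2 * φ p ^ (j : ℕ) := by
  obtain ⟨H, hH, hH0, hHeq⟩ := exists_conjDefect_solution k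
  have hreg := hH.continuousAt.eventually (hH0.symm ▸ eventually_regular k)
  obtain ⟨σ, ⟨g, hg, ⟨hgH, hgeq, hg1, hg2⟩, hev⟩, hσ : 0 < σ⟩ :=
    ((exists_series_near_monomial hf hw hw0 hfw
      (hH.eventually_analyticAt.and (hHeq.eventually_nhds.and hreg))).and
      self_mem_nhdsWithin).exists
  have hσ' : (σ : ℂ) ≠ 0 := by exact_mod_cast hσ.ne'
  have hgeq' := hg.continuousAt.eventually hgeq
  obtain ⟨u, hu⟩ : ∃ u, u = fun l => H (g l) := ⟨_, rfl⟩
  have hua : AnalyticAt ℂ u 0 := hu ▸ hgH.comp hg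
  have hu0 : H (g 0) = u 0 := by rw [hu]
  rw [hu0] at hg1 hg2
  have hueq : ∀ᶠ l in 𝓝 0, conjDefect (g l) (u l) = 0 := by
    rw [hu]
    exact hgeq'
  clear hu hu0 hgeq hgeq' hgH hreg hHeq hH0 hH H
  have hy (j : Fin k) : AnalyticAt ℂ (fun l => (u l).2.2.1 j) 0 :=
    ((ContinuousLinearMap.proj (R := ℂ) (φ := fun _ : Fin k => ℂ) j).analyticAt _).comp
      ((analyticAt_fst.comp (analyticAt_snd.comp analyticAt_snd)).comp hua)
  have hμ : AnalyticAt ℂ (fun l => (u l).2.2.2) 0 :=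
    (analyticAt_snd.comp (analyticAt_snd.comp analyticAt_snd)).comp hua
  have hEq : ∀ᶠ p in 𝓝 (0 : ℂ × Λ), ((σ : ℂ) ^ (k + 1) * w 0)⁻¹ * f (σ * p.1, p.2) *
        pderiv (fun p : ℂ × Λ => ev p.1 (u p.2).coord) p *
        (1 + (u p.2).2.2.2 * ev p.1 (u p.2).coord ^ k) = ev p.1 (u p.2).coord ^ (k + 1)
          + ∑ j : Fin k, (u p.2).2.2.1 j * ev p.1 (u p.2).coord ^ (j : ℕ) := by
    have t1 : Tendsto (fun p : ℂ × Λ => p.1) (𝓝 0) (𝓝 0) := continuous_fst.tendsto _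
    have t2 : Tendsto (fun p : ℂ × Λ => p.2) (𝓝 0) (𝓝 0) := continuous_snd.tendsto _
    filter_upwards [t1.eventually eventually_norm_lt_one, t2.eventually hev,
      t2.eventually hueq] with p hp1 hp2 hp3
    have := ev_conjDefect (g p.2) (u p.2) hp1
    rw [hp3, map_zero, hp2 _ hp1] at this
    rw [pderiv_ev_coord u hp1]
    exact (sub_eq_zero.1 this.symm)
  have hφ' : pderiv (fun p : ℂ × Λ => ev p.1 (u p.2).coord) 0 ≠ 0 := by
    rw [pderiv_ev_coord u (by simp)]
    exact hg1
  have hw1 : ContinuousAt (fun x : ℂ => w (σ * x)) 0 :=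
    ContinuousAt.comp (g := w) (by simpa using hw.continuousAt) (by fun_prop)
  have h1 : ContinuousAt (fun x : ℂ => ev x (u 0).2.1) 0 :=
    (analyticAt_ev_apply analyticAt_id analyticAt_const (by simp)).continuousAt
  have h2 : ContinuousAt (fun x : ℂ => ev x (u 0).coord) 0 :=
    (analyticAt_ev_apply analyticAt_id analyticAt_const (by simp)).continuousAt
  -- For the parameter `0` the left-hand side of the equation vanishes to order `k + 1`.
  have hzero := eq_zero_of_vanishing_order (k := k) (y := (u 0).2.2.1)
    (φ := fun x => ev x (u 0).coord)
    (w := fun x => (σ ^ (k + 1) * w 0)⁻¹ * (σ ^ (k + 1) * w (σ * x)) * ev x (u 0).2.1 *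
      (1 + (u 0).2.2.2 * ev x (u 0).coord ^ k))
    (hasDerivAt_ev_coord _ (by simp)).differentiableAt hφ'
      (((continuousAt_const.mul (continuousAt_const.mul hw1)).mul h1).mul
        (continuousAt_const.add (continuousAt_const.mul (h2.pow k)))) (by
      filter_upwards [tendsto_slice.eventually hEq, eventually_norm_lt_one,
        (tendsto_const_mul_zero σ).eventually hfw] with x hx1 hx2 hx3
      rw [← hx1, pderiv_ev_coord u hx2, hx3]
      ring)
  exact ⟨σ, fun j l => (u l).2.2.1 j, fun l => (u l).2.2.2,
      fun p => ev p.1 (u p.2).coord, hσ', fun j => ⟨hy j, hzero.2 j⟩, hμ, analyticAt_ev_coord hua,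
      hzero.1, hφ', hg2, hEq⟩

section Scaling

variable {Λ : Type*} [NormedAddCommGroup Λ]

lemma tendsto_scale (s : ℂ) :
    Tendsto (fun p : ℂ × Λ => (s * p.1, p.2)) (𝓝 0) (𝓝 0) := by
  have h : Continuous (fun p : ℂ × Λ => (s * p.1, p.2)) := by fun_prop
  have := h.tendsto 0
  simpa only [Prod.fst_zero, Prod.snd_zero, mul_zero, Prod.mk_zero_zero] using this

variable [NormedSpace ℂ Λ]

lemma analyticAt_scale {φ : ℂ × Λ → ℂ} (hφ : AnalyticAt ℂ φ 0) (r s : ℂ) :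
    AnalyticAt ℂ (fun p : ℂ × Λ => r * φ (s * p.1, p.2)) 0 := by
  refine analyticAt_const.mul (AnalyticAt.comp (g := φ) (f := fun p : ℂ × Λ => (s * p.1, p.2)) ?_
    ((analyticAt_const.mul analyticAt_fst).prod analyticAt_snd))
  simpa [Prod.mk_zero_zero] using hφ

lemma pderiv_scale {φ : ℂ × Λ → ℂ} (hφ : AnalyticAt ℂ φ 0) (r s : ℂ) :
    ∀ᶠ p in 𝓝 (0 : ℂ × Λ), pderiv (fun p : ℂ × Λ => r * φ (s * p.1, p.2)) p =
      r * (pderiv φ (s * p.1, p.2) * s) := by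
  filter_upwards [(tendsto_scale s).eventually hφ.eventually_analyticAt] with p hp
  refine HasDerivAt.deriv (HasDerivAt.const_mul r ?_)
  refine HasDerivAt.comp (h₂ := fun z => φ (z, p.2)) p.1 (hasDerivAt_pderiv hp) ?_
  simpa using (hasDerivAt_id p.1).const_mul s

end Scaling

lemma exists_linearForm {m : ℕ} {ω : ℂ → ℂ} {f : ℂ × (Fin m → ℂ) → ℂ} (hω : AnalyticAt ℂ ω 0)
    (hω0 : ω 0 ≠ 0) (hf : Unfolds f 0 ω) :
    ∃ c : (Fin m → ℂ) → ℂ, IsLinearCoeff c ∧ AreConjugate f (linearForm c) := by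
  obtain ⟨σ, y, μ, φ, hσ, -, hμ, hφ, hφ0, hφ', hreg, hEq⟩ := exists_scaled_conjugacy (k := 0)
    (w := fun x => (ω x)⁻¹) hf.1
    (hω.inv hω0) (inv_ne_zero hω0) (hf.2.mono fun x hx => by rw [hx, div_eq_mul_inv])
  rw [pow_zero, mul_one] at hreg
  have hs := pderiv_scale hφ 1 σ⁻¹
  simp only [one_mul] at hs
  have hμne : ∀ᶠ p in 𝓝 (0 : ℂ × (Fin m → ℂ)), 1 + μ p.2 ≠ 0 := by
    have : ContinuousAt (fun p : ℂ × (Fin m → ℂ) => 1 + μ p.2) 0 :=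
      continuousAt_const.add (ContinuousAt.comp (g := μ) hμ.continuousAt continuous_snd.continuousAt)
    exact this.eventually_ne hreg
  refine ⟨fun l => (ω 0)⁻¹ / (1 + μ l), ⟨analyticAt_const.div (analyticAt_const.add hμ) hreg,
    div_ne_zero (inv_ne_zero hω0) hreg⟩, fun p => φ (σ⁻¹ * p.1, p.2),
    by simpa using analyticAt_scale hφ 1 σ⁻¹, ?_, ?_, ?_⟩
  · simpa [Prod.mk_zero_zero] using hφ0
  · have := hs.self_of_nhds
    rw [show deriv (fun x => φ (σ⁻¹ * (x, (0 : Fin m → ℂ)).1, (x, (0 : Fin m → ℂ)).2)) 0 =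
      pderiv (fun p : ℂ × (Fin m → ℂ) => φ (σ⁻¹ * p.1, p.2)) 0 from rfl, this]
    simpa [hσ, Prod.mk_zero_zero] using hφ'
  · filter_upwards [(tendsto_scale σ⁻¹).eventually hEq, hs, hμne] with p hp1 hp2 hp3
    change _ = pderiv (fun p : ℂ × (Fin m → ℂ) => φ (σ⁻¹ * p.1, p.2)) p * f p
    rw [hp2]
    simp only [mul_inv_cancel_left₀ hσ, Finset.univ_eq_empty, Finset.sum_empty, add_zero, pow_zero,
      mul_one, zero_add, pow_one] at hp1
    simp only [linearForm]
    rw [← hp1]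
    field_simp

lemma exists_normalForm {m k : ℕ} (hk : 1 ≤ k) {ω : ℂ → ℂ} {f : ℂ × (Fin m → ℂ) → ℂ}
    (hω : AnalyticAt ℂ ω 0) (hω0 : ω 0 ≠ 0) (hf : Unfolds f k ω) :
    ∃ (y : Fin k → (Fin m → ℂ) → ℂ) (μ : (Fin m → ℂ) → ℂ),
      IsNormalCoeffs y μ ∧ AreConjugate f (normalForm y μ) := by
  obtain ⟨σ, y, μ, φ, hσ, hy, hμ, hφ, hφ0, hφ', hreg, hEq⟩ := exists_scaled_conjugacy (k := k)
    (w := fun x => (ω x)⁻¹) hf.1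
    (hω.inv hω0) (inv_ne_zero hω0) (hf.2.mono fun x hx => by rw [hx, div_eq_mul_inv])
  -- The factor `r` turns the leading coefficient `σ ^ k / ω 0` of the scaled problem into `1`.
  obtain ⟨r, hr⟩ := IsAlgClosed.exists_pow_nat_eq (σ ^ k * (ω 0)⁻¹) hk
  have hr0 : r ≠ 0 := by
    rintro rfl
    rw [zero_pow (by omega)] at hr
    exact mul_ne_zero (pow_ne_zero _ hσ) (inv_ne_zero hω0) hr.symm
  have hs := pderiv_scale hφ r σ⁻¹
  have hne : ∀ᶠ p in 𝓝 (0 : ℂ × (Fin m → ℂ)), 1 + μ p.2 * φ p ^ k ≠ 0 := by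
    have h1 : ContinuousAt (fun p : ℂ × (Fin m → ℂ) => μ p.2) 0 :=
      ContinuousAt.comp (g := μ) hμ.continuousAt continuous_snd.continuousAt
    exact (continuousAt_const.add (h1.mul (hφ.continuousAt.pow k))).eventually_ne hreg
  refine ⟨fun j l => r ^ (k + 1 - (j : ℕ)) * y j l, fun l => μ l / r ^ k,
    ⟨fun j => ⟨analyticAt_const.mul (hy j).1, by simp [(hy j).2]⟩,
      hμ.div analyticAt_const (pow_ne_zero _ hr0)⟩, fun p => r * φ (σ⁻¹ * p.1, p.2),
    analyticAt_scale hφ r σ⁻¹, ?_, ?_, ?_⟩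
  · simpa [Prod.mk_zero_zero] using Or.inr hφ0
  · have := hs.self_of_nhds
    rw [show deriv (fun x => r * φ (σ⁻¹ * (x, (0 : Fin m → ℂ)).1, (x, (0 : Fin m → ℂ)).2)) 0 =
      pderiv (fun p : ℂ × (Fin m → ℂ) => r * φ (σ⁻¹ * p.1, p.2)) 0 from rfl, this]
    simpa [hσ, hr0, Prod.mk_zero_zero] using hφ'
  · filter_upwards [(tendsto_scale σ⁻¹).eventually hEq, hs,
      (tendsto_scale σ⁻¹).eventually hne] with p hp1 hp2 hp3
    change _ = pderiv (fun p : ℂ × (Fin m → ℂ) => r * φ (σ⁻¹ * p.1, p.2)) p * f p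
    rw [hp2]
    simp only [mul_inv_cancel_left₀ hσ, Prod.mk.eta] at hp1
    simp only [normalForm]
    set z := φ (σ⁻¹ * p.1, p.2)
    have e1 : ∑ j : Fin k, r ^ (k + 1 - (j : ℕ)) * y j p.2 * (r * z) ^ (j : ℕ) =
        r ^ (k + 1) * ∑ j : Fin k, y j p.2 * z ^ (j : ℕ) := by
      rw [Finset.mul_sum]
      refine Finset.sum_congr rfl fun j _ => ?_
      have := j.2
      rw [← Nat.sub_add_cancel (show (j : ℕ) ≤ k + 1 by omega), pow_add, Nat.add_sub_cancel]
      simp only [mul_pow]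
      ring
    have e2 : 1 + μ p.2 / r ^ k * (r * z) ^ k = 1 + μ p.2 * z ^ k := by
      rw [mul_pow]
      field_simp
    rw [e1, e2, mul_pow, ← mul_add, ← hp1, pow_succ r k, hr]
    field_simp
    ring

/-! ### Inverses and composition of conjugacies -/

section Inverse

variable {Λ : Type*} [NormedAddCommGroup Λ]

lemma eventually_slice {P : ℂ × Λ → Prop} {p : ℂ × Λ} (h : ∀ᶠ q in 𝓝 p, P q) :
    ∀ᶠ z in 𝓝 p.1, P (z, p.2) := by
  have : Tendsto (fun z : ℂ => (z, p.2)) (𝓝 p.1) (𝓝 p) :=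
    Continuous.tendsto' (by fun_prop) _ _ rfl
  exact this.eventually h

variable [NormedSpace ℂ Λ]

/-- A germ `φ` with invertible derivative has an inverse `ψ` with respect to the first variable. -/
lemma exists_local_inverse [CompleteSpace Λ] {φ : ℂ × Λ → ℂ} (hφ : AnalyticAt ℂ φ 0)
    (hφ0 : φ 0 = 0) (hφ' : pderiv φ 0 ≠ 0) :
    ∃ ψ : ℂ × Λ → ℂ, AnalyticAt ℂ ψ 0 ∧ ψ 0 = 0 ∧
      (∀ᶠ q in 𝓝 (0 : (ℂ × Λ) × ℂ), φ (q.2, q.1.2) = q.1.1 ↔ q.2 = ψ q.1) ∧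
      ∀ᶠ p in 𝓝 (0 : ℂ × Λ), φ (ψ p, p.2) = p.1 := by
  have hF : AnalyticAt ℂ (fun q : (ℂ × Λ) × ℂ => (pderiv φ 0)⁻¹ * (φ (q.2, q.1.2) - q.1.1))
      (0, 0) := by
    refine analyticAt_const.mul (AnalyticAt.sub ?_ (analyticAt_fst.comp analyticAt_fst))
    refine AnalyticAt.comp (g := φ) (f := fun q : (ℂ × Λ) × ℂ => (q.2, q.1.2)) hφ ?_
    exact analyticAt_snd.prod (analyticAt_snd.comp analyticAt_fst)
  obtain ⟨ψ, h1, h2, h3, h4⟩ := exists_analytic_implicit hF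
      (mul_eq_zero_of_right _ (sub_eq_zero.2 hφ0)) fun h => by
    have e : HasDerivAt (fun s : ℂ => (0 : ℂ) + s • h) h 0 := by
      simpa using (hasDerivAt_id (0 : ℂ)).mul_const h
    have h1 : HasDerivAt (fun x => φ (x, (0 : Λ))) (pderiv φ 0) ((0 : ℂ) + (0 : ℂ) • h) := by
      simpa using hasDerivAt_pderiv hφ
    have := ((h1.comp (0 : ℂ) e).sub_const 0).const_mul (pderiv φ 0)⁻¹
    rw [inv_mul_cancel_left₀ hφ'] at this
    exact this
  simp only [mul_eq_zero, inv_eq_zero, hφ', false_or, sub_eq_zero] at h3 h4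
  exact ⟨ψ, h1, h2, h3, h4⟩

lemma tendsto_pair {ψ : ℂ × Λ → ℂ} (hψ : AnalyticAt ℂ ψ 0) (hψ0 : ψ 0 = 0) :
    Tendsto (fun p : ℂ × Λ => (ψ p, p.2)) (𝓝 0) (𝓝 0) := by
  have h := hψ.continuousAt.tendsto.prodMk_nhds (continuous_snd.tendsto (0 : ℂ × Λ))
  rwa [hψ0, Prod.snd_zero, Prod.mk_zero_zero] at h

lemma analyticAt_pair {φ ψ : ℂ × Λ → ℂ} (hφ : AnalyticAt ℂ φ 0) (hψ : AnalyticAt ℂ ψ 0)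
    (hψ0 : ψ 0 = 0) : AnalyticAt ℂ (fun p : ℂ × Λ => φ (ψ p, p.2)) 0 := by
  refine AnalyticAt.comp (g := φ) (f := fun p : ℂ × Λ => (ψ p, p.2)) ?_ (hψ.prod analyticAt_snd)
  simpa [hψ0, Prod.mk_zero_zero] using hφ

lemma pderiv_pair {φ ψ : ℂ × Λ → ℂ} (hφ : AnalyticAt ℂ φ 0) (hψ : AnalyticAt ℂ ψ 0)
    (hψ0 : ψ 0 = 0) : ∀ᶠ p in 𝓝 (0 : ℂ × Λ),
      pderiv (fun p : ℂ × Λ => φ (ψ p, p.2)) p = pderiv φ (ψ p, p.2) * pderiv ψ p := by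
  filter_upwards [(tendsto_pair hψ hψ0).eventually hφ.eventually_analyticAt,
    hψ.eventually_analyticAt] with p h1 h2
  exact (HasDerivAt.comp (h₂ := fun z => φ (z, p.2)) p.1 (hasDerivAt_pderiv h1)
    (hasDerivAt_pderiv h2)).deriv

end Inverse

variable {m : ℕ}

lemma IsConjugacy.pderiv_ne_zero {f g φ : ℂ × (Fin m → ℂ) → ℂ} (h : IsConjugacy f g φ) :
    pderiv φ 0 ≠ 0 := h.invertible

lemma IsConjugacy.eventually {f g φ : ℂ × (Fin m → ℂ) → ℂ} (h : IsConjugacy f g φ) :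
    ∀ᶠ p in 𝓝 0, g (φ p, p.2) = pderiv φ p * f p := h.conj

/-- If `φ` conjugates `f` to `g` and `χ` conjugates `f` to `h`, then `g` and `h` are conjugate. -/
lemma IsConjugacy.areConjugate {f g h φ χ : ℂ × (Fin m → ℂ) → ℂ} (hφ : IsConjugacy f g φ)
    (hχ : IsConjugacy f h χ) : AreConjugate g h := by
  obtain ⟨ψ, hψ, hψ0, -, hinv⟩ := exists_local_inverse hφ.analytic hφ.map_zero hφ.pderiv_ne_zero
  have hd := pderiv_pair hφ.analytic hψ hψ0
  have hd' := pderiv_pair hχ.analytic hψ hψ0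
  have hone : ∀ᶠ p in 𝓝 (0 : ℂ × (Fin m → ℂ)), pderiv φ (ψ p, p.2) * pderiv ψ p = 1 := by
    filter_upwards [hd, hinv.eventually_nhds] with p h1 h2
    rw [← h1, pderiv]
    exact ((hasDerivAt_id p.1).congr_of_eventuallyEq (eventually_slice h2)).deriv
  refine ⟨fun p => χ (ψ p, p.2), analyticAt_pair hχ.analytic hψ hψ0, ?_, ?_, ?_⟩
  · simpa [hψ0, Prod.mk_zero_zero] using hχ.map_zero
  · change pderiv (fun p => χ (ψ p, p.2)) 0 ≠ 0
    rw [hd'.self_of_nhds]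
    refine mul_ne_zero ?_ (right_ne_zero_of_mul_eq_one hone.self_of_nhds)
    simpa [hψ0, Prod.mk_zero_zero] using hχ.pderiv_ne_zero
  · filter_upwards [hd', hone, hinv, (tendsto_pair hψ hψ0).eventually hφ.eventually,
      (tendsto_pair hψ hψ0).eventually hχ.eventually] with p h1 h2 h3 h4 h5
    change _ = pderiv (fun p => χ (ψ p, p.2)) p * g p
    rw [h1]
    rw [h5]
    rw [h3, Prod.mk.eta] at h4
    rw [h4]
    linear_combination (-pderiv χ (ψ p, p.2) * f (ψ p, p.2)) * h2

/-- A conjugacy may be followed by a homothety. -/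
lemma IsConjugacy.const_mul {f g h φ : ℂ × (Fin m → ℂ) → ℂ} (hφ : IsConjugacy f g φ) {c : ℂ}
    (hc : c ≠ 0) (hgh : ∀ᶠ p in 𝓝 (0 : ℂ × (Fin m → ℂ)), h (c * p.1, p.2) = c * g p) :
    IsConjugacy f h (fun p => c * φ p) where
  analytic := analyticAt_const.mul hφ.analytic
  map_zero := by simp [hφ.map_zero]
  invertible := by
    change pderiv (fun p => c * φ p) 0 ≠ 0
    rw [show pderiv (fun p => c * φ p) 0 = c * pderiv φ 0 from
      ((hasDerivAt_pderiv hφ.analytic).const_mul c).deriv]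
    exact mul_ne_zero hc hφ.pderiv_ne_zero
  conj := by
    filter_upwards [hφ.eventually, hφ.analytic.eventually_analyticAt,
      (tendsto_pair hφ.analytic hφ.map_zero).eventually hgh] with p h1 h2 h3
    rw [h3, h1, (((hasDerivAt_pderiv h2).const_mul c).deriv)]
    ring

lemma IsConjugacy.congr {f g g' φ : ℂ × (Fin m → ℂ) → ℂ} (hφ : IsConjugacy f g φ)
    (h : g =ᶠ[𝓝 0] g') : IsConjugacy f g' φ where
  analytic := hφ.analytic
  map_zero := hφ.map_zero
  invertible := hφ.invertible
  conj := by
    filter_upwards [hφ.conj, (tendsto_pair hφ.analytic hφ.map_zero).eventually h] with p h1 h2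
    rw [← h2, h1]

/-! ### Uniqueness of the linear normal form -/

/-- A conjugacy between linear families is linear, and the two families are the same:
differentiating `c' φ = φ' c x` at the origin gives `c' = c`, hence `φ = x φ'` and `φ'' = 0`. -/
lemma IsConjugacy.linear {c c' : (Fin m → ℂ) → ℂ} {φ : ℂ × (Fin m → ℂ) → ℂ}
    (hc : IsLinearCoeff c)
    (hφ : IsConjugacy (linearForm c) (linearForm c') φ) :
    c' =ᶠ[𝓝 0] c ∧ ∀ᶠ p in 𝓝 (0 : ℂ × (Fin m → ℂ)), φ p = pderiv φ (0, p.2) * p.1 := by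
  have hd := analyticAt_pderiv hφ.analytic
  have hl : Tendsto (fun l : Fin m → ℂ => ((0 : ℂ), l)) (𝓝 0) (𝓝 0) :=
    Continuous.tendsto' (by fun_prop) _ _ rfl
  have hcc : c' =ᶠ[𝓝 0] c := by
    filter_upwards [hl.eventually hφ.eventually.eventually_nhds,
      hl.eventually hφ.analytic.eventually_analyticAt, hl.eventually hd.eventually_analyticAt,
      hl.eventually (hd.continuousAt.eventually_ne hφ.pderiv_ne_zero)] with l h1 h2 h3 h4
    have e1 : HasDerivAt (fun x => c' l * φ (x, l)) (c' l * pderiv φ (0, l)) 0 :=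
      (hasDerivAt_pderiv h2).const_mul (c' l)
    have e2 : HasDerivAt (fun x => pderiv φ (x, l) * (c l * x))
        (pderiv (pderiv φ) (0, l) * (c l * 0) + pderiv φ (0, l) * (c l * 1)) 0 :=
      (hasDerivAt_pderiv h3).mul ((hasDerivAt_id (0 : ℂ)).const_mul (c l))
    have e3 := e1.unique (e2.congr_of_eventuallyEq (eventually_slice h1))
    refine mul_right_cancel₀ h4 ?_
    linear_combination e3
  refine ⟨hcc, ?_⟩
  have hcne := hc.1.continuousAt.eventually_ne hc.2
  have hball : ∀ᶠ p in 𝓝 (0 : ℂ × (Fin m → ℂ)), φ p = pderiv φ p * p.1 ∧ AnalyticAt ℂ φ p := by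
    filter_upwards [hφ.eventually, hφ.analytic.eventually_analyticAt,
      (continuous_snd.tendsto (0 : ℂ × (Fin m → ℂ))).eventually hcc,
      (continuous_snd.tendsto (0 : ℂ × (Fin m → ℂ))).eventually hcne] with p h1 h2 h3 h4
    refine ⟨mul_left_cancel₀ h4 ?_, h2⟩
    simp only [linearForm, h3] at h1
    rw [h1]
    ring
  obtain ⟨ε, hε, hb⟩ := Metric.eventually_nhds_iff_ball.1 hball
  filter_upwards [Metric.ball_mem_nhds _ hε] with p hp
  have hpl : ‖p.1‖ < ε ∧ ‖p.2‖ < ε := by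
    simpa [Prod.norm_def] using hp
  have hmem {x : ℂ} (hx : x ∈ Metric.ball (0 : ℂ) ε) : (x, p.2) ∈ Metric.ball 0 ε := by
    simpa [Prod.norm_def, hpl.2] using hx
  have hzero {x : ℂ} (hx : x ∈ Metric.ball (0 : ℂ) ε) (hx0 : x ≠ 0) :
      pderiv (pderiv φ) (x, p.2) = 0 := by
    have h1 := hasDerivAt_pderiv (hb _ (hmem hx)).2
    have h2 : HasDerivAt (fun x => pderiv φ (x, p.2) * x)
        (pderiv (pderiv φ) (x, p.2) * x + pderiv φ (x, p.2) * 1) x :=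
      (hasDerivAt_pderiv (analyticAt_pderiv (hb _ (hmem hx)).2)).mul (hasDerivAt_id x)
    have h3 := h1.unique (h2.congr_of_eventuallyEq (by
      filter_upwards [Metric.isOpen_ball.mem_nhds hx] with z hz
      exact (hb _ (hmem hz)).1))
    have h4 : pderiv (pderiv φ) (x, p.2) * x = 0 := by linear_combination -h3
    exact (mul_eq_zero.1 h4).resolve_right hx0
  have hzero' {x : ℂ} (hx : x ∈ Metric.ball (0 : ℂ) ε) : pderiv (pderiv φ) (x, p.2) = 0 := by
    rcases eq_or_ne x 0 with rfl | hx0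
    · have hc : ContinuousAt (fun z => pderiv (pderiv φ) (z, p.2)) 0 :=
        ContinuousAt.comp (g := pderiv (pderiv φ))
          (analyticAt_pderiv (analyticAt_pderiv (hb _ (hmem hx)).2)).continuousAt (by fun_prop)
      have h1 : Tendsto (fun z => pderiv (pderiv φ) (z, p.2)) (𝓝[≠] 0)
          (𝓝 (pderiv (pderiv φ) (0, p.2))) := hc.tendsto.mono_left nhdsWithin_le_nhds
      refine tendsto_nhds_unique_of_eventuallyEq h1 tendsto_const_nhds ?_
      filter_upwards [nhdsWithin_le_nhds (Metric.isOpen_ball.mem_nhds hx), self_mem_nhdsWithin]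
        with z hz1 hz2
      exact hzero hz1 hz2
    · exact hzero hx hx0
  have hconst : pderiv φ p = pderiv φ (0, p.2) := by
    refine (convex_ball (0 : ℂ) ε).is_const_of_fderivWithin_eq_zero (𝕜 := ℂ)
      (f := fun x => pderiv φ (x, p.2)) (x := p.1) (y := 0) ?_ ?_ (by simpa using hpl.1) (by simpa)
    · intro x hx
      exact (hasDerivAt_pderiv (analyticAt_pderiv
        (hb _ (hmem hx)).2)).differentiableAt.differentiableWithinAt
    · intro x hx
      have h := hasDerivAt_pderiv (analyticAt_pderiv (hb _ (hmem hx)).2)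
      rw [hzero' hx] at h
      rw [(h.hasFDerivAt.hasFDerivWithinAt).fderivWithin
        (Metric.isOpen_ball.uniqueDiffWithinAt hx)]
      ext
      simp
  rw [(hb p hp).1, hconst]

lemma IsConjugacy.exists_exp {c c' : (Fin m → ℂ) → ℂ} {φ : ℂ × (Fin m → ℂ) → ℂ}
    (hc : IsLinearCoeff c)
    (hφ : IsConjugacy (linearForm c) (linearForm c') φ) :
    ∃ t : (Fin m → ℂ) → ℂ, AnalyticAt ℂ t 0 ∧
      ∀ᶠ p in 𝓝 (0 : ℂ × (Fin m → ℂ)), φ p = exp (t p.2) * p.1 := by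
  obtain ⟨t₀, ht₀⟩ : ∃ t₀, exp t₀ = pderiv φ 0 := ⟨_, Complex.exp_log hφ.pderiv_ne_zero⟩
  have hι : AnalyticAt ℂ (fun l : Fin m → ℂ => ((0 : ℂ), l)) 0 :=
    analyticAt_const.prod analyticAt_id
  have hA : AnalyticAt ℂ (fun l => pderiv φ (0, l)) 0 :=
    AnalyticAt.comp (g := pderiv φ) (f := fun l : Fin m → ℂ => ((0 : ℂ), l))
      (analyticAt_pderiv hφ.analytic) hι
  have h1 : pderiv φ (0, 0) / pderiv φ 0 = 1 := div_self hφ.pderiv_ne_zero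
  refine ⟨fun l => t₀ + log (pderiv φ (0, l) / pderiv φ 0), analyticAt_const.add
    ((hA.div analyticAt_const hφ.pderiv_ne_zero).clog ?_), ?_⟩
  · change pderiv φ (0, 0) / pderiv φ 0 ∈ slitPlane
    rw [h1]
    exact one_mem_slitPlane
  · have hne : ∀ᶠ l : Fin m → ℂ in 𝓝 0, pderiv φ (0, l) ≠ 0 :=
      hA.continuousAt.eventually_ne hφ.pderiv_ne_zero
    filter_upwards [(hφ.linear hc).2,
      (continuous_snd.tendsto (0 : ℂ × (Fin m → ℂ))).eventually hne] with p h1 h2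
    rw [h1, exp_add, exp_log (div_ne_zero h2 hφ.pderiv_ne_zero), ht₀,
      mul_div_cancel₀ _ hφ.pderiv_ne_zero]

/-- The coefficient of the linear normal form is unique. -/
lemma areConjugate_linearForm_iff {c c' : (Fin m → ℂ) → ℂ} (hc : IsLinearCoeff c)
    {f : ℂ × (Fin m → ℂ) → ℂ} (hf : AreConjugate f (linearForm c)) :
    AreConjugate f (linearForm c') ↔ c' =ᶠ[𝓝 0] c := by
  obtain ⟨φ, hφ⟩ := hf
  constructor
  · rintro ⟨χ, hχ⟩
    obtain ⟨θ, hθ⟩ := hφ.areConjugate hχ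
    exact (hθ.linear hc).1
  · intro h
    refine ⟨φ, hφ.congr ?_⟩
    filter_upwards [(continuous_snd.tendsto (0 : ℂ × (Fin m → ℂ))).eventually h] with p hp
    simp [linearForm, hp]

end AbsSeriesGerms

/-! ### Residues -/

/-- The integral of `g` over small circles around `a` is `2πi R`. -/
def HasResidue (g : ℂ → ℂ) (a R : ℂ) : Prop :=
  ∀ᶠ r in 𝓝[>] (0 : ℝ), CircleIntegrable g a r ∧
    (2 * (Real.pi : ℂ) * I)⁻¹ * circleIntegral g a r = R

lemma HasResidue.residue_eq {g : ℂ → ℂ} {a R : ℂ} (h : HasResidue g a R) : residue g a = R := by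
  refine Tendsto.limUnder_eq (tendsto_const_nhds.congr' ?_)
  filter_upwards [h] with r hr
  exact hr.2.symm

lemma HasResidue.add {g h : ℂ → ℂ} {a R S : ℂ} (hg : HasResidue g a R) (hh : HasResidue h a S) :
    HasResidue (fun x => g x + h x) a (R + S) := by
  filter_upwards [Filter.Eventually.and hg hh] with r ⟨h1, h2⟩
  refine ⟨h1.1.add h2.1, ?_⟩
  rw [circleIntegral.integral_add h1.1 h2.1, mul_add, h1.2, h2.2]

lemma HasResidue.sum {ι : Type*} (s : Finset ι) {g : ι → ℂ → ℂ} {a : ℂ} {R : ι → ℂ}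
    (hg : ∀ i ∈ s, HasResidue (g i) a (R i)) :
    HasResidue (fun x => ∑ i ∈ s, g i x) a (∑ i ∈ s, R i) := by
  classical
  induction s using Finset.induction_on with
  | empty =>
    refine Eventually.of_forall fun r => ⟨?_, ?_⟩
    · simp
    · simp [circleIntegral]
  | insert i s hi ih =>
    simp only [Finset.sum_insert hi]
    exact (hg i (Finset.mem_insert_self _ _)).add
      (ih fun j hj => hg j (Finset.mem_insert_of_mem hj))

lemma eventually_sphere {P : ℂ → Prop} {a : ℂ} (h : ∀ᶠ x in 𝓝[≠] a, P x) :
    ∀ᶠ r in 𝓝[>] (0 : ℝ), ∀ x ∈ Metric.sphere a r, P x := by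
  obtain ⟨ε, hε, hb⟩ := Metric.mem_nhdsWithin_iff.1 h
  filter_upwards [Ioo_mem_nhdsGT hε] with r hr x hx
  rw [mem_sphere_iff_norm] at hx
  refine hb ⟨by rw [mem_ball_iff_norm, hx]; exact hr.2, ?_⟩
  rintro rfl
  simp at hx
  exact hr.1.ne hx

lemma HasResidue.congr {g h : ℂ → ℂ} {a R : ℂ} (hg : HasResidue g a R)
    (he : ∀ᶠ x in 𝓝[≠] a, g x = h x) : HasResidue h a R := by
  filter_upwards [hg, eventually_sphere he, self_mem_nhdsWithin] with r h1 h2 (h3 : 0 < r)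
  refine ⟨h1.1.congr ?_, ?_⟩
  · exact fun θ _ => h2 _ (circleMap_mem_sphere a h3.le θ)
  · rw [← h1.2]
    congr 1
    exact (circleIntegral.integral_congr h3.le h2).symm

/-- A simple pole. -/
lemma hasResidue_inv_mul {h : ℂ → ℂ} {a : ℂ} (hh : AnalyticAt ℂ h a) :
    HasResidue (fun x => (x - a)⁻¹ * h x) a (h a) := by
  obtain ⟨ε, hε, hb⟩ := Metric.eventually_nhds_iff_ball.1 hh.eventually_analyticAt
  filter_upwards [Ioo_mem_nhdsGT hε] with r hr
  have hsub : Metric.closedBall a r ⊆ Metric.ball a ε := Metric.closedBall_subset_ball hr.2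
  have hd : DifferentiableOn ℂ h (Metric.closedBall a r) := fun x hx =>
    (hb x (hsub hx)).differentiableAt.differentiableWithinAt
  refine ⟨?_, ?_⟩
  · refine ContinuousOn.circleIntegrable hr.1.le (ContinuousOn.mul (ContinuousOn.inv₀ (by fun_prop)
      fun x hx => ?_) (hd.continuousOn.mono Metric.sphere_subset_closedBall))
    rw [mem_sphere_iff_norm] at hx
    rw [← norm_pos_iff, hx]
    exact hr.1
  · have := hd.diffContOnCl_ball le_rfl |>.circleIntegral_sub_inv_smul (Metric.mem_ball_self hr.1)
    simp only [smul_eq_mul] at this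
    rw [this, inv_mul_cancel_left₀ two_pi_I_ne_zero]

lemma hasResidue_of_analyticAt {h : ℂ → ℂ} {a : ℂ} (hh : AnalyticAt ℂ h a) :
    HasResidue h a 0 := by
  have := hasResidue_inv_mul (h := fun x => (x - a) * h x)
    ((analyticAt_id.sub analyticAt_const).mul hh)
  rw [sub_self, zero_mul] at this
  refine this.congr ?_
  filter_upwards [self_mem_nhdsWithin] with x hx
  exact inv_mul_cancel_left₀ (sub_ne_zero.2 hx) _

/-- A form with a primitive on a punctured neighbourhood has no residue. -/
lemma hasResidue_deriv {G : ℂ → ℂ} {a : ℂ} (hG : ∀ᶠ x in 𝓝[≠] a, AnalyticAt ℂ G x) :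
    HasResidue (deriv G) a 0 := by
  filter_upwards [eventually_sphere hG, self_mem_nhdsWithin] with r h (hr : 0 < r)
  refine ⟨ContinuousOn.circleIntegrable hr.le fun x hx =>
    (h x hx).deriv.continuousAt.continuousWithinAt, ?_⟩
  rw [circleIntegral.integral_eq_zero_of_hasDerivWithinAt hr.le fun x hx =>
    (h x hx).differentiableAt.hasDerivAt.hasDerivWithinAt, mul_zero]

/-! ### Partial fractions -/

/-- Off the finite set `T`, `R` is `∑ c b / (z - b)` plus a derivative, and `∑ c b = σ`. -/
def HasSimpleParts (T : Finset ℂ) (R : ℂ → ℂ) (σ : ℂ) : Prop :=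
  ∃ (c : ℂ → ℂ) (G : ℂ → ℂ), (∀ z ∉ T, AnalyticAt ℂ G z) ∧
    (∀ z ∉ T, R z = ∑ b ∈ T, c b * (z - b)⁻¹ + deriv G z) ∧ ∑ b ∈ T, c b = σ

lemma HasSimpleParts.add {T : Finset ℂ} {R R' : ℂ → ℂ} {σ σ' : ℂ} (h : HasSimpleParts T R σ)
    (h' : HasSimpleParts T R' σ') : HasSimpleParts T (fun z => R z + R' z) (σ + σ') := by
  obtain ⟨c, G, hG, hR, hs⟩ := h
  obtain ⟨c', G', hG', hR', hs'⟩ := h'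
  refine ⟨fun b => c b + c' b, fun z => G z + G' z, fun z hz => (hG z hz).add (hG' z hz),
    fun z hz => ?_, by rw [Finset.sum_add_distrib, hs, hs']⟩
  simp only [hR z hz, hR' z hz]
  rw [deriv_fun_add (hG z hz).differentiableAt (hG' z hz).differentiableAt]
  simp only [add_mul, Finset.sum_add_distrib]
  ring

lemma HasSimpleParts.const_mul {T : Finset ℂ} {R : ℂ → ℂ} {σ : ℂ} (h : HasSimpleParts T R σ)
    (a : ℂ) : HasSimpleParts T (fun z => a * R z) (a * σ) := by
  obtain ⟨c, G, hG, hR, hs⟩ := h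
  refine ⟨fun b => a * c b, fun z => a * G z, fun z hz => analyticAt_const.mul (hG z hz),
    fun z hz => ?_, by rw [← Finset.mul_sum, hs]⟩
  simp only [hR z hz]
  rw [deriv_const_mul _ (hG z hz).differentiableAt, mul_add, Finset.mul_sum]
  simp only [mul_assoc]

lemma HasSimpleParts.congr {T : Finset ℂ} {R R' : ℂ → ℂ} {σ : ℂ} (h : HasSimpleParts T R σ)
    (he : ∀ z ∉ T, R' z = R z) : HasSimpleParts T R' σ := by
  obtain ⟨c, G, hG, hR, hs⟩ := h
  exact ⟨c, G, hG, fun z hz => (he z hz).trans (hR z hz), hs⟩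

/-- The product `∏ (z - b)` over a multiset of points `b`. -/
def rootProd (s : Multiset ℂ) (z : ℂ) : ℂ := (s.map (z - ·)).prod

lemma rootProd_cons (b : ℂ) (s : Multiset ℂ) (z : ℂ) :
    rootProd (b ::ₘ s) z = (z - b) * rootProd s z := by simp [rootProd]

lemma rootProd_eq_zero {s : Multiset ℂ} {z : ℂ} : rootProd s z = 0 ↔ z ∈ s := by
  simp [rootProd, Multiset.prod_eq_zero_iff, sub_eq_zero]

/-- By induction on the degree: if two roots `b ≠ b'` occur, then
`1 / ((z - b) (z - b')) = (b - b')⁻¹ (1 / (z - b) - 1 / (z - b'))` lowers it, and otherwise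
`1 / (z - b) ^ (n + 1)` is a derivative for `0 < n`. -/
lemma hasSimpleParts_inv_rootProd (T : Finset ℂ) (n : ℕ) :
    ∀ s : Multiset ℂ, s.card = n + 1 → (∀ b ∈ s, b ∈ T) →
      HasSimpleParts T (fun z => (rootProd s z)⁻¹) (if n = 0 then 1 else 0) := by
  induction n with
  | zero =>
    intro s hs hT
    obtain ⟨b, rfl⟩ := Multiset.card_eq_one.1 hs
    have hb := hT b (by simp)
    refine ⟨fun a => if a = b then 1 else 0, fun _ => 0, fun _ _ => analyticAt_const,
      fun z _ => ?_, by simp [hb]⟩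
    simp [rootProd, hb]
  | succ n ih =>
    intro s hs hT
    obtain ⟨b, hb⟩ := Multiset.card_pos_iff_exists_mem.1 (show 0 < s.card by omega)
    by_cases hall : ∀ a ∈ s, a = b
    · rw [Multiset.eq_replicate.2 ⟨hs, hall⟩]
      have hsub {z : ℂ} (hz : z ∉ T) : z - b ≠ 0 := sub_ne_zero.2 fun h => hz (h ▸ hT b hb)
      have hn := Nat.cast_add_one_ne_zero (R := ℂ) n
      refine ⟨fun _ => 0, fun z => -((n : ℂ) + 1)⁻¹ * ((z - b) ^ (n + 1))⁻¹, fun z hz => ?_,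
        fun z hz => ?_, by simp⟩
      · exact analyticAt_const.mul (((analyticAt_id.sub analyticAt_const).pow _).inv
          (pow_ne_zero _ (hsub hz)))
      · have h1 : HasDerivAt (fun z => -((n : ℂ) + 1)⁻¹ * ((z - b) ^ (n + 1))⁻¹)
          (-((n : ℂ) + 1)⁻¹ * (-(((n + 1 : ℕ) : ℂ) * (z - b) ^ n * 1) / ((z - b) ^ (n + 1)) ^ 2)) z :=
          ((((hasDerivAt_id z).sub_const b).fun_pow (n + 1)).fun_inv
            (pow_ne_zero _ (hsub hz))).const_mul _
        rw [h1.deriv]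
        have := hsub hz
        simp only [rootProd, Multiset.map_replicate, Multiset.prod_replicate, zero_mul,
          Finset.sum_const_zero, zero_add]
        push_cast
        field_simp
        ring
    · push Not at hall
      obtain ⟨b', hb', hne⟩ := hall
      obtain ⟨t, rfl⟩ := Multiset.exists_cons_of_mem hb
      obtain ⟨u, rfl⟩ := Multiset.exists_cons_of_mem
        ((Multiset.mem_cons.1 hb').resolve_left hne)
      simp only [Multiset.card_cons] at hs
      have h1 := ih (b ::ₘ u) (by simp; omega) fun a ha => hT a (by simp at ha ⊢; tauto)
      have h2 := ih (b' ::ₘ u) (by simp; omega) fun a ha => hT a (by simp at ha ⊢; tauto)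
      have h3 := (h1.add (h2.const_mul (-1))).const_mul (b - b')⁻¹
      rw [show (b - b')⁻¹ * ((if n = 0 then (1 : ℂ) else 0) + -1 * if n = 0 then 1 else 0) =
        if n + 1 = 0 then 1 else 0 by split_ifs <;> simp_all] at h3
      refine h3.congr fun z hz => ?_
      have e1 : z - b ≠ 0 := sub_ne_zero.2 fun h => hz (h ▸ hT b hb)
      have e2 : z - b' ≠ 0 := sub_ne_zero.2 fun h => hz (h ▸ hT b' hb')
      have e3 : b - b' ≠ 0 := sub_ne_zero.2 hne.symm
      simp only [rootProd_cons, mul_inv]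
      field_simp
      ring

lemma hasSimpleParts_pow_div_rootProd (T : Finset ℂ) (j : ℕ) :
    ∀ (n : ℕ) (s : Multiset ℂ), s.card = n + 1 → j ≤ n → (∀ b ∈ s, b ∈ T) →
      HasSimpleParts T (fun z => z ^ j * (rootProd s z)⁻¹) (if j = n then 1 else 0) := by
  induction j with
  | zero =>
    intro n s hs _ hT
    simpa [eq_comm] using hasSimpleParts_inv_rootProd T n s hs hT
  | succ j ih =>
    intro n s hs hj hT
    obtain ⟨n, rfl⟩ := Nat.exists_eq_succ_of_ne_zero (show n ≠ 0 by omega)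
    obtain ⟨b, hb⟩ := Multiset.card_pos_iff_exists_mem.1 (show 0 < s.card by omega)
    have h1 := ih (n + 1) s hs (by omega) hT
    obtain ⟨u, rfl⟩ := Multiset.exists_cons_of_mem hb
    simp only [Multiset.card_cons] at hs
    have h2 := ih n u (by omega) (by omega) fun a ha => hT a (Multiset.mem_cons_of_mem ha)
    have h3 := h2.add (h1.const_mul b)
    rw [if_neg (show j ≠ n + 1 by omega), mul_zero, add_zero] at h3
    simp only [Nat.succ_eq_add_one, Nat.add_right_cancel_iff]
    refine h3.congr fun z hz => ?_
    have e1 : z - b ≠ 0 := sub_ne_zero.2 fun h => hz (h ▸ hT b hb)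
    simp only [rootProd_cons, mul_inv]
    field_simp
    ring

lemma exists_rootProd {k : ℕ} (y : Fin k → ℂ) : ∃ s : Multiset ℂ, s.card = k + 1 ∧
    ∀ z, z ^ (k + 1) + ∑ j : Fin k, y j * z ^ (j : ℕ) = rootProd s z := by
  let Q : Polynomial ℂ := ∑ j : Fin k, Polynomial.C (y j) * Polynomial.X ^ (j : ℕ)
  let P : Polynomial ℂ := Polynomial.X ^ (k + 1) + Q
  have hQdeg : Q.degree < (k + 1 : ℕ) := by
    refine (Polynomial.degree_sum_fin_lt y).trans ?_
    exact_mod_cast Nat.lt_succ_self k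
  have hmonic : P.Monic := Polynomial.monic_X_pow_add hQdeg
  have hdeg : P.natDegree = k + 1 := by
    rw [Polynomial.natDegree_eq_of_degree_eq_some]
    rw [Polynomial.degree_add_eq_left_of_degree_lt (by rwa [Polynomial.degree_X_pow]),
      Polynomial.degree_X_pow]
  have hs : P.Splits := IsAlgClosed.splits P
  refine ⟨P.roots, ?_, fun z => ?_⟩
  · rw [← hdeg, hs.natDegree_eq_card_roots]
  · have := congrArg (Polynomial.eval z) hs.eq_prod_roots
    rw [hmonic.leadingCoeff, Polynomial.C_1, one_mul, Polynomial.eval_multiset_prod,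
      Multiset.map_map] at this
    simp only [Function.comp_def, Polynomial.eval_sub, Polynomial.eval_X, Polynomial.eval_C] at this
    rw [rootProd, ← this]
    simp [P, Q, Polynomial.eval_finsetSum]

/-! ### The residue at infinity of a normal form -/

/-- In the coordinate `w = 1 / z` the dual form has a simple pole at the origin. -/
lemma residueAtInfinity_normalForm {m k : ℕ} (hk : 1 ≤ k) (y : Fin k → (Fin m → ℂ) → ℂ)
    (μ : (Fin m → ℂ) → ℂ) (l : Fin m → ℂ) :
    μ l = -residueAtInfinity (fun x => (normalForm y μ (x, l))⁻¹) := by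
  have hD : AnalyticAt ℂ (fun w : ℂ => 1 + ∑ j : Fin k, y j l * w ^ (k + 1 - (j : ℕ))) 0 :=
    analyticAt_const.add (Finset.analyticAt_fun_sum _ fun j _ =>
      analyticAt_const.mul (analyticAt_id.pow _))
  have hD0 : (1 : ℂ) + ∑ j : Fin k, y j l * (0 : ℂ) ^ (k + 1 - (j : ℕ)) = 1 := by
    rw [Finset.sum_eq_zero, add_zero]
    intro j _
    rw [zero_pow (by omega), mul_zero]
  have hA : AnalyticAt ℂ (fun w : ℂ => -((w ^ k + μ l) /
      (1 + ∑ j : Fin k, y j l * w ^ (k + 1 - (j : ℕ))))) 0 :=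
    (((analyticAt_id.pow k).add analyticAt_const).div hD (by rw [hD0]; exact one_ne_zero)).neg
  have hR := hasResidue_inv_mul hA
  rw [hD0, zero_pow (by omega), zero_add, div_one] at hR
  have := hR.congr (h := fun w => -(w ^ 2)⁻¹ * (normalForm y μ (w⁻¹, l))⁻¹) (by
    filter_upwards [self_mem_nhdsWithin] with w (hw : w ≠ 0)
    have e1 : (w⁻¹) ^ (k + 1) + ∑ j : Fin k, y j l * (w⁻¹) ^ (j : ℕ) =
        (w⁻¹) ^ (k + 1) * (1 + ∑ j : Fin k, y j l * w ^ (k + 1 - (j : ℕ))) := by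
      rw [mul_add, mul_one, Finset.mul_sum]
      congr 1
      refine Finset.sum_congr rfl fun j _ => ?_
      have hj : (w⁻¹) ^ (k + 1) = (w⁻¹) ^ (k + 1 - (j : ℕ)) * (w⁻¹) ^ (j : ℕ) := by
        rw [← pow_add, Nat.sub_add_cancel (by omega)]
      have hw1 : (w⁻¹) ^ (k + 1 - (j : ℕ)) * w ^ (k + 1 - (j : ℕ)) = 1 := by
        rw [← mul_pow, inv_mul_cancel₀ hw, one_pow]
      rw [hj]
      linear_combination (-(y j l * (w⁻¹) ^ (j : ℕ))) * hw1
    have e2 : 1 + μ l * (w⁻¹) ^ k = (w⁻¹) ^ k * (w ^ k + μ l) := by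
      rw [mul_add, ← mul_pow, inv_mul_cancel₀ hw, one_pow]
      ring
    simp only [normalForm, e1, e2, inv_div, sub_zero]
    generalize (1 + ∑ j : Fin k, y j l * w ^ (k + 1 - (j : ℕ))) = D
    rw [pow_succ (w⁻¹), mul_assoc (w⁻¹ ^ k), mul_div_mul_left _ _ (pow_ne_zero k (inv_ne_zero hw)),
      ← div_div, div_inv_eq_mul]
    field_simp)
  rw [residueAtInfinity, this.residue_eq, neg_neg]

/-! ### The sum of the residues over the local polar locus -/

/-- Small lower coefficients of a monic polynomial force its roots to be small. -/
lemma eventually_roots_small {Λ : Type*} [TopologicalSpace Λ] {l₀ : Λ} {k : ℕ} {y : Fin k → Λ → ℂ}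
    (hy : ∀ j, ContinuousAt (y j) l₀) (hy0 : ∀ j, y j l₀ = 0) {η : ℝ} (hη : 0 < η) :
    ∀ᶠ l in 𝓝 l₀, ∀ z : ℂ, z ^ (k + 1) + ∑ j : Fin k, y j l * z ^ (j : ℕ) = 0 → ‖z‖ < η := by
  have hc : ContinuousAt (fun l => ∑ j : Fin k, ‖y j l‖ * (η⁻¹) ^ (k + 1 - (j : ℕ))) l₀ :=
    tendsto_finsetSum _ fun j _ => (hy j).norm.mul continuousAt_const
  have h0 : ∑ j : Fin k, ‖y j l₀‖ * (η⁻¹) ^ (k + 1 - (j : ℕ)) < 1 := by simp [hy0]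
  filter_upwards [hc.eventually_lt_const h0] with l hl z hz
  by_contra! hzη
  have hz0 : 0 < ‖z‖ := hη.trans_le hzη
  have h1 : ‖z‖ ^ (k + 1) ≤ ∑ j : Fin k, ‖y j l‖ * ‖z‖ ^ (j : ℕ) := by
    rw [← norm_pow, eq_neg_of_add_eq_zero_left hz, norm_neg]
    refine (norm_sum_le _ _).trans (le_of_eq ?_)
    simp
  have h2 : ∑ j : Fin k, ‖y j l‖ * ‖z‖ ^ (j : ℕ) ≤
      ‖z‖ ^ (k + 1) * ∑ j : Fin k, ‖y j l‖ * (η⁻¹) ^ (k + 1 - (j : ℕ)) := by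
    rw [Finset.mul_sum]
    refine Finset.sum_le_sum fun j _ => ?_
    have hj : ‖z‖ ^ (k + 1) = ‖z‖ ^ (j : ℕ) * ‖z‖ ^ (k + 1 - (j : ℕ)) := by
      rw [← pow_add, Nat.add_sub_cancel' (by omega)]
    have h3 : 1 ≤ ‖z‖ ^ (k + 1 - (j : ℕ)) * (η⁻¹) ^ (k + 1 - (j : ℕ)) := by
      rw [← mul_pow]
      refine one_le_pow₀ ?_
      rwa [← div_eq_mul_inv, one_le_div hη]
    rw [hj]
    calc ‖y j l‖ * ‖z‖ ^ (j : ℕ) = ‖y j l‖ * ‖z‖ ^ (j : ℕ) * 1 := (mul_one _).symm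
      _ ≤ ‖y j l‖ * ‖z‖ ^ (j : ℕ) * (‖z‖ ^ (k + 1 - (j : ℕ)) * (η⁻¹) ^ (k + 1 - (j : ℕ))) := by
          gcongr
      _ = _ := by ring
  have h3 : 0 < ‖z‖ ^ (k + 1) := by positivity
  nlinarith

/-- Pulling back a simple part: if `φ` is regular at `a`, then `φ' / (φ - b)` has residue `1` at `a`
if `φ a = b`, and `0` otherwise. -/
lemma hasResidue_logDeriv {φ : ℂ → ℂ} {a : ℂ} (hφ : AnalyticAt ℂ φ a) (hφ' : deriv φ a ≠ 0)
    (b c : ℂ) : HasResidue (fun x => c * (φ x - b)⁻¹ * deriv φ x) a (if b = φ a then c else 0) := by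
  split_ifs with h
  · subst h
    have hd : AnalyticAt ℂ (dslope φ a) a := by
      obtain ⟨p, hp⟩ := hφ
      exact ⟨_, hp.has_fpower_series_dslope_fslope⟩
    have hd0 : dslope φ a a ≠ 0 := by rwa [dslope_same]
    have h1 : AnalyticAt ℂ (fun x => c * (dslope φ a x)⁻¹ * deriv φ x) a :=
      (analyticAt_const.mul (hd.inv hd0)).mul hφ.deriv
    have h2 := hasResidue_inv_mul h1
    rw [dslope_same, mul_assoc, inv_mul_cancel₀ hφ', mul_one] at h2
    refine h2.congr ?_
    filter_upwards [self_mem_nhdsWithin] with x hx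
    have e : φ x - φ a = (x - a) * dslope φ a x := by
      have := sub_smul_dslope φ a x
      simpa using this.symm
    rw [e, mul_inv]
    ring
  · refine hasResidue_of_analyticAt ?_
    exact (analyticAt_const.mul ((hφ.sub analyticAt_const).inv
      (sub_ne_zero.2 (Ne.symm h)))).mul hφ.deriv

/-- The residue of a pulled back form `φ' R(φ)` at a regular point of `φ`. -/
lemma hasResidue_comp {T : Finset ℂ} {c : ℂ → ℂ} {R G φ : ℂ → ℂ} {a : ℂ} (hφ : AnalyticAt ℂ φ a)
    (hφ' : deriv φ a ≠ 0) (haT : φ a ∈ T) (hG : ∀ z ∉ T, AnalyticAt ℂ G z)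
    (hR : ∀ z ∉ T, R z = ∑ b ∈ T, c b * (z - b)⁻¹ + deriv G z)
    (hT : ∀ᶠ x in 𝓝[≠] a, φ x ∉ T) :
    HasResidue (fun x => R (φ x) * deriv φ x) a (c (φ a)) := by
  have hφev : ∀ᶠ x in 𝓝[≠] a, AnalyticAt ℂ φ x := nhdsWithin_le_nhds hφ.eventually_analyticAt
  have h1 := HasResidue.sum T fun b (_ : b ∈ T) => hasResidue_logDeriv hφ hφ' b (c b)
  have h2 : HasResidue (deriv fun x => G (φ x)) a 0 := hasResidue_deriv (by
    filter_upwards [hφev, hT] with x hx1 hx2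
    exact AnalyticAt.comp (g := G) (hG _ hx2) hx1)
  have h3 := h1.add h2
  rw [add_zero, Finset.sum_ite_eq' T (φ a) c, if_pos haT] at h3
  refine h3.congr ?_
  filter_upwards [hφev, hT] with x hx1 hx2
  have e : deriv (fun x => G (φ x)) x = deriv G (φ x) * deriv φ x :=
    (HasDerivAt.comp x (hG _ hx2).differentiableAt.hasDerivAt
      hx1.differentiableAt.hasDerivAt).deriv
  rw [e, hR _ hx2, add_mul, Finset.sum_mul]

lemma mem_ball_prod {Λ : Type*} [NormedAddCommGroup Λ] {x : ℂ} {l : Λ} {ε : ℝ} (hx : ‖x‖ < ε)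
    (hl : ‖l‖ < ε) : (x, l) ∈ Metric.ball (0 : ℂ × Λ) ε := by
  simpa [Prod.norm_def] using ⟨hx, hl⟩

lemma analyticAt_slice {Λ : Type*} [NormedAddCommGroup Λ] [NormedSpace ℂ Λ] {φ : ℂ × Λ → ℂ}
    {x : ℂ} {l : Λ} (h : AnalyticAt ℂ φ (x, l)) : AnalyticAt ℂ (fun z => φ (z, l)) x :=
  AnalyticAt.comp (g := φ) (f := fun z : ℂ => (z, l)) h (analyticAt_id.prod analyticAt_const)

/-- The coefficient `μ` of a normal form is the sum of the residues of any conjugate family. -/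
lemma IsConjugacy.isResidueSum {m k : ℕ} (hk : 1 ≤ k) {f φ : ℂ × (Fin m → ℂ) → ℂ}
    {y : Fin k → (Fin m → ℂ) → ℂ} {μ : (Fin m → ℂ) → ℂ} (hc : IsNormalCoeffs y μ)
    (hφ : IsConjugacy f (normalForm y μ) φ) : IsResidueSum f μ := by
  obtain ⟨ψ, hψ, hψ0, hiff, hinv⟩ :=
    exists_local_inverse hφ.analytic hφ.map_zero hφ.pderiv_ne_zero
  have hleft : ∀ᶠ p in 𝓝 (0 : ℂ × (Fin m → ℂ)), ψ (φ p, p.2) = p.1 := by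
    have ht : Tendsto (fun p : ℂ × (Fin m → ℂ) => ((φ p, p.2), p.1)) (𝓝 0) (𝓝 0) :=
      (tendsto_pair hφ.analytic hφ.map_zero).prodMk_nhds (continuous_fst.tendsto _)
    filter_upwards [ht.eventually hiff] with p hp
    exact (hp.1 rfl).symm
  have hne : ∀ᶠ p in 𝓝 (0 : ℂ × (Fin m → ℂ)), 1 + μ p.2 * φ p ^ k ≠ 0 := by
    have h1 : ContinuousAt (fun p : ℂ × (Fin m → ℂ) => μ p.2) 0 :=
      ContinuousAt.comp (g := μ) hc.2.continuousAt continuous_snd.continuousAt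
    refine (continuousAt_const.add (h1.mul (hφ.analytic.continuousAt.pow k))).eventually_ne ?_
    simp [hφ.map_zero, show k ≠ 0 by omega]
  obtain ⟨ε, hε, hball⟩ := Metric.eventually_nhds_iff_ball.1
    (hφ.analytic.eventually_analyticAt.and
      (((analyticAt_pderiv hφ.analytic).continuousAt.eventually_ne hφ.pderiv_ne_zero).and
        (hφ.eventually.and (hne.and hleft))))
  filter_upwards [Ioo_mem_nhdsGT hε] with r hr
  have hψr : ∀ᶠ p in 𝓝 (0 : ℂ × (Fin m → ℂ)), ‖ψ p‖ < r ∧ φ (ψ p, p.2) = p.1 :=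
    ((hψ.continuousAt.norm).eventually_lt_const (by simpa [hψ0] using hr.1)).and hinv
  obtain ⟨η, hη, hηball⟩ := Metric.eventually_nhds_iff_ball.1 hψr
  filter_upwards [Metric.ball_mem_nhds _ (lt_min hε hη),
    eventually_roots_small (fun j => (hc.1 j).1.continuousAt) (fun j => (hc.1 j).2) hη]
    with l hl hroots
  rw [mem_ball_zero_iff, lt_min_iff] at hl
  obtain ⟨s, hscard, hs⟩ := exists_rootProd fun j => y j l
  obtain ⟨T, hT⟩ : ∃ T : Finset ℂ, T = s.toFinset := ⟨_, rfl⟩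
  have hTs {b : ℂ} : b ∈ T ↔ b ∈ s := by rw [hT, Multiset.mem_toFinset]
  -- Partial fractions of `(1 + μ z ^ k) / P(z)`, with `P` the numerator of the normal form.
  obtain ⟨c, G, hG, hR, hsum⟩ := ((hasSimpleParts_pow_div_rootProd T 0 k s hscard (by omega)
      fun b hb => hTs.2 hb).add
    ((hasSimpleParts_pow_div_rootProd T k k s hscard le_rfl fun b hb => hTs.2 hb).const_mul (μ l)))
  rw [if_neg (by omega), if_pos rfl, zero_add, mul_one] at hsum
  have hTsmall {b : ℂ} (hb : b ∈ T) : ‖ψ (b, l)‖ < r ∧ φ (ψ (b, l), l) = b := by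
    refine hηball (b, l) (mem_ball_prod (hroots b ?_) hl.2)
    rw [hs, rootProd_eq_zero]
    exact hTs.1 hb
  have hmem {x : ℂ} (hx : ‖x‖ < r) := hball (x, l) (mem_ball_prod (hx.trans hr.2) hl.1)
  have hN (z : ℂ) : normalForm y μ (z, l) = rootProd s z / (1 + μ l * z ^ k) := by
    rw [← hs]
    rfl
  have hzero {x : ℂ} (hx : ‖x‖ < r) : f (x, l) = 0 ↔ φ (x, l) ∈ T := by
    obtain ⟨-, h2, h3, h4, -⟩ := hmem hx
    rw [hTs, ← rootProd_eq_zero]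
    simp only [hN] at h3
    constructor
    · intro h
      rw [h, mul_zero, div_eq_zero_iff] at h3
      exact h3.resolve_right h4
    · intro h
      rw [h, zero_div] at h3
      exact (mul_eq_zero.1 h3.symm).resolve_left h2
  -- The polar locus is the preimage by `φ` of the set of roots of `P`.
  have hlocus : polarLocus f r l = ((T.image fun b => ψ (b, l) : Finset ℂ) : Set ℂ) := by
    ext x
    simp only [polarLocus, Set.mem_ofPred_eq, Finset.coe_image, Set.mem_image, Finset.mem_coe]
    constructor
    · rintro ⟨hx, hfx⟩
      exact ⟨φ (x, l), (hzero hx).1 hfx, (hmem hx).2.2.2.2⟩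
    · rintro ⟨b, hb, rfl⟩
      obtain ⟨h1, h2⟩ := hTsmall hb
      refine ⟨h1, (hzero h1).2 ?_⟩
      rwa [h2]
  have hinj : Set.InjOn (fun b => ψ (b, l)) T := by
    intro b hb b' hb' h
    rw [← (hTsmall hb).2, ← (hTsmall hb').2]
    simp only at h
    rw [h]
  have hfin : (polarLocus f r l).Finite := by
    rw [hlocus]
    exact Finset.finite_toSet _
  refine ⟨hfin, ?_⟩
  have hres {b : ℂ} (hb : b ∈ T) : residue (fun x => (f (x, l))⁻¹) (ψ (b, l)) = c b := by
    obtain ⟨h1, h2⟩ := hTsmall hb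
    obtain ⟨ha1, ha2, -⟩ := hmem h1
    have hnhds : ∀ᶠ x in 𝓝 (ψ (b, l)), ‖x‖ < r :=
      (continuous_norm.tendsto _).eventually_lt_const h1
    have hoff : ∀ᶠ x in 𝓝[≠] (ψ (b, l)), x ∉ polarLocus f r l := by
      have h : ∀ᶠ x in 𝓝 (ψ (b, l)), x ∉ polarLocus f r l \ {ψ (b, l)} :=
        (hfin.sdiff).isClosed.isOpen_compl.mem_nhds (by simp)
      filter_upwards [nhdsWithin_le_nhds h, self_mem_nhdsWithin] with x hx1 hx2 hx3
      exact hx1 ⟨hx3, hx2⟩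
    have hTx : ∀ᶠ x in 𝓝[≠] (ψ (b, l)), φ (x, l) ∉ T := by
      filter_upwards [nhdsWithin_le_nhds hnhds, hoff] with x hx1 hx2 hx3
      exact hx2 ⟨hx1, (hzero hx1).2 hx3⟩
    have key := hasResidue_comp (φ := fun x => φ (x, l)) (analyticAt_slice ha1) ha2
      (by simpa only [h2] using hb) hG hR hTx
    simp only [h2] at key
    refine (key.congr ?_).residue_eq
    filter_upwards [nhdsWithin_le_nhds hnhds, hTx] with x hx1 hx2
    obtain ⟨-, hx3, hx4, hx5, -⟩ := hmem hx1
    have hprod : rootProd s (φ (x, l)) ≠ 0 := fun h => hx2 (hTs.2 (rootProd_eq_zero.1 h))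
    simp only [hN] at hx4 hx5
    have hf : f (x, l) = (pderiv φ (x, l))⁻¹ *
        (rootProd s (φ (x, l)) / (1 + μ l * φ (x, l) ^ k)) := by
      rw [hx4, inv_mul_cancel_left₀ hx3]
    change _ * pderiv φ (x, l) = _
    rw [hf, mul_inv, inv_inv, inv_div, pow_zero]
    field_simp
  rw [hlocus, finsum_mem_coe_finset, Finset.sum_image hinj, ← hsum]
  exact Finset.sum_congr rfl fun b hb => (hres hb).symm

section AbsSeriesFlow

open AbsSeries

/-! ### The flow of the normal form -/

/-- The integral curve that starts at `q.1`, as a series in half the time, for a given velocity. -/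
def curve {Λ : Type*} (v : ℂ × (ℂ × Λ) → AbsSeries) (q : ℂ × (ℂ × Λ)) : AbsSeries :=
  algebraMap ℂ AbsSeries q.1 + integral (v q)

lemma analyticAt_curve {Λ : Type*} [NormedAddCommGroup Λ] [NormedSpace ℂ Λ]
    {v : ℂ × (ℂ × Λ) → AbsSeries} {q : ℂ × (ℂ × Λ)} (hv : AnalyticAt ℂ v q) :
    AnalyticAt ℂ (curve v) q :=
  (((algebraMapCLM ℂ AbsSeries).analyticAt _).comp analyticAt_fst).add
    ((integral.analyticAt _).comp hv)

/-- The differential equation of the flow of the normal form, as an equation for the velocity `v`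
in the algebra of series: its linearisation at `v = 0` is the identity when `1 ≤ k`. -/
lemma exists_flow_velocity {m k : ℕ} (hk : 1 ≤ k) {y : Fin k → (Fin m → ℂ) → ℂ}
    {μ : (Fin m → ℂ) → ℂ} (hc : IsNormalCoeffs y μ) (t₀ : ℂ) :
    ∃ v : ℂ × (ℂ × (Fin m → ℂ)) → AbsSeries, AnalyticAt ℂ v (0, (t₀, 0)) ∧ v (0, (t₀, 0)) = 0 ∧
      ∀ᶠ q in 𝓝 ((0, (t₀, 0)) : ℂ × (ℂ × (Fin m → ℂ))),
        v q * (1 + μ q.2.2 • curve v q ^ k) =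
          (2 * q.2.1) • (curve v q ^ (k + 1) + ∑ j : Fin k, y j q.2.2 • curve v q ^ (j : ℕ)) := by
  let c (Q : (ℂ × (ℂ × (Fin m → ℂ))) × AbsSeries) : AbsSeries :=
    algebraMap ℂ AbsSeries Q.1.1 + integral Q.2
  let F (Q : (ℂ × (ℂ × (Fin m → ℂ))) × AbsSeries) : AbsSeries :=
    Q.2 * (1 + μ Q.1.2.2 • c Q ^ k) -
      (2 * Q.1.2.1) • (c Q ^ (k + 1) + ∑ j : Fin k, y j Q.1.2.2 • c Q ^ (j : ℕ))
  have hl : AnalyticAt ℂ (fun Q : (ℂ × (ℂ × (Fin m → ℂ))) × AbsSeries => Q.1.2.2)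
      ((0, (t₀, 0)), 0) := (analyticAt_snd.comp (analyticAt_snd.comp analyticAt_fst))
  have ht : AnalyticAt ℂ (fun Q : (ℂ × (ℂ × (Fin m → ℂ))) × AbsSeries => 2 * Q.1.2.1)
      ((0, (t₀, 0)), 0) :=
    analyticAt_const.fun_mul (analyticAt_fst.comp (analyticAt_snd.comp analyticAt_fst))
  have hcA : AnalyticAt ℂ c ((0, (t₀, 0)), 0) :=
    (((algebraMapCLM ℂ AbsSeries).analyticAt _).comp (analyticAt_fst.comp analyticAt_fst)).add
      ((integral.analyticAt _).comp analyticAt_snd)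
  have hy (j : Fin k) : AnalyticAt ℂ (fun Q : (ℂ × (ℂ × (Fin m → ℂ))) × AbsSeries => y j Q.1.2.2)
      ((0, (t₀, 0)), 0) :=
    AnalyticAt.comp (g := y j) (f := fun Q : (ℂ × (ℂ × (Fin m → ℂ))) × AbsSeries => Q.1.2.2)
      (hc.1 j).1 hl
  have hμ : AnalyticAt ℂ (fun Q : (ℂ × (ℂ × (Fin m → ℂ))) × AbsSeries => μ Q.1.2.2)
      ((0, (t₀, 0)), 0) :=
    AnalyticAt.comp (g := μ) (f := fun Q : (ℂ × (ℂ × (Fin m → ℂ))) × AbsSeries => Q.1.2.2) hc.2 hl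
  have hF : AnalyticAt ℂ F ((0, (t₀, 0)), 0) :=
    (analyticAt_snd.fun_mul (analyticAt_const.fun_add (hμ.fun_smul (hcA.fun_pow k)))).fun_sub
      (ht.fun_smul ((hcA.fun_pow (k + 1)).fun_add
        (Finset.analyticAt_fun_sum _ fun j _ => (hy j).fun_smul (hcA.fun_pow j))))
  have hk0 : k ≠ 0 := by omega
  have h0 : F ((0, (t₀, 0)), 0) = 0 := by
    simp [F, c, (hc.1 _).2]
  have hD (h : AbsSeries) : HasDerivAt (fun s : ℂ => F ((0, (t₀, 0)), 0 + s • h)) h 0 := by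
    have e (s : ℂ) : F ((0, (t₀, 0)), 0 + s • h) = s • (h * (1 + μ 0 • (s • integral h) ^ k)) -
        (2 * t₀) • (s • integral h) ^ (k + 1) := by
      simp [F, c, (hc.1 _).2]
    simp only [e]
    have h1 : HasDerivAt (fun s : ℂ => s • integral h) (integral h) 0 := by
      simpa using (hasDerivAt_id (0 : ℂ)).smul_const (integral h)
    have h2 := ((hasDerivAt_id (0 : ℂ)).fun_smul
      ((((h1.fun_pow k).const_smul (μ 0)).const_add 1).const_mul h)).fun_sub
      ((h1.fun_pow (k + 1)).const_smul (2 * t₀))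
    refine h2.congr_deriv ?_
    simp [hk0]
  obtain ⟨v, hv, hv0, -, hvF⟩ := exists_analytic_implicit hF h0 hD
  exact ⟨v, hv, hv0, hvF.mono fun q hq => sub_eq_zero.1 hq⟩

lemma ev_curve {Λ : Type*} (v : ℂ × (ℂ × Λ) → AbsSeries) (q : ℂ × (ℂ × Λ)) {z : ℂ}
    (hz : ‖z‖ < 1) : ev z (curve v q) = q.1 + ev z (integral (v q)) := by
  rw [curve, map_add, ev_algebraMap hz]

lemma ev_zero_curve {Λ : Type*} (v : ℂ × (ℂ × Λ) → AbsSeries) (q : ℂ × (ℂ × Λ)) :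
    ev 0 (curve v q) = q.1 := by
  rw [ev_curve v q (by simp), ev_zero_apply, coeff_integral_zero, add_zero]

lemma hasDerivAt_ev_curve {Λ : Type*} (v : ℂ × (ℂ × Λ) → AbsSeries) (q : ℂ × (ℂ × Λ)) {z : ℂ}
    (hz : ‖z‖ < 1) : HasDerivAt (fun z => ev z (curve v q)) (ev z (v q)) z := by
  refine ((hasDerivAt_ev_integral hz (v q)).const_add q.1).congr_of_eventuallyEq ?_
  filter_upwards [Metric.isOpen_ball.mem_nhds (show z ∈ Metric.ball (0 : ℂ) 1 by simpa)] with w hw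
  exact ev_curve v q (by simpa using hw)

lemma norm_half_lt_one {s : ℝ} (hs : s ∈ Set.Icc (0 : ℝ) 1) : ‖(2 : ℂ)⁻¹ * s‖ < 1 := by
  rw [norm_mul, Complex.norm_real, Real.norm_of_nonneg hs.1, norm_inv, Complex.norm_ofNat]
  linarith [hs.2]

lemma hasDerivAt_comp_half {D : ℂ → ℂ} {D' : ℂ} {s : ℝ}
    (h : HasDerivAt D D' ((2 : ℂ)⁻¹ * s)) :
    HasDerivAt (fun s : ℝ => D ((2 : ℂ)⁻¹ * s)) ((2 : ℂ)⁻¹ * D') s := by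
  have h1 : HasDerivAt (fun s : ℝ => (2 : ℂ)⁻¹ * (s : ℂ)) (2 : ℂ)⁻¹ s := by
    simpa using (Complex.ofRealCLM.hasDerivAt (x := s)).const_mul (2 : ℂ)⁻¹
  exact h.scomp s h1

/-- A solution of a homogeneous linear differential equation which vanishes at the origin. -/
lemma eq_zero_of_linear_ode {D a : ℂ → ℂ} {C : ℝ}
    (hD : ∀ z, ‖z‖ < 1 → HasDerivAt D (a z * D z) z) (ha : ∀ z, ‖z‖ < 1 → ‖a z‖ ≤ C)
    (h0 : D 0 = 0) {s : ℝ} (hs : s ∈ Set.Icc (0 : ℝ) 1) : D ((2 : ℂ)⁻¹ * s) = 0 := by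
  have hd (s : ℝ) (hs : s ∈ Set.Icc (0 : ℝ) 1) := hasDerivAt_comp_half (hD _ (norm_half_lt_one hs))
  refine eq_zero_of_abs_deriv_le_mul_abs_self_of_eq_zero_right
    (f := fun s : ℝ => D ((2 : ℂ)⁻¹ * s)) (K := C) (a := 0) (b := 1)
    (fun s hs => (hd s hs).continuousAt.continuousWithinAt)
    (fun s hs => (hd s (Set.Ico_subset_Icc_self hs)).hasDerivWithinAt) (by simpa) ?_ s hs
  intro s hs
  have h1 := ha _ (norm_half_lt_one (Set.Ico_subset_Icc_self hs))
  have h2 : ‖(2 : ℂ)⁻¹‖ ≤ 1 := by norm_num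
  rw [norm_mul, norm_mul]
  calc _ ≤ 1 * (‖a ((2 : ℂ)⁻¹ * s)‖ * ‖D ((2 : ℂ)⁻¹ * s)‖) := by gcongr
    _ ≤ _ := by rw [one_mul]; gcongr

section Flow

variable {Λ : Type*} [NormedAddCommGroup Λ] [NormedSpace ℂ Λ] {f : ℂ × Λ → ℂ} {t₀ : ℂ}
  {v : ℂ × (ℂ × Λ) → AbsSeries}

/-- The series `curve v` are integral curves of the family `f`, run at the speed `2 t`, so that the
flow at the time `t` is reached at `1 / 2`, inside the disc of convergence. -/
def IsFlowVelocity (f : ℂ × Λ → ℂ) (t₀ : ℂ) (v : ℂ × (ℂ × Λ) → AbsSeries) : Prop :=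
  AnalyticAt ℂ v (0, (t₀, 0)) ∧ v (0, (t₀, 0)) = 0 ∧
    ∀ᶠ q in 𝓝 ((0, (t₀, 0)) : ℂ × (ℂ × Λ)), ∀ z : ℂ, ‖z‖ < 1 →
      ev z (v q) = 2 * q.2.1 * f (ev z (curve v q), q.2.2)

/-- The flow map at the complex time `q.2.1`. -/
def flow (v : ℂ × (ℂ × Λ) → AbsSeries) (q : ℂ × (ℂ × Λ)) : ℂ := ev (2 : ℂ)⁻¹ (curve v q)

lemma norm_two_inv_lt_one : ‖(2 : ℂ)⁻¹‖ < 1 := by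
  rw [norm_inv, Complex.norm_ofNat]
  norm_num

lemma IsFlowVelocity.analyticAt_flow (h : IsFlowVelocity f t₀ v) :
    AnalyticAt ℂ (flow v) (0, (t₀, 0)) :=
  ((ev (2 : ℂ)⁻¹).analyticAt _).comp (analyticAt_curve h.1)

lemma IsFlowVelocity.tendsto_curve (h : IsFlowVelocity f t₀ v) :
    Tendsto (curve v) (𝓝 (0, (t₀, 0))) (𝓝 0) := by
  have h1 := (analyticAt_curve h.1).continuousAt.tendsto
  simpa [curve, h.2.1] using h1

/-- The points of the integral curve stay close to the origin. -/
lemma IsFlowVelocity.eventually_curve (h : IsFlowVelocity f t₀ v) {P : ℂ × Λ → Prop}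
    (hP : ∀ᶠ p in 𝓝 0, P p) :
    ∀ᶠ q in 𝓝 ((0, (t₀, 0)) : ℂ × (ℂ × Λ)), ∀ z : ℂ, ‖z‖ < 1 → P (ev z (curve v q), q.2.2) := by
  obtain ⟨ε, hε, hball⟩ := Metric.eventually_nhds_iff_ball.1 hP
  have hl : Tendsto (fun q : ℂ × (ℂ × Λ) => q.2.2) (𝓝 (0, (t₀, 0))) (𝓝 0) :=
    Continuous.tendsto' (by fun_prop) _ _ rfl
  filter_upwards [h.tendsto_curve.eventually (Metric.ball_mem_nhds 0 hε),
    hl.eventually (Metric.ball_mem_nhds 0 hε)] with q h1 h2 z hz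
  rw [dist_zero_right] at h1 h2
  refine hball _ ?_
  rw [mem_ball_zero_iff, Prod.norm_def, max_lt_iff]
  exact ⟨(norm_ev_le hz _).trans_lt h1, h2⟩

lemma IsFlowVelocity.exists_integralCurve (h : IsFlowVelocity f t₀ v) {V : Set ℂ} (hV : V ∈ 𝓝 0) :
    ∀ᶠ q in 𝓝 ((0, (t₀, 0)) : ℂ × (ℂ × Λ)), ∃ γ : ℝ → ℂ, γ 0 = q.1 ∧ γ 1 = flow v q ∧
      ∀ s ∈ Set.Icc (0 : ℝ) 1, γ s ∈ V ∧
        HasDerivWithinAt γ (q.2.1 * f (γ s, q.2.2)) (Set.Icc (0 : ℝ) 1) s := by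
  have hV' : ∀ᶠ p : ℂ × Λ in 𝓝 0, p.1 ∈ V :=
    (Continuous.tendsto' continuous_fst (0 : ℂ × Λ) 0 rfl).eventually hV
  filter_upwards [h.2.2, h.eventually_curve hV'] with q hq hqV
  refine ⟨fun s => ev ((2 : ℂ)⁻¹ * s) (curve v q), ?_, ?_, fun s hs =>
    ⟨hqV _ (norm_half_lt_one hs), ?_⟩⟩
  · simp [ev_zero_curve]
  · simp [flow]
  · have h1 := hasDerivAt_comp_half (hasDerivAt_ev_curve v q (norm_half_lt_one hs))
    rw [hq _ (norm_half_lt_one hs)] at h1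
    refine (h1.congr_deriv ?_).hasDerivWithinAt
    ring

/-- The flow of a family preserves the family: the difference of the two sides satisfies the
linearised equation along the integral curve. -/
lemma IsFlowVelocity.flow_conj (h : IsFlowVelocity f t₀ v) (hf : AnalyticAt ℂ f 0) :
    ∀ᶠ q in 𝓝 ((0, (t₀, 0)) : ℂ × (ℂ × Λ)),
      f (flow v q, q.2.2) = pderiv (flow v) q * f (q.1, q.2.2) := by
  have hb : ∀ᶠ p in 𝓝 0, ‖pderiv f p‖ < ‖pderiv f 0‖ + 1 :=
    (analyticAt_pderiv hf).continuousAt.norm.eventually_lt_const (lt_add_one _)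
  filter_upwards [h.1.eventually_analyticAt, h.2.2.eventually_nhds,
    h.eventually_curve (hf.eventually_analyticAt.and hb)] with q hv hode hfb
  have hode0 := hode.self_of_nhds
  let ι : ℂ → ℂ × (ℂ × Λ) := fun x => (x, q.2)
  have hι : AnalyticAt ℂ ι q.1 := analyticAt_id.prod analyticAt_const
  have hvx : DifferentiableAt ℂ (fun x => v (x, q.2)) q.1 :=
    (AnalyticAt.comp (g := v) (f := ι) hv hι).differentiableAt
  set vx := deriv (fun x => v (x, q.2)) q.1 with hvx_def
  set cx : AbsSeries := 1 + integral vx with hcx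
  have hc : HasDerivAt (fun x => curve v (x, q.2)) cx q.1 := by
    have h1 : HasDerivAt (fun x : ℂ => algebraMap ℂ AbsSeries x) 1 q.1 := by
      simp only [Algebra.algebraMap_eq_smul_one]
      simpa using (hasDerivAt_id q.1).smul_const (1 : AbsSeries)
    exact h1.add ((integral.hasFDerivAt).comp_hasDerivAt q.1 hvx.hasDerivAt)
  have hcz (z : ℂ) : HasDerivAt (fun x => ev z (curve v (x, q.2))) (ev z cx) q.1 :=
    ((ev z).hasFDerivAt).comp_hasDerivAt q.1 hc
  have hvz (z : ℂ) : HasDerivAt (fun x => ev z (v (x, q.2))) (ev z vx) q.1 :=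
    ((ev z).hasFDerivAt).comp_hasDerivAt q.1 hvx.hasDerivAt
  have key (z : ℂ) (hz : ‖z‖ < 1) :
      ev z vx = 2 * q.2.1 * (pderiv f (ev z (curve v q), q.2.2) * ev z cx) := by
    refine (hvz z).unique ?_
    have h1 := ((hasDerivAt_pderiv (hfb z hz).1).comp q.1 (hcz z)).const_mul (2 * q.2.1)
    refine h1.congr_of_eventuallyEq ?_
    filter_upwards [(hι.continuousAt.tendsto).eventually hode] with x hx
    exact hx z hz
  -- With `γ` the integral curve, `D = f(γ) - γₓ f(x)` satisfies `D' = 2 t f'(γ) D`.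
  let D : ℂ → ℂ := fun z => f (ev z (curve v q), q.2.2) - ev z cx * f (q.1, q.2.2)
  have hD (z : ℂ) (hz : ‖z‖ < 1) :
      HasDerivAt D ((2 * q.2.1 * pderiv f (ev z (curve v q), q.2.2)) * D z) z := by
    have h1 := (hasDerivAt_pderiv (hfb z hz).1).comp z (hasDerivAt_ev_curve v q hz)
    have h2 : HasDerivAt (fun z => ev z cx) (ev z vx) z := by
      refine ((hasDerivAt_ev_integral hz vx).const_add 1).congr_of_eventuallyEq ?_
      filter_upwards [Metric.isOpen_ball.mem_nhds
        (show z ∈ Metric.ball (0 : ℂ) 1 by simpa)] with w hw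
      rw [hcx, map_add, ev_one (by simpa using hw)]
    refine (h1.sub (h2.mul_const (f (q.1, q.2.2)))).congr_deriv ?_
    rw [key z hz, hode0 z hz]
    ring
  have hD0 : D 0 = 0 := by
    simp only [D, ev_zero_curve]
    rw [hcx, map_add, ev_one (by simp), ev_zero_apply, coeff_integral_zero]
    ring
  have h1 := eq_zero_of_linear_ode (C := ‖2 * q.2.1‖ * (‖pderiv f 0‖ + 1)) hD (fun z hz => by
    rw [norm_mul]
    gcongr
    exact (hfb z hz).2.le) hD0 (s := 1) (by simp)
  simp only [ofReal_one, mul_one] at h1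
  have h2 : pderiv (flow v) q = ev (2 : ℂ)⁻¹ cx := (hcz _).deriv
  rw [h2]
  exact sub_eq_zero.1 h1

end Flow

lemma exists_isFlowVelocity {m k : ℕ} (hk : 1 ≤ k) {y : Fin k → (Fin m → ℂ) → ℂ}
    {μ : (Fin m → ℂ) → ℂ} (hc : IsNormalCoeffs y μ) (t₀ : ℂ) :
    ∃ v : ℂ × (ℂ × (Fin m → ℂ)) → AbsSeries, IsFlowVelocity (normalForm y μ) t₀ v ∧
      ∀ᶠ q in 𝓝 ((0, (t₀, 0)) : ℂ × (ℂ × (Fin m → ℂ))),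
        v q * (1 + μ q.2.2 • curve v q ^ k) =
          (2 * q.2.1) • (curve v q ^ (k + 1) + ∑ j : Fin k, y j q.2.2 • curve v q ^ (j : ℕ)) := by
  obtain ⟨v, hv, hv0, hF⟩ := exists_flow_velocity hk hc t₀
  refine ⟨v, ⟨hv, hv0, ?_⟩, hF⟩
  have hl : AnalyticAt ℂ (fun q : ℂ × (ℂ × (Fin m → ℂ)) => q.2.2) (0, (t₀, 0)) :=
    analyticAt_snd.comp analyticAt_snd
  have hμ : AnalyticAt ℂ (fun q : ℂ × (ℂ × (Fin m → ℂ)) => μ q.2.2) (0, (t₀, 0)) :=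
    AnalyticAt.comp (g := μ) (f := fun q : ℂ × (ℂ × (Fin m → ℂ)) => q.2.2) hc.2 hl
  have hsmall := (hμ.fun_smul ((analyticAt_curve hv).fun_pow k)).continuousAt.norm
  have hsmall0 : ‖μ ((0, (t₀, 0)) : ℂ × (ℂ × (Fin m → ℂ))).2.2 • curve v (0, (t₀, 0)) ^ k‖ < 1 := by
    have : k ≠ 0 := by omega
    simp [curve, hv0, this]
  filter_upwards [hF, hsmall.eventually_lt_const hsmall0] with q hq hs z hz
  have h1 : 1 + μ q.2.2 * ev z (curve v q) ^ k ≠ 0 := by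
    intro h0
    have h2 := (norm_ev_le hz _).trans_lt hs
    rw [map_smul, ev_pow hz, smul_eq_mul, eq_neg_of_add_eq_zero_right h0] at h2
    simp at h2
  have h3 := congrArg (ev z) hq
  simp only [ev_mul hz, map_add, map_smul, ev_one hz, ev_pow hz, map_sum, smul_eq_mul] at h3
  rw [normalForm, eq_comm, mul_div_assoc', div_eq_iff h1, h3]

/-! ### Expansion of the flow at the singular parameter value -/

/-- The velocity of the stationary curve is zero. -/
lemma eventually_velocity_eq_zero {k : ℕ} (hk : 1 ≤ k) {Λ : Type*} [NormedAddCommGroup Λ]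
    [NormedSpace ℂ Λ] {v : ℂ × (ℂ × Λ) → AbsSeries} {t₀ μ : ℂ}
    (hv : AnalyticAt ℂ v (0, (t₀, 0))) (hv0 : v (0, (t₀, 0)) = 0)
    (hF : ∀ᶠ q in 𝓝 ((0, (t₀, 0)) : ℂ × (ℂ × Λ)), q.2.2 = 0 →
      v q * (1 + μ • curve v q ^ k) = (2 * q.2.1) • curve v q ^ (k + 1)) :
    ∀ᶠ q in 𝓝 ((0, (t₀, 0)) : ℂ × (ℂ × Λ)), q.1 = 0 → q.2.2 = 0 → v q = 0 := by
  have hk0 : k ≠ 0 := by omega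
  have hc := (analyticAt_curve hv).continuousAt
  have ht : ContinuousAt (fun q : ℂ × (ℂ × Λ) => q.2.1) (0, (t₀, 0)) := by fun_prop
  have hs : ContinuousAt (fun q : ℂ × (ℂ × Λ) =>
      ‖curve v q ^ k‖ * (‖2 * q.2.1‖ * ‖integral‖ + ‖μ‖)) (0, (t₀, 0)) := by fun_prop
  have hs0 : ‖curve v (0, (t₀, 0)) ^ k‖ * (‖2 * t₀‖ * ‖integral‖ + ‖μ‖) < 1 := by
    simp [curve, hv0, hk0]
  filter_upwards [hF, hs.eventually_lt_const hs0] with q hq hlt h1 h2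
  -- The right-hand side is a contraction in `v q`.
  have e : v q = curve v q ^ k * ((2 * q.2.1) • integral (v q) - μ • v q) := by
    have e1 : integral (v q) = curve v q := by simp [curve, h1]
    have e2 := hq h2
    rw [e1]
    simp only [Algebra.smul_def] at e2 ⊢
    linear_combination e2
  by_contra hne
  have hpos : 0 < ‖v q‖ := norm_pos_iff.2 hne
  have : ‖v q‖ ≤ ‖curve v q ^ k‖ * (‖2 * q.2.1‖ * ‖integral‖ + ‖μ‖) * ‖v q‖ := by
    calc ‖v q‖ = ‖curve v q ^ k * ((2 * q.2.1) • integral (v q) - μ • v q)‖ := by rw [← e]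
      _ ≤ ‖curve v q ^ k‖ * (‖2 * q.2.1‖ * (‖integral‖ * ‖v q‖) + ‖μ‖ * ‖v q‖) := by
        refine (norm_mul_le _ _).trans ?_
        gcongr
        refine (norm_sub_le _ _).trans ?_
        rw [norm_smul, norm_smul]
        gcongr
        exact integral.le_opNorm _
      _ = _ := by ring
  nlinarith

/-- For the parameter `0`, the flow of the normal form is tangent to the identity to order `k`, and
the time is read off from the coefficient of `x ^ (k + 1)`. -/
lemma flow_expansion {m k : ℕ} (hk : 1 ≤ k) {y : Fin k → (Fin m → ℂ) → ℂ}
    {μ : (Fin m → ℂ) → ℂ} (hc : IsNormalCoeffs y μ) {t₀ : ℂ}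
    {v : ℂ × (ℂ × (Fin m → ℂ)) → AbsSeries} (hv : AnalyticAt ℂ v (0, (t₀, 0)))
    (hv0 : v (0, (t₀, 0)) = 0)
    (hF : ∀ᶠ q in 𝓝 ((0, (t₀, 0)) : ℂ × (ℂ × (Fin m → ℂ))),
        v q * (1 + μ q.2.2 • curve v q ^ k) =
          (2 * q.2.1) • (curve v q ^ (k + 1) + ∑ j : Fin k, y j q.2.2 • curve v q ^ (j : ℕ))) :
    ∀ᶠ t in 𝓝 t₀, ∃ K : ℂ → ℂ, AnalyticAt ℂ K 0 ∧ K 0 = t ∧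
      ∀ᶠ x in 𝓝 0, flow v (x, (t, 0)) = x + x ^ (k + 1) * K x := by
  have hF' : ∀ᶠ q in 𝓝 ((0, (t₀, 0)) : ℂ × (ℂ × (Fin m → ℂ))), q.2.2 = 0 →
      v q * (1 + μ 0 • curve v q ^ k) = (2 * q.2.1) • curve v q ^ (k + 1) := by
    filter_upwards [hF] with q hq h0
    simpa [h0, (hc.1 _).2] using hq
  have hι : Tendsto (fun t : ℂ => ((0, (t, 0)) : ℂ × (ℂ × (Fin m → ℂ)))) (𝓝 t₀)
      (𝓝 (0, (t₀, 0))) := Continuous.tendsto' (by fun_prop) _ _ rfl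
  filter_upwards [hι.eventually hv.eventually_analyticAt, hι.eventually hF'.eventually_nhds,
    hι.eventually (eventually_velocity_eq_zero hk hv hv0 hF')] with t ht hFt hvt
  let w : ℂ → AbsSeries := fun x => v (x, (t, 0))
  have hw : AnalyticAt ℂ w 0 :=
    AnalyticAt.comp (g := v) (f := fun x : ℂ => ((x, (t, 0)) : ℂ × (ℂ × (Fin m → ℂ)))) ht
      (analyticAt_id.prod analyticAt_const)
  have hw0 : w 0 = 0 := hvt rfl rfl
  let w₁ := dslope w 0
  have hw₁ : AnalyticAt ℂ w₁ 0 := by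
    obtain ⟨p, hp⟩ := hw
    exact ⟨_, hp.has_fpower_series_dslope_fslope⟩
  have hww (x : ℂ) : w x = x • w₁ x := by
    have := sub_smul_dslope w 0 x
    rw [hw0, sub_zero, sub_zero] at this
    exact this.symm
  let γ₁ : ℂ → AbsSeries := fun x => 1 + integral (w₁ x)
  have hγ₁ : AnalyticAt ℂ γ₁ 0 := analyticAt_const.fun_add ((integral.analyticAt _).comp hw₁)
  have hcurve (x : ℂ) : curve v (x, (t, 0)) = x • γ₁ x := by
    change algebraMap ℂ AbsSeries x + integral (w x) = _
    rw [hww, map_smul, Algebra.algebraMap_eq_smul_one, smul_add]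
  let κ : ℂ → AbsSeries := fun x => γ₁ x ^ k * ((2 * t) • γ₁ x - μ 0 • w₁ x)
  have hκ : AnalyticAt ℂ κ 0 := (hγ₁.fun_pow k).fun_mul
    ((analyticAt_const.fun_smul hγ₁).fun_sub (analyticAt_const.fun_smul hw₁))
  have hpunct : ∀ᶠ x in 𝓝[≠] (0 : ℂ), w₁ x = x ^ k • κ x := by
    have hx : Tendsto (fun x : ℂ => ((x, (t, 0)) : ℂ × (ℂ × (Fin m → ℂ)))) (𝓝 0)
      (𝓝 (0, (t, 0))) := Continuous.tendsto' (by fun_prop) _ _ rfl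
    filter_upwards [nhdsWithin_le_nhds (hx.eventually hFt), self_mem_nhdsWithin]
      with x h1 (hx0 : x ≠ 0)
    have h2 := h1 rfl
    rw [hcurve, show v (x, (t, 0)) = x • w₁ x from hww x] at h2
    refine smul_right_injective AbsSeries hx0 ?_
    simp only [κ, Algebra.smul_def, map_mul, map_pow, mul_pow] at h2 ⊢
    linear_combination h2
  have hall : ∀ᶠ x in 𝓝 (0 : ℂ), w₁ x = x ^ k • κ x :=
    (hw₁.frequently_eq_iff_eventually_eq ((analyticAt_id.pow k).smul hκ)).1 hpunct.frequently
  have hw₁0 : w₁ 0 = 0 := by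
    rw [hall.self_of_nhds, zero_pow (by omega), zero_smul]
  refine ⟨fun x => ev (2 : ℂ)⁻¹ (integral (κ x)),
    ((ev (2 : ℂ)⁻¹).analyticAt _).comp ((integral.analyticAt _).comp hκ), ?_, ?_⟩
  · have h1 : integral 1 = X := by
      have := coord_base 0
      simpa [Unknown.coord, Unknown.base] using this
    have h2 : κ 0 = (2 * t) • 1 := by simp [κ, γ₁, hw₁0]
    change ev (2 : ℂ)⁻¹ (integral (κ 0)) = t
    rw [h2, map_smul, map_smul, h1, ev_X norm_two_inv_lt_one, smul_eq_mul]
    ring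
  · filter_upwards [hall] with x hx
    change ev (2 : ℂ)⁻¹ (algebraMap ℂ AbsSeries x + integral (w x)) = _
    rw [hww, hx, smul_smul, ← pow_succ', map_smul, map_add, ev_algebraMap norm_two_inv_lt_one,
      map_smul, smul_eq_mul]

/-! ### Coefficients of germs -/

/-- The coefficients of two dilations of the same germ. -/
lemma scale_coeff {g : ℂ → ℂ} {ρ σ : ℂ} {a b : AbsSeries}
    (ha : ∀ᶠ x in 𝓝 0, ev x a = g (ρ * x)) (hb : ∀ᶠ x in 𝓝 0, ev x b = g (σ * x)) (n : ℕ) :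
    σ ^ n * coeff n a = ρ ^ n * coeff n b := by
  have hs0 : 0 < 1 + ‖ρ‖ + ‖σ‖ := by positivity
  set s : ℂ := ((1 + ‖ρ‖ + ‖σ‖ : ℝ) : ℂ)⁻¹ with hs
  have hsn : ‖s‖ = (1 + ‖ρ‖ + ‖σ‖)⁻¹ := by
    rw [hs, norm_inv, Complex.norm_real, Real.norm_of_nonneg hs0.le]
  have hs' : s ≠ 0 := by
    rw [← norm_pos_iff, hsn]
    positivity
  have hσ : ‖s * σ‖ ≤ 1 := by
    rw [norm_mul, hsn, inv_mul_le_iff₀ hs0]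
    linarith [norm_nonneg ρ]
  have hρ : ‖s * ρ‖ ≤ 1 := by
    rw [norm_mul, hsn, inv_mul_le_iff₀ hs0]
    linarith [norm_nonneg σ]
  have h : dilate _ hσ a = dilate _ hρ b := by
    apply eq_of_eventually_ev_eq
    filter_upwards [eventually_norm_lt_one, (tendsto_const_mul_zero (s * σ)).eventually ha,
      (tendsto_const_mul_zero (s * ρ)).eventually hb] with x hx h1 h2
    rw [ev_dilate hx, ev_dilate hx, h1, h2]
    congr 1
    ring
  have h1 := congrArg (coeff n) h
  rw [coeff_dilate, coeff_dilate, mul_pow, mul_pow, mul_assoc, mul_assoc] at h1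
  exact mul_left_cancel₀ (pow_ne_zero n hs') h1

lemma coeff_of_eventually {k : ℕ} (hk : 1 ≤ k) {h : ℂ → ℂ} (hh : AnalyticAt ℂ h 0) {a : AbsSeries}
    (ha : ∀ᶠ x in 𝓝 0, ev x a = 1 + x ^ k * h x) : coeff k a = h 0 := by
  have hh' : AnalyticAt ℂ (fun p : ℂ × ℂ => h p.1) (0, 0) :=
    AnalyticAt.comp (g := h) (f := fun p : ℂ × ℂ => p.1) hh analyticAt_fst
  obtain ⟨ρ, ⟨g, -, hg⟩, hρ : 0 < ρ⟩ := ((exists_series hh').and self_mem_nhdsWithin).exists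
  have hρ' : (ρ : ℂ) ≠ 0 := by exact_mod_cast hρ.ne'
  have h0 : coeff 0 (g 0) = h 0 := by
    rw [← ev_zero_apply, hg.self_of_nhds 0 (by simp), mul_zero]
  have h1 := scale_coeff (g := fun x => 1 + x ^ k * h x) (ρ := 1) (σ := ρ) (a := a)
    (b := 1 + (ρ : ℂ) ^ k • (X ^ k * g 0)) (by simpa using ha) ?_ k
  · rw [one_pow, one_mul, map_add, map_smul, coeff_X_pow_mul, coeff_one, if_neg (by omega),
      if_pos le_rfl, Nat.sub_self, h0, zero_add, smul_eq_mul] at h1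
    exact mul_left_cancel₀ (pow_ne_zero k hρ') h1
  · filter_upwards [eventually_norm_lt_one] with x hx
    rw [map_add, ev_one hx, map_smul, ev_mul hx, ev_pow hx, ev_X hx, hg.self_of_nhds x hx,
      smul_eq_mul, mul_pow, mul_assoc]

/-- The coefficient of `x ^ k` in the derivative of the flow is an affine coordinate for the
time. -/
lemma coeff_of_expansion {k : ℕ} (hk : 1 ≤ k) {E K : ℂ → ℂ} (hK : AnalyticAt ℂ K 0)
    (hE : ∀ᶠ x in 𝓝 0, E x = x + x ^ (k + 1) * K x) {σ : ℂ} {a : AbsSeries}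
    (ha : ∀ᶠ x in 𝓝 0, ev x a = deriv E (σ * x)) : coeff k a = σ ^ k * ((k + 1) * K 0) := by
  have hd : ∀ᶠ x in 𝓝 0, deriv E x = 1 + x ^ k * ((k + 1) * K x + x * deriv K x) := by
    filter_upwards [hE.eventually_nhds, hK.eventually_analyticAt] with x h1 h2
    have h3 := (hasDerivAt_id x).fun_add
      (((hasDerivAt_id x).fun_pow (k + 1)).fun_mul h2.differentiableAt.hasDerivAt)
    rw [(h3.congr_of_eventuallyEq h1).deriv]
    simp only [id, Nat.add_sub_cancel]
    push_cast
    ring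
  have hh : AnalyticAt ℂ (fun x => σ ^ k * ((k + 1) * K (σ * x) + σ * x * deriv K (σ * x))) 0 := by
    have hl : AnalyticAt ℂ (fun x : ℂ => σ * x) 0 := analyticAt_const.fun_mul analyticAt_id
    have h1 : AnalyticAt ℂ (fun x => K (σ * x)) 0 :=
      AnalyticAt.comp (g := K) (f := fun x => σ * x) (by simpa using hK) hl
    have h2 : AnalyticAt ℂ (fun x => deriv K (σ * x)) 0 :=
      AnalyticAt.comp (g := deriv K) (f := fun x => σ * x) (by simpa using hK.deriv) hl
    exact analyticAt_const.fun_mul ((analyticAt_const.fun_mul h1).fun_add (hl.fun_mul h2))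
  have := coeff_of_eventually hk hh (a := a) ?_
  · simpa using this
  · filter_upwards [ha, (tendsto_const_mul_zero σ).eventually hd] with x h1 h2
    rw [h1, h2, mul_pow]
    ring

/-! ### Uniqueness of the conjugacy tangent to the identity -/

lemma eventually_one_add_ne_zero {k : ℕ} (hk : 1 ≤ k) {E : Type*} [TopologicalSpace E] {e : E}
    {M φ : E → ℂ} (hM : ContinuousAt M e) (hφ : ContinuousAt φ e) (hφ0 : φ e = 0) :
    ∀ᶠ q in 𝓝 e, 1 + M q * φ q ^ k ≠ 0 := by
  have h : ContinuousAt (fun q => 1 + M q * φ q ^ k) e := by fun_prop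
  refine h.eventually_ne ?_
  have : k ≠ 0 := by omega
  simp [hφ0, this]

lemma eventually_eventually_slice {Λ : Type*} [NormedAddCommGroup Λ] {P : ℂ × Λ → Prop} {l₀ : Λ}
    (h : ∀ᶠ p in 𝓝 ((0 : ℂ), l₀), P p) : ∀ᶠ l in 𝓝 l₀, ∀ᶠ x in 𝓝 (0 : ℂ), P (x, l) := by
  have : Tendsto (fun l : Λ => ((0 : ℂ), l)) (𝓝 l₀) (𝓝 (0, l₀)) :=
    Continuous.tendsto' (by fun_prop) _ _ rfl
  filter_upwards [this.eventually h.eventually_nhds] with l hl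
  exact eventually_slice hl

lemma analyticAt_normalForm {m k : ℕ} (hk : 1 ≤ k) {y : Fin k → (Fin m → ℂ) → ℂ}
    {μ : (Fin m → ℂ) → ℂ} (hc : IsNormalCoeffs y μ) : AnalyticAt ℂ (normalForm y μ) 0 := by
  have hk0 : k ≠ 0 := by omega
  have hs (h : (Fin m → ℂ) → ℂ) (hh : AnalyticAt ℂ h 0) :
      AnalyticAt ℂ (fun p : ℂ × (Fin m → ℂ) => h p.2) 0 :=
    AnalyticAt.comp (g := h) (f := fun p : ℂ × (Fin m → ℂ) => p.2) hh analyticAt_snd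
  have h1 : AnalyticAt ℂ (fun p : ℂ × (Fin m → ℂ) => p.1) 0 := analyticAt_fst
  refine ((h1.fun_pow (k + 1)).fun_add (Finset.analyticAt_fun_sum _ fun j _ =>
    (hs _ (hc.1 j).1).fun_mul (h1.fun_pow j))).fun_div
    (analyticAt_const.fun_add ((hs _ hc.2).fun_mul (h1.fun_pow k))) ?_
  simp [hk0]

/-- The primitive of the series of `χ'` is the series of `χ`. -/
lemma ev_coord_of_deriv {k : ℕ} {σ : ℂ} (hσ : σ ≠ 0) {χ : ℂ → ℂ} {a c : AbsSeries}
    (hc : ∀ x, ‖x‖ < 1 → ev x c = χ (σ * x)) (ha : ∀ x, ‖x‖ < 1 → ev x a = deriv χ (σ * x))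
    (y : Fin k → ℂ) (μ : ℂ) {x : ℂ} (hx : ‖x‖ < 1) :
    ev x (Unknown.coord ((χ 0 / σ, a, y, μ) : Unknown k)) = χ (σ * x) / σ := by
  set u : Unknown k := (χ 0 / σ, a, y, μ)
  have hball {x : ℂ} : x ∈ Metric.ball (0 : ℂ) 1 ↔ ‖x‖ < 1 := mem_ball_zero_iff
  have h := Metric.isOpen_ball.eqOn_of_deriv_eq (convex_ball (0 : ℂ) 1).isPreconnected
    (f := fun x => ev x u.coord) (g := fun x => σ⁻¹ * ev x c) (x := 0)
    (fun x hx => (hasDerivAt_ev_coord u (hball.1 hx)).differentiableAt.differentiableWithinAt)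
    (fun x hx => ((analyticAt_ev_apply analyticAt_id analyticAt_const
      (hball.1 hx)).differentiableAt.const_mul _).differentiableWithinAt) ?_ (by simp) ?_
    (hball.2 hx)
  · simp only [hc x hx] at h
    rw [h, div_eq_inv_mul]
  · intro x hx
    rw [(hasDerivAt_ev_coord u (hball.1 hx)).deriv]
    have e : (fun x => σ⁻¹ * ev x c) =ᶠ[𝓝 x] fun x => σ⁻¹ * χ (σ * x) := by
      filter_upwards [Metric.isOpen_ball.mem_nhds hx] with z hz
      rw [hc z (hball.1 hz)]
    rw [e.deriv_eq, deriv_const_mul_field, deriv_comp_mul_left, smul_eq_mul,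
      inv_mul_cancel_left₀ hσ]
    exact ha x (hball.1 hx)
  · simp only [hc 0 (by simp), mul_zero, Unknown.coord, map_add, ev_zero_apply,
      coeff_integral_zero, coeff_algebraMap, if_pos, add_zero]
    exact div_eq_inv_mul _ _

/-- A conjugacy `χ` of `F` with a normal form gives, after a dilation of ratio `σ`, a solution of
the conjugacy equation in the algebra of series. -/
lemma conjDefect_eq_zero {k : ℕ} {σ : ℂ} (hσ : σ ≠ 0) {F χ : ℂ → ℂ} {f a c : AbsSeries}
    {y : Fin k → ℂ} {μ : ℂ} (hf : ∀ x, ‖x‖ < 1 → ev x f = (σ ^ (k + 1))⁻¹ * F (σ * x))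
    (hc : ∀ x, ‖x‖ < 1 → ev x c = χ (σ * x)) (ha : ∀ x, ‖x‖ < 1 → ev x a = deriv χ (σ * x))
    (hconj : ∀ᶠ x in 𝓝 0, χ x ^ (k + 1) + ∑ j : Fin k, y j * χ x ^ (j : ℕ) =
      deriv χ x * F x * (1 + μ * χ x ^ k)) :
    conjDefect f ((χ 0 / σ, a, fun j => y j * σ ^ (j : ℕ) / σ ^ (k + 1), μ * σ ^ k) : Unknown k) =
      0 := by
  apply eq_of_eventually_ev_eq
  filter_upwards [eventually_norm_lt_one, (tendsto_const_mul_zero σ).eventually hconj] with x hx h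
  rw [ev_conjDefect f _ hx, map_zero, ev_coord_of_deriv hσ hc ha _ _ hx]
  simp only [hf x hx, ha x hx]
  have e : ∑ j : Fin k, y j * σ ^ (j : ℕ) / σ ^ (k + 1) * (χ (σ * x) / σ) ^ (j : ℕ) =
      (σ ^ (k + 1))⁻¹ * ∑ j : Fin k, y j * χ (σ * x) ^ (j : ℕ) := by
    rw [Finset.mul_sum]
    refine Finset.sum_congr rfl fun j _ => ?_
    rw [div_pow]
    field_simp
  rw [e, div_pow, div_pow, mul_assoc μ, mul_div_cancel₀ _ (pow_ne_zero k hσ)]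
  rw [eq_sub_of_add_eq h]
  field_simp
  ring

/-- The conjugacy equation with a normal form, without denominators. -/
lemma eventually_conj_polynomial {m k : ℕ} (hk : 1 ≤ k) {y : Fin k → (Fin m → ℂ) → ℂ}
    {μ : (Fin m → ℂ) → ℂ} (hc : IsNormalCoeffs y μ) {Λ : Type*} [NormedAddCommGroup Λ]
    {L : Λ → (Fin m → ℂ)} {l₀ : Λ} (hL : ContinuousAt L l₀) (hL0 : L l₀ = 0)
    {φ F : ℂ × Λ → ℂ} (hφ : ContinuousAt φ (0, l₀)) (hφ0 : φ (0, l₀) = 0)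
    (h : ∀ᶠ p in 𝓝 ((0 : ℂ), l₀), normalForm y μ (φ p, L p.2) = pderiv φ p * F p) :
    ∀ᶠ p in 𝓝 ((0 : ℂ), l₀), φ p ^ (k + 1) + ∑ j : Fin k, y j (L p.2) * φ p ^ (j : ℕ) =
      pderiv φ p * F p * (1 + μ (L p.2) * φ p ^ k) := by
  have hμ : ContinuousAt (fun p : ℂ × Λ => μ (L p.2)) (0, l₀) := by
    refine ContinuousAt.comp (g := μ) (f := fun p : ℂ × Λ => L p.2) ?_
      (ContinuousAt.comp (g := L) (f := fun p : ℂ × Λ => p.2) hL continuousAt_snd)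
    simpa [hL0] using hc.2.continuousAt
  filter_upwards [h, eventually_one_add_ne_zero hk hμ hφ hφ0] with p h1 h2
  rw [← h1, normalForm, div_mul_cancel₀ _ h2]

/-- A conjugacy between normal forms whose derivative at the origin is `1` is the flow at a suitable
time, and the normal forms are the same. -/
lemma IsConjugacy.exists_flow {m k : ℕ} (hk : 1 ≤ k) {y y' : Fin k → (Fin m → ℂ) → ℂ}
    {μ μ' : (Fin m → ℂ) → ℂ} (hc : IsNormalCoeffs y μ) (hc' : IsNormalCoeffs y' μ')
    {φ : ℂ × (Fin m → ℂ) → ℂ} (hφ : IsConjugacy (normalForm y μ) (normalForm y' μ') φ)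
    (h1 : pderiv φ 0 = 1) :
    ∃ t : (Fin m → ℂ) → ℂ, AnalyticAt ℂ t 0 ∧ IsFlowMap (normalForm y μ) t φ ∧
      ∀ᶠ l in 𝓝 0, μ' l = μ l ∧ ∀ j, y' j l = y j l := by
  have hk0 : k ≠ 0 := by omega
  have hN := analyticAt_normalForm hk hc
  have hφA := hφ.analytic
  have hφ' := analyticAt_pderiv hφA
  -- The time for the parameter `0`, read off from the coefficient of `x ^ k` in the derivative.
  obtain ⟨t₀, ht₀⟩ : ∃ t₀ : ℂ, ∀ (σ : ℂ) (a : AbsSeries),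
      (∀ᶠ x in 𝓝 0, ev x a = pderiv φ (σ * x, 0)) → coeff k a = σ ^ k * ((k + 1) * t₀) := by
    obtain ⟨ρ, ⟨g, -, hg⟩, hρ : 0 < ρ⟩ := ((exists_series (l₀ := (0 : Fin m → ℂ))
      (f := pderiv φ) hφ').and self_mem_nhdsWithin).exists
    have hρ' : (ρ : ℂ) ≠ 0 := by exact_mod_cast hρ.ne'
    refine ⟨coeff k (g 0) / ((k + 1) * (ρ : ℂ) ^ k), fun σ a ha => ?_⟩
    have h2 := scale_coeff (g := fun x => pderiv φ (x, 0)) (ρ := σ) (σ := ρ) (b := g 0) ha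
      (eventually_norm_lt_one.mono fun x hx => hg.self_of_nhds x hx) k
    have := natCast_add_one_ne_zero k
    field_simp
    linear_combination h2
  obtain ⟨v, hv, hF⟩ := exists_isFlowVelocity hk hc t₀
  have hE := hv.analyticAt_flow
  have hE' := analyticAt_pderiv hE
  have hexp := flow_expansion hk hc hv.1 hv.2.1 hF
  have hE1 : pderiv (flow v) (0, (t₀, 0)) = 1 := by
    obtain ⟨K, hK, -, hEK⟩ := hexp.self_of_nhds
    have h2 := (hasDerivAt_id (0 : ℂ)).fun_add (((hasDerivAt_id (0 : ℂ)).fun_pow (k + 1)).fun_mul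
      hK.differentiableAt.hasDerivAt)
    rw [pderiv, (h2.congr_of_eventuallyEq hEK).deriv]
    simp [hk0]
  have hE0 : flow v (0, (t₀, 0)) = 0 := by
    obtain ⟨K, hK, -, hEK⟩ := hexp.self_of_nhds
    simpa using hEK.self_of_nhds
  obtain ⟨ε, hε, hball⟩ := Metric.eventually_nhds_iff_ball.1 (conjDefect_solution_unique k)
  have hWone : Metric.ball (1 : AbsSeries) ε ∈ 𝓝 (algebraMap ℂ AbsSeries 1) := by
    rw [map_one]
    exact Metric.ball_mem_nhds _ hε
  have hσμ (c : ℂ) : ∀ᶠ σ : ℝ in 𝓝[>] 0, ‖c * (σ : ℂ) ^ k‖ < ε := by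
    have h2 : Continuous fun σ : ℝ => ‖c * (σ : ℂ) ^ k‖ := by fun_prop
    refine nhdsWithin_le_nhds (h2.continuousAt.eventually_lt_const ?_)
    simpa [hk0] using hε
  have hw : AnalyticAt ℂ (fun x : ℂ => (1 + μ 0 * x ^ k)⁻¹) 0 :=
    (analyticAt_const.fun_add (analyticAt_const.fun_mul (analyticAt_id.fun_pow k))).fun_inv
      (by simp [hk0])
  -- A dilation brings the family and both maps into the domain of the uniqueness statement.
  obtain ⟨σ, ⟨f, hf, hfW, hfev⟩, ⟨a, ha, haW, haev⟩, ⟨e, he, heW, heev⟩, ⟨c, -, hcev⟩,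
      ⟨d, -, hdev⟩, hσ1, hσ2, hσ : 0 < σ⟩ :=
    ((exists_series_near_monomial (k := k) hN hw (by simp [hk0])
      (Eventually.of_forall fun x => by simp [normalForm, (hc.1 _).2, div_eq_mul_inv])
      (Metric.ball_mem_nhds _ hε)).and
    ((exists_series_near_const (f := pderiv φ) (l₀ := 0) hφ'
      (by rwa [Prod.mk_zero_zero, h1])).and
    ((exists_series_near_const hE' (by rwa [hE1])).and
    ((exists_series (f := φ) (l₀ := 0) hφA).and ((exists_series hE).and
    ((hσμ (μ' 0)).and ((hσμ (μ 0)).and self_mem_nhdsWithin))))))).exists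
  have hσ0 : (σ : ℂ) ≠ 0 := by exact_mod_cast hσ.ne'
  have hk1 := natCast_add_one_ne_zero k
  -- The time is chosen to match the coefficient on which uniqueness depends.
  have hcoe : ∀ᶠ t in 𝓝 t₀, coeff k (e (t, 0)) = (σ : ℂ) ^ k * ((k + 1) * t) := by
    have hι : Tendsto (fun t : ℂ => (t, (0 : Fin m → ℂ))) (𝓝 t₀) (𝓝 (t₀, 0)) :=
      Continuous.tendsto' (by fun_prop) _ _ rfl
    filter_upwards [hexp, hι.eventually heev] with t ⟨K, hK, hK0, hEK⟩ h2
    have h3 := coeff_of_expansion hk hK hEK (σ := σ) (a := e (t, 0))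
      (eventually_norm_lt_one.mono fun x hx => h2 x hx)
    rwa [hK0] at h3
  have hcoa : coeff k (a 0) = (σ : ℂ) ^ k * ((k + 1) * t₀) :=
    ht₀ σ _ (eventually_norm_lt_one.mono fun x hx => haev.self_of_nhds x hx)
  obtain ⟨t, ht, ht0, -, htF⟩ := exists_analytic_implicit (p := (0 : Fin m → ℂ)) (e := t₀)
    (F := fun P : (Fin m → ℂ) × ℂ =>
      ((σ : ℂ) ^ k * (k + 1))⁻¹ * (coeff k (e (P.2, P.1)) - coeff k (a P.1)))
    (analyticAt_const.fun_mul ((((coeff k).analyticAt _).comp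
      (AnalyticAt.comp (g := e) (f := fun P : (Fin m → ℂ) × ℂ => (P.2, P.1)) he
        (analyticAt_snd.prod analyticAt_fst))).fun_sub (((coeff k).analyticAt _).comp
      (AnalyticAt.comp (g := a) (f := fun P : (Fin m → ℂ) × ℂ => P.1) ha analyticAt_fst))))
    (by simp [hcoe.self_of_nhds, hcoa]) (fun h => by
      have h2 : HasDerivAt (fun s : ℂ => t₀ + s • h - t₀) h 0 := by
        simpa using ((hasDerivAt_id (0 : ℂ)).mul_const h)
      refine h2.congr_of_eventuallyEq ?_
      have h3 : Tendsto (fun s : ℂ => t₀ + s • h) (𝓝 0) (𝓝 t₀) :=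
        Continuous.tendsto' (by fun_prop) _ _ (by simp)
      filter_upwards [h3.eventually hcoe] with s hs
      simp only [hs, hcoa]
      field_simp)
  have hT : AnalyticAt ℂ (fun l => (t l, l)) 0 := ht.prod analyticAt_id
  have hTt : Tendsto (fun l => (t l, l)) (𝓝 0) (𝓝 (t₀, 0)) := by
    have h2 := hT.continuousAt.tendsto
    rwa [ht0] at h2
  have hpair : Tendsto (fun p : ℂ × (Fin m → ℂ) => (p.1, (t p.2, p.2))) (𝓝 0)
      (𝓝 (0, (t₀, 0))) := by
    have h2 := hTt.comp ((continuous_snd (X := ℂ) (Y := Fin m → ℂ)).tendsto 0)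
    exact ((continuous_fst (X := ℂ) (Y := Fin m → ℂ)).tendsto 0).prodMk_nhds h2
  let uφ (l : Fin m → ℂ) : Unknown k :=
    (φ (0, l) / σ, a l, fun j => y' j l * (σ : ℂ) ^ (j : ℕ) / (σ : ℂ) ^ (k + 1),
      μ' l * (σ : ℂ) ^ k)
  let uE (l : Fin m → ℂ) : Unknown k :=
    (flow v (0, (t l, l)) / σ, e (t l, l),
      fun j => y j l * (σ : ℂ) ^ (j : ℕ) / (σ : ℂ) ^ (k + 1), μ l * (σ : ℂ) ^ k)
  have huφ : ContinuousAt uφ 0 := by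
    refine ContinuousAt.prodMk ?_ (ha.continuousAt.prodMk (ContinuousAt.prodMk ?_ ?_))
    · exact ContinuousAt.div_const (ContinuousAt.comp (g := φ)
        (f := fun l : Fin m → ℂ => ((0 : ℂ), l)) hφA.continuousAt (by fun_prop)) _
    · refine continuousAt_pi.2 fun j => ?_
      exact ((hc'.1 j).1.continuousAt.mul_const _).div_const _
    · exact hc'.2.continuousAt.mul_const _
  have huE : ContinuousAt uE 0 := by
    refine ContinuousAt.prodMk ?_ (ContinuousAt.prodMk ?_ (ContinuousAt.prodMk ?_ ?_))
    · refine ContinuousAt.div_const ?_ _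
      refine ContinuousAt.comp (g := flow v) (f := fun l => ((0 : ℂ), (t l, l))) ?_
        (continuousAt_const.prodMk hT.continuousAt)
      rw [ht0]
      exact hE.continuousAt
    · refine ContinuousAt.comp (g := e) (f := fun l => (t l, l)) ?_ hT.continuousAt
      rw [ht0]
      exact he.continuousAt
    · refine continuousAt_pi.2 fun j => ?_
      exact ((hc.1 j).1.continuousAt.mul_const _).div_const _
    · exact hc.2.continuousAt.mul_const _
  have hnear : ∀ᶠ l in 𝓝 0, (f l, uφ l, uE l) ∈
      Metric.ball (X ^ (k + 1), Unknown.base k, Unknown.base k) ε := by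
    refine (hf.continuousAt.prodMk (huφ.prodMk huE)).eventually_mem
      (Metric.isOpen_ball.mem_nhds ?_)
    have e1 : uφ 0 = (0, a 0, 0, μ' 0 * (σ : ℂ) ^ k) := by
      have : φ (0, 0) = 0 := hφ.map_zero
      simp [uφ, this, (hc'.1 _).2, funext_iff]
    have e2 : uE 0 = (0, e (t₀, 0), 0, μ 0 * (σ : ℂ) ^ k) := by
      simp [uE, ht0, hE0, (hc.1 _).2, funext_iff]
    simp only [e1, e2, Unknown.base, Metric.mem_ball, Prod.dist_eq, max_lt_iff, dist_self,
      dist_zero_right] at *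
    exact ⟨hfW, ⟨hε, haW, hε, hσ1⟩, ⟨hε, heW, hε, hσ2⟩⟩
  have hcφ := eventually_eventually_slice (eventually_conj_polynomial hk hc' (L := id) (l₀ := 0)
    continuousAt_id rfl hφA.continuousAt hφ.map_zero hφ.eventually)
  have hcE := eventually_eventually_slice (eventually_conj_polynomial hk hc
    (L := fun q : ℂ × (Fin m → ℂ) => q.2) continuousAt_snd rfl hE.continuousAt hE0
    (F := fun q => normalForm y μ (q.1, q.2.2)) (hv.flow_conj hN))
  have hkey : ∀ᶠ l in 𝓝 0, (∀ x : ℂ, ‖x‖ < 1 → φ (σ * x, l) = flow v (σ * x, (t l, l))) ∧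
      μ' l = μ l ∧ ∀ j, y' j l = y j l := by
    filter_upwards [hnear, htF, hcφ, hTt.eventually hcE, hfev, haev, hTt.eventually heev, hcev,
      hTt.eventually hdev] with l h2 h3 h4 h5 h6 h7 h8 h9 h10
    have hf' : ∀ x, ‖x‖ < 1 →
        ev x (f l) = ((σ : ℂ) ^ (k + 1))⁻¹ * (fun x => normalForm y μ (x, l)) (σ * x) := by
      intro x hx
      simpa [hk0] using h6 x hx
    have d1 : conjDefect (f l) (uφ l) = 0 :=
      conjDefect_eq_zero hσ0 (χ := fun x => φ (x, l)) hf' h9 h7 h4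
    have d2 : conjDefect (f l) (uE l) = 0 :=
      conjDefect_eq_zero hσ0 (χ := fun x => flow v (x, (t l, l))) hf' h10 h8 h5
    have hcoeff : coeff k (uφ l).2.1 = coeff k (uE l).2.1 := by
      have h11 := (mul_eq_zero.1 h3).resolve_left
        (inv_ne_zero (mul_ne_zero (pow_ne_zero k hσ0) hk1))
      exact (sub_eq_zero.1 h11).symm
    have hu : uφ l = uE l := hball _ h2 d1 d2 hcoeff
    refine ⟨fun x hx => ?_, ?_, fun j => ?_⟩
    · have g1 := ev_coord_of_deriv hσ0 (χ := fun x => φ (x, l)) h9 h7 (uφ l).2.2.1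
        (uφ l).2.2.2 hx
      have g2 := ev_coord_of_deriv hσ0 (χ := fun x => flow v (x, (t l, l))) h10 h8
        (uE l).2.2.1 (uE l).2.2.2 hx
      change ev x (uφ l).coord = _ at g1
      change ev x (uE l).coord = _ at g2
      rw [hu, g2] at g1
      exact ((div_left_inj' hσ0).1 g1).symm
    · have g1 := congrArg (fun u : Unknown k => u.2.2.2) hu
      exact mul_right_cancel₀ (pow_ne_zero k hσ0) g1
    · have g1 := congrFun (congrArg (fun u : Unknown k => u.2.2.1) hu) j
      have g2 := (div_left_inj' (pow_ne_zero (k + 1) hσ0)).1 g1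
      exact mul_right_cancel₀ (pow_ne_zero _ hσ0) g2
  have hφE : ∀ᶠ p in 𝓝 (0 : ℂ × (Fin m → ℂ)), φ p = flow v (p.1, (t p.2, p.2)) := by
    have h2 : Tendsto (fun p : ℂ × (Fin m → ℂ) => (σ : ℂ)⁻¹ * p.1) (𝓝 0) (𝓝 0) :=
      Continuous.tendsto' (by fun_prop) _ _ (by simp)
    filter_upwards [h2.eventually eventually_norm_lt_one,
      ((continuous_snd (X := ℂ) (Y := Fin m → ℂ)).tendsto 0).eventually hkey] with p h3 h4
    have h5 := h4.1 _ h3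
    rwa [mul_inv_cancel_left₀ hσ0] at h5
  refine ⟨t, ht, fun V hV => ?_, hkey.mono fun l hl => hl.2⟩
  filter_upwards [hφE, hpair.eventually (hv.exists_integralCurve hV)] with p h2 h3
  rw [h2]
  exact h3

end AbsSeriesFlow

/-! ### Rotations -/

/-- The root of unity `exp (2πi l / k)`. -/
def unityRoot (k l : ℕ) : ℂ := exp (2 * (Real.pi : ℂ) * I * (l : ℂ) / (k : ℂ))

lemma unityRoot_eq_pow (k l : ℕ) : unityRoot k l = exp (2 * (Real.pi : ℂ) * I / (k : ℂ)) ^ l := by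
  rw [unityRoot, ← Complex.exp_nat_mul]
  congr 1
  ring

lemma unityRoot_ne_zero (k l : ℕ) : unityRoot k l ≠ 0 := exp_ne_zero _

lemma unityRoot_pow {k : ℕ} (hk : 1 ≤ k) (l : ℕ) : unityRoot k l ^ k = 1 := by
  rw [unityRoot_eq_pow, pow_right_comm,
    (Complex.isPrimitiveRoot_exp k (by omega)).pow_eq_one, one_pow]

lemma exists_unityRoot_eq {k : ℕ} (hk : 1 ≤ k) {a : ℂ} (ha : a ^ k = 1) :
    ∃ l : Fin k, unityRoot k l = a := by
  have : NeZero k := ⟨by omega⟩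
  obtain ⟨i, hi, h⟩ := (Complex.isPrimitiveRoot_exp k (by omega)).eq_pow_of_pow_eq_one ha
  exact ⟨⟨i, hi⟩, by rw [unityRoot_eq_pow, ← h]⟩

lemma exp_rotation (k l j : ℕ) :
    exp (-(2 * (Real.pi : ℂ) * I * ((j : ℂ) - 1) * (l : ℂ) / (k : ℂ))) =
      unityRoot k l * (unityRoot k l ^ j)⁻¹ := by
  rw [unityRoot, ← Complex.exp_nat_mul, ← Complex.exp_neg, ← Complex.exp_add]
  congr 1
  ring

/-- The homothety by a `k`-th root of unity `c` multiplies `yⱼ` by `c ^ (1 - j)`. -/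
lemma normalForm_rotate {m k : ℕ} {c : ℂ} (hc : c ^ k = 1) (hc0 : c ≠ 0)
    (y : Fin k → (Fin m → ℂ) → ℂ) (μ : (Fin m → ℂ) → ℂ) (p : ℂ × (Fin m → ℂ)) :
    normalForm (fun j l => c * (c ^ (j : ℕ))⁻¹ * y j l) μ (c * p.1, p.2) =
      c * normalForm y μ p := by
  simp only [normalForm, mul_pow, pow_succ, hc, one_mul]
  rw [mul_div_assoc']
  congr 1
  rw [mul_add, Finset.mul_sum]
  congr 1
  · ring
  · refine Finset.sum_congr rfl fun j _ => ?_
    field_simp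

/-- The linear part at the origin of a conjugacy between normal forms is a rotation: compare the
leading coefficients for the parameter `0`. -/
lemma IsConjugacy.pderiv_pow_eq_one {m k : ℕ} (hk : 1 ≤ k) {y y' : Fin k → (Fin m → ℂ) → ℂ}
    {μ μ' : (Fin m → ℂ) → ℂ} (hc : IsNormalCoeffs y μ) (hc' : IsNormalCoeffs y' μ')
    {φ : ℂ × (Fin m → ℂ) → ℂ} (hφ : IsConjugacy (normalForm y μ) (normalForm y' μ') φ) :
    pderiv φ 0 ^ k = 1 := by
  have hk0 : k ≠ 0 := by omega
  let χ : ℂ → ℂ := fun x => φ (x, 0)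
  have hχ : AnalyticAt ℂ χ 0 := analyticAt_slice hφ.analytic
  have hχ0 : χ 0 = 0 := hφ.map_zero
  have hconj := eventually_slice (p := (0 : ℂ × (Fin m → ℂ))) hφ.eventually
  have hd1 : ∀ᶠ x in 𝓝 (0 : ℂ), 1 + μ 0 * id x ^ k ≠ 0 :=
    eventually_one_add_ne_zero hk continuousAt_const continuousAt_id rfl
  have hd2 : ∀ᶠ x in 𝓝 (0 : ℂ), 1 + μ' 0 * χ x ^ k ≠ 0 :=
    eventually_one_add_ne_zero hk continuousAt_const hχ.continuousAt hχ0
  have hs : ContinuousAt (dslope χ 0) 0 := continuousAt_dslope_same.2 hχ.differentiableAt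
  have hL : ContinuousAt (fun x => dslope χ 0 x ^ (k + 1) * (1 + μ 0 * x ^ k)) 0 := by fun_prop
  have hR : ContinuousAt (fun x => deriv χ x * (1 + μ' 0 * χ x ^ k)) 0 := by
    have h1 := hχ.deriv.continuousAt
    have h2 := hχ.continuousAt
    fun_prop
  have heq : (fun x => dslope χ 0 x ^ (k + 1) * (1 + μ 0 * x ^ k)) =ᶠ[𝓝[≠] 0]
      fun x => deriv χ x * (1 + μ' 0 * χ x ^ k) := by
    filter_upwards [nhdsWithin_le_nhds hconj, nhdsWithin_le_nhds hd1, nhdsWithin_le_nhds hd2,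
      self_mem_nhdsWithin] with x h1 h2 h3 (hx : x ≠ 0)
    have h4 : χ x = x * dslope χ 0 x := by
      have := sub_smul_dslope χ 0 x
      simpa [hχ0] using this.symm
    have h5 : χ x ^ (k + 1) / (1 + μ' 0 * χ x ^ k) =
        deriv χ x * (x ^ (k + 1) / (1 + μ 0 * x ^ k)) := by
      simpa [normalForm, (hc.1 _).2, (hc'.1 _).2, χ, pderiv] using h1
    simp only [id] at h2
    rw [div_eq_iff h3, mul_div_assoc', div_mul_eq_mul_div, eq_div_iff h2] at h5
    refine mul_left_cancel₀ (pow_ne_zero (k + 1) hx) ?_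
    have h6 : χ x ^ (k + 1) = x ^ (k + 1) * dslope χ 0 x ^ (k + 1) := by rw [h4, mul_pow]
    rw [h6] at h5
    linear_combination h5
  have hlim := tendsto_nhds_unique_of_eventuallyEq (hL.tendsto.mono_left nhdsWithin_le_nhds)
    (hR.tendsto.mono_left nhdsWithin_le_nhds) heq
  have hne : deriv χ 0 ≠ 0 := hφ.pderiv_ne_zero
  simp only [dslope_same, hχ0, zero_pow hk0, mul_zero, add_zero, mul_one, pow_succ] at hlim
  exact (mul_eq_right₀ hne).1 hlim

/-- A conjugacy between normal forms is the flow map followed by a rotation. -/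
lemma IsConjugacy.exists_rotated_flow {m k : ℕ} (hk : 1 ≤ k) {y y' : Fin k → (Fin m → ℂ) → ℂ}
    {μ μ' : (Fin m → ℂ) → ℂ} (hc : IsNormalCoeffs y μ) (hc' : IsNormalCoeffs y' μ')
    {φ : ℂ × (Fin m → ℂ) → ℂ} (hφ : IsConjugacy (normalForm y μ) (normalForm y' μ') φ) :
    ∃ (l : Fin k) (t : (Fin m → ℂ) → ℂ) (Ψ : ℂ × (Fin m → ℂ) → ℂ),
      IsRotated l y μ y' μ' ∧ AnalyticAt ℂ t 0 ∧ IsFlowMap (normalForm y μ) t Ψ ∧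
      ∀ᶠ p in 𝓝 (0 : ℂ × (Fin m → ℂ)),
        φ p = exp (2 * (Real.pi : ℂ) * I * ((l : ℕ) : ℂ) / (k : ℂ)) * Ψ p := by
  obtain ⟨l, hl⟩ := exists_unityRoot_eq hk (hφ.pderiv_pow_eq_one hk hc hc')
  have hζ0 := unityRoot_ne_zero k l
  have hζk := unityRoot_pow hk l
  set ζ := unityRoot k l
  have hinv : ζ⁻¹ ^ k = 1 := by rw [inv_pow, hζk, inv_one]
  have hφ2 := hφ.const_mul (inv_ne_zero hζ0) (Eventually.of_forall
    fun p => normalForm_rotate hinv (inv_ne_zero hζ0) y' μ' p)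
  have hd : pderiv (fun p => ζ⁻¹ * φ p) 0 = 1 := by
    rw [show pderiv (fun p => ζ⁻¹ * φ p) 0 = ζ⁻¹ * pderiv φ 0 from
      ((hasDerivAt_pderiv hφ.analytic).const_mul ζ⁻¹).deriv, ← hl, inv_mul_cancel₀ hζ0]
  obtain ⟨t, ht, hflow, heq⟩ := hφ2.exists_flow hk hc
    ⟨fun j => ⟨analyticAt_const.mul (hc'.1 j).1, by simp [(hc'.1 j).2]⟩, hc'.2⟩ hd
  refine ⟨l, t, _, heq.mono fun lam h => ⟨h.1, fun j => ?_⟩, ht, hflow,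
    Eventually.of_forall fun p => ?_⟩
  · rw [exp_rotation, ← h.2 j]
    change _ = ζ * (ζ ^ (j : ℕ))⁻¹ * (ζ⁻¹ * (ζ⁻¹ ^ (j : ℕ))⁻¹ * y' j lam)
    rw [inv_pow, inv_inv]
    field_simp
  · exact (mul_inv_cancel_left₀ hζ0 _).symm

lemma IsConjugacy.areConjugate_of_isRotated {m k : ℕ} (hk : 1 ≤ k)
    {y y' : Fin k → (Fin m → ℂ) → ℂ} {μ μ' : (Fin m → ℂ) → ℂ} {f φ : ℂ × (Fin m → ℂ) → ℂ}
    (hφ : IsConjugacy f (normalForm y μ) φ) {l : Fin k} (h : IsRotated l y μ y' μ') :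
    AreConjugate f (normalForm y' μ') := by
  refine ⟨_, (hφ.const_mul (unityRoot_ne_zero k l) (Eventually.of_forall
    fun p => normalForm_rotate (unityRoot_pow hk l) (unityRoot_ne_zero k l) y μ p)).congr ?_⟩
  filter_upwards [((continuous_snd (X := ℂ) (Y := Fin m → ℂ)).tendsto 0).eventually h]
    with p hp
  simp only [normalForm, hp.1, hp.2, exp_rotation]

lemma areConjugate_normalForm_iff {m k : ℕ} (hk : 1 ≤ k) {y y' : Fin k → (Fin m → ℂ) → ℂ}
    {μ μ' : (Fin m → ℂ) → ℂ} (hc : IsNormalCoeffs y μ) (hc' : IsNormalCoeffs y' μ')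
    {f : ℂ × (Fin m → ℂ) → ℂ} (hf : AreConjugate f (normalForm y μ)) :
    AreConjugate f (normalForm y' μ') ↔ ∃ l : Fin k, IsRotated l y μ y' μ' := by
  obtain ⟨φ, hφ⟩ := hf
  refine ⟨fun ⟨χ, hχ⟩ => ?_, fun ⟨l, hl⟩ => hφ.areConjugate_of_isRotated hk hl⟩
  obtain ⟨ψ, hψ⟩ := hφ.areConjugate hχ
  obtain ⟨l, _, _, hl, _⟩ := hψ.exists_rotated_flow hk hc hc'
  exact ⟨l, hl⟩

end Kostov

end

theorem theorem2 (m : ℕ) :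
    -- (i) existence of the normal form
    (∀ (k : ℕ) (ω : ℂ → ℂ) (f : ℂ × (Fin m → ℂ) → ℂ),
      AnalyticAt ℂ ω 0 → ω 0 ≠ 0 → Kostov.Unfolds f k ω →
      (k = 0 → ∃ c : (Fin m → ℂ) → ℂ,
        Kostov.IsLinearCoeff c ∧ Kostov.AreConjugate f (Kostov.linearForm c)) ∧
      (1 ≤ k → ∃ (y : Fin k → (Fin m → ℂ) → ℂ) (μ : (Fin m → ℂ) → ℂ),
        Kostov.IsNormalCoeffs y μ ∧ Kostov.AreConjugate f (Kostov.normalForm y μ) ∧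
        (∀ᶠ lam in 𝓝 (0 : Fin m → ℂ),
          μ lam = -Kostov.residueAtInfinity (fun x => (Kostov.normalForm y μ (x, lam))⁻¹)) ∧
        Kostov.IsResidueSum f μ)) ∧
    -- (ii) uniqueness of the normal form, `k = 0`
    (∀ c c' : (Fin m → ℂ) → ℂ, Kostov.IsLinearCoeff c → Kostov.IsLinearCoeff c' →
      (∀ f : ℂ × (Fin m → ℂ) → ℂ, AnalyticAt ℂ f 0 →
        Kostov.AreConjugate f (Kostov.linearForm c) →
        (Kostov.AreConjugate f (Kostov.linearForm c') ↔ c' =ᶠ[𝓝 0] c)) ∧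
      (∀ φ : ℂ × (Fin m → ℂ) → ℂ,
        Kostov.IsConjugacy (Kostov.linearForm c) (Kostov.linearForm c') φ →
        ∃ t : (Fin m → ℂ) → ℂ, AnalyticAt ℂ t 0 ∧
          ∀ᶠ p in 𝓝 (0 : ℂ × (Fin m → ℂ)), φ p = exp (t p.2) * p.1)) ∧
    -- (ii) uniqueness of the normal form up to rotation, `k ≥ 1`
    (∀ k : ℕ, 1 ≤ k → ∀ (y y' : Fin k → (Fin m → ℂ) → ℂ) (μ μ' : (Fin m → ℂ) → ℂ),
      Kostov.IsNormalCoeffs y μ → Kostov.IsNormalCoeffs y' μ' →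
      (∀ f : ℂ × (Fin m → ℂ) → ℂ, AnalyticAt ℂ f 0 →
        Kostov.AreConjugate f (Kostov.normalForm y μ) →
        (Kostov.AreConjugate f (Kostov.normalForm y' μ') ↔
          ∃ l : Fin k, Kostov.IsRotated l y μ y' μ')) ∧
      (∀ φ : ℂ × (Fin m → ℂ) → ℂ,
        Kostov.IsConjugacy (Kostov.normalForm y μ) (Kostov.normalForm y' μ') φ →
        ∃ (l : Fin k) (t : (Fin m → ℂ) → ℂ) (Ψ : ℂ × (Fin m → ℂ) → ℂ),
          Kostov.IsRotated l y μ y' μ' ∧ AnalyticAt ℂ t 0 ∧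
          Kostov.IsFlowMap (Kostov.normalForm y μ) t Ψ ∧
          ∀ᶠ p in 𝓝 (0 : ℂ × (Fin m → ℂ)),
            φ p = exp (2 * (Real.pi : ℂ) * I * ((l : ℕ) : ℂ) / (k : ℂ)) * Ψ p)) := by
  refine ⟨fun k ω f hω hω0 hf => ⟨?_, fun hk => ?_⟩, fun c c' hc _ =>
    ⟨fun f _ hfc => Kostov.areConjugate_linearForm_iff hc hfc, fun φ hφ => hφ.exists_exp hc⟩,
    fun k hk y y' μ μ' hc hc' => ⟨fun f _ hf => Kostov.areConjugate_normalForm_iff hk hc hc' hf,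
      fun φ hφ => hφ.exists_rotated_flow hk hc hc'⟩⟩
  · rintro rfl
    exact Kostov.exists_linearForm hω hω0 hf
  · obtain ⟨y, μ, hc, φ, hφ⟩ := Kostov.exists_normalForm hk hω hω0 hf
    exact ⟨y, μ, hc, ⟨φ, hφ⟩, Eventually.of_forall (Kostov.residueAtInfinity_normalForm hk y μ),
      hφ.isResidueSum hk hc⟩
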